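/- **Setting.** Let $F$ be a completion of a number field at a place $\nu$, i.e. $F=\mathbb R$, $F=\mathbb C$, or a finite extension of some $\mathbb Q_p$. Let $|x|$ be its module ($d(tx)=|t|\,dx$), let $\lambda(x)=\exp(2\pi i\{\mathrm{Tr}_{F/\mathbb Q_p}x\})$ at a finite place ($\{a\}$ the polar part of $a\in\mathbb Q_p$), resp. $\lambda(x)=\exp(-2\pi i\,\mathrm{Tr}_{F/\mathbb R}x)$ at an archimedean one, and let $dx$ be the unique additive Haar measure that is self-dual for $\mathcal F(\varphi)(y)=\int_F\varphi(x)\lambda(-yx)\,dx$, i.e. $\mathcal F\mathcal F\varphi(x)=\varphi(-x)$. Let $\mathcal S$ be the space of Schwartz–Bruhat functions on $F$ and $\mathcal S^{*}\subset\mathcal S$ the subspace of those that vanish identically in a neighbourhood of $0$. Put $A\varphi(x)=\log|x|\,\varphi(x)$, $B=\mathcal F A\mathcal F^{-1}$, $H=A+B$ (conductor operator), $K=i[B,A]$ (commutator operator), $K_1=iK=[A,H]$ and $K_{N+1}=[A,K_N]$ for $N\ge1$. An operator $O$ acts on a function $T$, viewed as the distribution $\alpha\mapsto\int T\alpha\,dx$,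 by transposition: $O(T)(\alpha)=\int T\,O'(\alpha)\,dx$, where $O'$ is the transpose of $O$ on the space of test functions, $\int O(\alpha)\beta\,dx=\int\alpha\, O'(\beta)\,dx$, all integrals being absolutely convergent. The test functions are those in $\mathcal S$ for $H$ (distributions on $F$) and those in $\mathcal S^{*}$ for $K$ and the $K_N$ (distributions on the punctured field $F\setminus\{0\}$). **Statement.** Let $\chi:F^\times\to U(1)$ be a continuous unitary character. For $0<\mathrm{Re}\,s<1$ there is a unique number $\Gamma(\chi,s)$ with $$\int_F\mathcal F(\alpha)(y)\,\chi(y)|y|^{s-1}\,dy=\Gamma(\chi,s)\int_F\alpha(x)\,\chi^{-1}(x)|x|^{-s}\,dx\qquad(\alpha\in\mathcal S),$$ and $s\mapsto\Gamma(\chi,s)$ is analytic without zeros in this strip. With $\frac{\partial}{\partial s}\log\Gamma(\chi,s):=\Gamma'(\chi,s)/\Gamma(\chi,s)$ and its successive derivatives, for every $s$ with $0<\mathrm{Re}\,s<1$: 1. $H(\chi^{-1}(x)|x|^{-s})=\frac{\partial}{\partial s}\log\Gamma(\chi,s)\cdot\chi^{-1}(x)|x|^{-s}$ as distributions on $F$;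 2. $K(\chi^{-1}(x)|x|^{-s})=-i\,\frac{\partial^2}{\partial s^2}\log\Gamma(\chi,s)\cdot\chi^{-1}(x)|x|^{-s}$ as distributions on $F\setminus\{0\}$; 3. $K_N(\chi^{-1}(x)|x|^{-s})=\frac{\partial^{N+1}}{\partial s^{N+1}}\log\Gamma(\chi,s)\cdot\chi^{-1}(x)|x|^{-s}$ as distributions on $F\setminus\{0\}$, for every $N\ge1$. Moreover, for every $N\ge1$ the operator $K_N$, with initial domain $\mathcal S^{*}$, is bounded on $L^2(F,dx)$. -/

import Mathlib

open MeasureTheory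
open scoped SchwartzMap NNReal ENNReal

noncomputable section

/-! ### The local fields and their basic additive character -/

/-- Every `p`-adic number differs from a number `m / p ^ n` with `0 ≤ m < p ^ n` by a `p`-adic
integer. -/
theorem padic_exists_polarPart (p : ℕ) [Fact p.Prime] (a : ℚ_[p]) :
    ∃ r : ℚ, (∃ m n : ℕ, m < p ^ n ∧ r = (m : ℚ) / (p : ℚ) ^ n) ∧ ‖a - (r : ℚ_[p])‖ ≤ 1 := by
  have hp : p.Prime := Fact.out
  have hp1 : (1 : ℝ) < p := by exact_mod_cast hp.one_lt
  have hp0 : (0 : ℝ) < p := by linarith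
  obtain ⟨n, hn⟩ := pow_unbounded_of_one_lt ‖a‖ hp1
  have hy : ‖a * (p : ℚ_[p]) ^ n‖ ≤ 1 := by
    rw [norm_mul, norm_pow, Padic.norm_p, inv_pow, ← div_eq_mul_inv,
      div_le_one (by positivity)]
    exact hn.le
  obtain ⟨y, hya⟩ : ∃ y : ℤ_[p], (y : ℚ_[p]) = a * (p : ℚ_[p]) ^ n := ⟨⟨_, hy⟩, rfl⟩
  refine ⟨((y.appr n : ℕ) : ℚ) / (p : ℚ) ^ n, ⟨_, n, PadicInt.appr_lt _ n, rfl⟩, ?_⟩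
  have h := PadicInt.appr_spec n y
  rw [← PadicInt.norm_le_pow_iff_mem_span_pow, PadicInt.norm_def, PadicInt.coe_sub,
    PadicInt.coe_natCast, hya] at h
  have hpq : ((p : ℚ_[p]) ^ n) ≠ 0 := pow_ne_zero _ (by exact_mod_cast hp.ne_zero)
  have e : a - ((((y.appr n : ℕ) : ℚ) / (p : ℚ) ^ n : ℚ) : ℚ_[p])
      = (a * (p : ℚ_[p]) ^ n - ((y.appr n : ℕ) : ℚ_[p])) / (p : ℚ_[p]) ^ n := by
    push_cast
    field_simp
  rw [e, norm_div, norm_pow, Padic.norm_p, div_le_one (by positivity)]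
  simpa using h

/-- The polar part `{a}` of a `p`-adic number `a`: the rational number `m / p ^ n` in `[0, 1)`
such that `a - {a}` is a `p`-adic integer. -/
def padicPolarPart (p : ℕ) [Fact p.Prime] (a : ℚ_[p]) : ℚ :=
  (padic_exists_polarPart p a).choose

/-- The ways in which a normed field `F` is a completion of a number field: a finite extension
of `ℝ` (that is, `ℝ` or `ℂ`) or a finite extension of some `ℚ_[p]`, with a norm that extends the
usual absolute value of the base field. -/
inductive LocalPlace (F : Type*) [NormedField F] : Type _
  | archimedean [alg : NormedAlgebra ℝ F] [fin : FiniteDimensional ℝ F] : LocalPlace F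
  | finite (p : ℕ) [hp : Fact p.Prime] [alg : NormedAlgebra ℚ_[p] F]
      [fin : FiniteDimensional ℚ_[p] F] : LocalPlace F

namespace LocalPlace

variable {F : Type*} [NormedField F]

/-- The degree of `F` over `ℝ` or over `ℚ_[p]`. -/
def degree : LocalPlace F → ℕ
  | @archimedean _ _ _ _ => Module.finrank ℝ F
  | @finite _ _ p _ _ _ => Module.finrank ℚ_[p] F

/-- The module `|x|_ν`, i.e. the absolute value with `d(tx) = |t|_ν dx` for an additive Haar
measure `dx`. It is the usual absolute value on `ℝ`, it is `z * conj z` on `ℂ`, and it gives the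
value `1 / q` to a uniformizer at a finite place with residue field of cardinality `q`. -/
def modulus (ν : LocalPlace F) (x : F) : ℝ := ‖x‖ ^ ν.degree

/-- The basic additive character `λ(x) = exp(2πi {Tr x})` at a finite place,
`λ(x) = exp(-2πi Tr x)` at an archimedean one. -/
def basicChar : LocalPlace F → F → ℂ
  | @archimedean _ _ _ _, x =>
      Complex.exp (-(2 * Real.pi * Complex.I * (Algebra.trace ℝ F x : ℝ)))
  | @finite _ _ p _ _ _, x =>
      Complex.exp (2 * Real.pi * Complex.I * (padicPolarPart p (Algebra.trace ℚ_[p] F x) : ℚ))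

/-- The Schwartz-Bruhat functions on `F`: Schwartz functions at an archimedean place, locally
constant functions with compact support at a finite place. -/
def schwartzBruhat : LocalPlace F → Set (F → ℂ)
  | @archimedean _ _ _ _ => {φ | ∃ f : 𝓢(F, ℂ), ⇑f = φ}
  | @finite _ _ _ _ _ _ => {φ | IsLocallyConstant φ ∧ HasCompactSupport φ}

/-- The Schwartz-Bruhat functions on `F` which vanish identically in a neighborhood of the
origin: the test functions on the punctured field. -/
def schwartzBruhatPunctured (ν : LocalPlace F) : Set (F → ℂ) :=
  {φ | φ ∈ ν.schwartzBruhat ∧ (0 : F) ∉ tsupport φ}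

/-! ### Fourier transform and self-dual measure -/

variable [MeasurableSpace F]

/-- `∫ φ(x) λ(-yx) dμ(x)`. -/
def fourierWith (ν : LocalPlace F) (μ : Measure F) (φ : F → ℂ) (y : F) : ℂ :=
  ∫ x, φ x * ν.basicChar (-(y * x)) ∂μ

/-- `μ` is an additive Haar measure on `F` which is self-dual for the character `λ`. -/
def IsSelfDualHaar (ν : LocalPlace F) (μ : Measure F) : Prop :=
  μ.IsAddHaarMeasure ∧
    ∀ φ ∈ ν.schwartzBruhat, ∀ x, ν.fourierWith μ (ν.fourierWith μ φ) x = φ (-x)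

/-- The self-dual Haar measure `dx`. -/
def haar (ν : LocalPlace F) : Measure F := Classical.epsilon fun μ => ν.IsSelfDualHaar μ

/-- The Fourier transform `ℱ(φ)(y) = ∫ φ(x) λ(-yx) dx`. -/
def fourier (ν : LocalPlace F) (φ : F → ℂ) : F → ℂ :=
  ν.fourierWith ν.haar φ

/-- The inverse Fourier transform `ℱ⁻¹(ψ)(x) = ∫ ψ(y) λ(xy) dy`. -/
def fourierInv (ν : LocalPlace F) (ψ : F → ℂ) (x : F) : ℂ :=
  ∫ y, ψ y * ν.basicChar (x * y) ∂ν.haar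

/-! ### The operators `A`, `B`, `H`, `K` and `K_N` -/

/-- `A`: multiplication with `log |x|`. -/
def opA (ν : LocalPlace F) (φ : F → ℂ) (x : F) : ℂ := (Real.log (ν.modulus x) : ℂ) * φ x

/-- `B = ℱ A ℱ⁻¹`. -/
def opB (ν : LocalPlace F) (φ : F → ℂ) : F → ℂ := ν.fourier (ν.opA (ν.fourierInv φ))

/-- The conductor operator `H = A + B`. -/
def conductorOp (ν : LocalPlace F) (φ : F → ℂ) : F → ℂ := ν.opA φ + ν.opB φ

/-- The commutator operator `K = i [B, A]`. -/
def commutatorOp (ν : LocalPlace F) (φ : F → ℂ) : F → ℂ :=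
  Complex.I • (ν.opB (ν.opA φ) - ν.opA (ν.opB φ))

/-- The higher commutators: `K_0 = H`, `K_{N + 1} = [A, K_N]`; in particular `K_1 = [A, H]`. -/
def higherCommutator (ν : LocalPlace F) : ℕ → (F → ℂ) → F → ℂ
  | 0, φ => ν.conductorOp φ
  | N + 1, φ => ν.opA (ν.higherCommutator N φ) - ν.higherCommutator N (ν.opA φ)

/-! ### Homogeneous functions and the Gamma function -/

open Classical in
/-- The function `x ↦ χ(x) |x|^s` on `F` (with the value `0` at the origin). -/
def homogeneous (ν : LocalPlace F) (χ : Fˣ →ₜ* Circle) (s : ℂ) (x : F) : ℂ :=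
  if hx : x = 0 then 0 else (χ (Units.mk0 x hx) : ℂ) * (ν.modulus x : ℂ) ^ s

/-- `c` is the proportionality factor in `ℱ(χ(y) |y|^{s-1}) = c · χ⁻¹(x) |x|^{-s}`, an identity
of distributions on `F` (for `0 < Re s < 1`). -/
def IsGammaFactor (ν : LocalPlace F) (χ : Fˣ →ₜ* Circle) (s c : ℂ) : Prop :=
  ∀ α ∈ ν.schwartzBruhat,
    ∫ y, ν.fourier α y * ν.homogeneous χ (s - 1) y ∂ν.haar =
      c * ∫ x, α x * ν.homogeneous χ⁻¹ (-s) x ∂ν.haar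

/-- The Tate-Gel'fand-Graev Gamma function `Γ(χ, s)`, for `s` in the critical strip. -/
def gamma (ν : LocalPlace F) (χ : Fˣ →ₜ* Circle) (s : ℂ) : ℂ :=
  Classical.epsilon fun c => ν.IsGammaFactor χ s c

/-! ### Operators acting on distributions, boundedness -/

/-- `O'` is the transpose of the operator `O` on the space `D` of test functions:
`∫ O(α) β dx = ∫ α O'(β) dx` for `α`, `β` in `D`, with absolutely convergent integrals. -/
def IsTransposeOn (ν : LocalPlace F) (D : Set (F → ℂ)) (O O' : (F → ℂ) → F → ℂ) : Prop :=
  ∀ α ∈ D, ∀ β ∈ D,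
    Integrable (fun x => O α x * β x) ν.haar ∧ Integrable (fun x => α x * O' β x) ν.haar ∧
      ∫ x, O α x * β x ∂ν.haar = ∫ x, α x * O' β x ∂ν.haar

/-- `O(T) = c · T` as distributions, with `D` as the space of test functions. Here `T` is a
function identified with the distribution `α ↦ ∫ T α dx`, and `O` acts on it by transposition:
`O(T)` is the distribution `α ↦ ∫ T O'(α) dx` where `O'` is the transpose of `O` on `D` (which is
unique up to null sets). All the integrals are absolutely convergent. -/
def DistributionEigen (ν : LocalPlace F) (D : Set (F → ℂ)) (O : (F → ℂ) → F → ℂ)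
    (T : F → ℂ) (c : ℂ) : Prop :=
  ∃ O' : (F → ℂ) → F → ℂ, ν.IsTransposeOn D O O' ∧
    ∀ α ∈ D, Integrable (fun x => T x * α x) ν.haar ∧ Integrable (fun x => T x * O' α x) ν.haar ∧
      ∫ x, T x * O' α x ∂ν.haar = c * ∫ x, T x * α x ∂ν.haar

/-- `O` with initial domain `D` is a bounded operator on the Hilbert space `L²(F, dx)`. -/
def IsBoundedOn (ν : LocalPlace F) (D : Set (F → ℂ)) (O : (F → ℂ) → F → ℂ) : Prop :=
  ∃ C : ℝ≥0, ∀ α ∈ D, MemLp α 2 ν.haar ∧ MemLp (O α) 2 ν.haar ∧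
    eLpNorm (O α) 2 ν.haar ≤ C * eLpNorm α 2 ν.haar

end LocalPlace

/-- The critical strip `0 < Re s < 1`. -/
def criticalStrip : Set ℂ := {s | 0 < s.re ∧ s.re < 1}

end

open Filter Set Metric
open scoped Topology Pointwise

namespace LocalPlace

variable {F : Type*} [NormedField F]

/-! ### The module -/

/-! Everything is read off on the Mellin side. Write Z(χ,g,s) = ∫ χ(x)|x|^{-s} g(x) dx
(`mellinTransform`). Fubini and Parseval give Tate's exchange identity Z(χ,g,1-s) Z(χ⁻¹,β,s) =
Z(χ⁻¹,ℱ⁻¹g,s) Z(χ,ℱβ,1-s) (`functional_equation`). For Schwartz–Bruhat g it says that the ratio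
Z(χ,ℱβ,1-s)/Z(χ⁻¹,β,s) does not depend on β; this ratio is Γ(χ,s). The identity is proved for more
general g, so that g = Aℱα is allowed. Then ℱ⁻¹g = Bα because log|x| is even, and Z(χ,Aℱα,1-s) =
Γ(χ,s) Z(χ⁻¹,Bα,s). Multiplication by log|x| acts as -∂/∂s on Mellin transforms, so the left side is
also the s-derivative of Z(χ,ℱα,1-s) = Γ(χ,s) Z(χ⁻¹,α,s). The product rule yields Z(χ⁻¹,Hα,s) =
(Γ'/Γ)(χ,s) Z(χ⁻¹,α,s) (`mellinTransform_conductorOp`), and H is its own transpose. Each further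
commutator with A differentiates the eigenvalue and brings a sign, which the transpose of K_N
undoes.

The analytic obstacle is that Bα must have a Mellin transform in the whole strip. It is bounded, and
it must be shown to decay like |x|⁻¹. Differentiating the functional equation of the trivial
character at the edge of the strip shows that ℱ(log|y|) is a multiple k|x|⁻¹ away from the origin
(`exists_integral_opA_fourier_eq`). Hence B is a regularised convolution with k|z|⁻¹
(`exists_opB_eq`), and the decay follows.

The same formula gives boundedness. K_N has the kernel k (log|x| - log|y|)^N / |x-y|
(`higherCommutator_eq_opB`), whose numerator vanishes at y = x, so no regularisation is left. The
kernel is homogeneous of degree -1, and a Schur test with the weight |u|^{-1/2} reduces the bound to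
`integrable_commutatorKernel`.

The preliminaries (scaling of Haar measure, stability of Schwartz–Bruhat functions under ℱ,
inversion up to a constant) are done separately for the two kinds of places; the later arguments are
mostly uniform in the place. -/

theorem properSpace (ν : LocalPlace F) : ProperSpace F := by
  cases ν with
  | archimedean => exact FiniteDimensional.proper ℝ F
  | finite p => exact FiniteDimensional.proper ℚ_[p] F

theorem degree_pos (ν : LocalPlace F) : 0 < ν.degree := by
  cases ν with
  | archimedean => exact Module.finrank_pos
  | finite p => exact Module.finrank_pos

variable (ν : LocalPlace F)

@[simp] theorem modulus_zero : ν.modulus 0 = 0 := by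
  simp [modulus, ν.degree_pos.ne']

@[simp] theorem modulus_one : ν.modulus 1 = 1 := by simp [modulus]

@[simp] theorem modulus_neg (x : F) : ν.modulus (-x) = ν.modulus x := by simp [modulus]

theorem modulus_mul (x y : F) : ν.modulus (x * y) = ν.modulus x * ν.modulus y := by
  simp [modulus, mul_pow]

theorem modulus_inv (x : F) : ν.modulus x⁻¹ = (ν.modulus x)⁻¹ := by simp [modulus]

theorem modulus_pow (x : F) (n : ℕ) : ν.modulus (x ^ n) = ν.modulus x ^ n := by
  simp [modulus, pow_right_comm]

theorem modulus_nonneg (x : F) : 0 ≤ ν.modulus x := by unfold modulus; positivity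

theorem modulus_pos {x : F} (hx : x ≠ 0) : 0 < ν.modulus x := by unfold modulus; positivity

theorem continuous_modulus : Continuous ν.modulus := by unfold modulus; fun_prop

theorem modulus_le_modulus {x y : F} (h : ‖x‖ ≤ ‖y‖) : ν.modulus x ≤ ν.modulus y := by
  unfold modulus; gcongr

theorem modulus_le_one {x : F} (h : ‖x‖ ≤ 1) : ν.modulus x ≤ 1 := by
  simpa using ν.modulus_le_modulus (x := x) (y := 1) (by simpa using h)

theorem one_le_modulus {x : F} (h : 1 ≤ ‖x‖) : 1 ≤ ν.modulus x := by
  simpa using ν.modulus_le_modulus (x := 1) (y := x) (by simpa using h)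

theorem modulus_lt_one {x : F} (h : ‖x‖ < 1) : ν.modulus x < 1 := by
  unfold modulus; exact pow_lt_one₀ (norm_nonneg _) h ν.degree_pos.ne'

theorem exists_norm_lt_one (ν : LocalPlace F) : ∃ u : F, u ≠ 0 ∧ ‖u‖ < 1 := by
  cases ν with
  | archimedean =>
    refine ⟨algebraMap ℝ F (1 / 2), by simp, ?_⟩
    rw [norm_algebraMap', Real.norm_eq_abs, abs_of_pos] <;> norm_num
  | finite p =>
    have hp : p.Prime := Fact.out
    refine ⟨algebraMap ℚ_[p] F p, (_root_.map_ne_zero _).2 (by exact_mod_cast hp.ne_zero), ?_⟩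
    rw [norm_algebraMap', Padic.norm_p]
    exact inv_lt_one_of_one_lt₀ (by exact_mod_cast hp.one_lt)

variable [MeasurableSpace F] [BorelSpace F]

/-! ### The scaling factor of Haar measure is the module -/

omit [MeasurableSpace F] [BorelSpace F] in
-- Multiplication by t maps the unit ball, of positive finite measure, into itself.
theorem distribHaarChar_le_one [ProperSpace F] {t : Fˣ} (ht : ‖(t : F)‖ ≤ 1) :
    distribHaarChar F t ≤ 1 := by
  borelize F
  have h0 : (Measure.addHaar (closedBall (0 : F) 1)) ≠ 0 :=
    (measure_closedBall_pos _ _ one_pos).ne'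
  have h1 : (Measure.addHaar (closedBall (0 : F) 1)) ≠ ∞ :=
    (isCompact_closedBall _ _).measure_lt_top.ne
  have h := distribHaarChar_mul (Measure.addHaar (G := F)) t (closedBall (0 : F) 1)
  have hs : t • closedBall (0 : F) 1 ⊆ closedBall (0 : F) 1 := by
    rintro _ ⟨x, hx, rfl⟩
    simp only [mem_closedBall, dist_zero_right, smul_eq_mul, norm_mul] at hx ⊢
    exact mul_le_one₀ ht (norm_nonneg _) hx
  have h2 : (distribHaarChar F t : ℝ≥0∞) * Measure.addHaar (closedBall (0 : F) 1) ≤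
      1 * Measure.addHaar (closedBall (0 : F) 1) := by
    rw [h, one_mul]; exact measure_mono hs
  exact_mod_cast (ENNReal.mul_le_mul_iff_left h0 h1).1 h2

omit [MeasurableSpace F] [BorelSpace F] in
theorem distribHaarChar_eq_one [ProperSpace F] {t : Fˣ} (ht : ‖(t : F)‖ = 1) :
    distribHaarChar F t = 1 := by
  refine le_antisymm (distribHaarChar_le_one ht.le) ?_
  have h := distribHaarChar_le_one (t := t⁻¹) (by simp [ht])
  rw [map_inv] at h
  exact (inv_le_one₀ distribHaarChar_pos).1 h

omit [MeasurableSpace F] [BorelSpace F] in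
theorem distribHaarChar_real [ProperSpace F] [NormedAlgebra ℝ F] [FiniteDimensional ℝ F] (t : Fˣ) :
    (distribHaarChar F t : ℝ) = ‖(t : F)‖ ^ Module.finrank ℝ F := by
  borelize F
  have hr : ‖(t : F)‖ ≠ 0 := by simp
  let r : Fˣ := Units.mk0 (algebraMap ℝ F ‖(t : F)‖) (by simp)
  have hrc : distribHaarChar F r = (‖(t : F)‖₊) ^ Module.finrank ℝ F := by
    refine distribHaarChar_eq_of_measure_smul_eq_mul (μ := Measure.addHaar)
      (s := closedBall (0 : F) 1) (measure_closedBall_pos _ _ one_pos).ne'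
      (isCompact_closedBall _ _).measure_lt_top.ne ?_
    have : r • closedBall (0 : F) 1 = ‖(t : F)‖ • closedBall (0 : F) 1 := by
      ext x
      simp [Set.mem_smul_set, Units.smul_def, r, Algebra.smul_def]
    rw [this, Measure.addHaar_smul, abs_of_nonneg (by positivity),
      ENNReal.ofReal_pow (norm_nonneg _), ofReal_norm]
    rfl
  -- The factor depends only on the norm, so t may be replaced by the real scalar of the same norm,
  -- for which scaling of Haar measure in a real vector space is known.
  have h1 : distribHaarChar F (r⁻¹ * t) = 1 := by
    apply distribHaarChar_eq_one
    simp [r, norm_algebraMap', hr]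
  rw [map_mul, map_inv, inv_mul_eq_one₀ distribHaarChar_pos.ne'] at h1
  rw [← h1, hrc]
  simp

omit [MeasurableSpace F] [BorelSpace F] in
-- In `ℚ_[p]`-coordinates multiplication by p maps the closed unit cube `L` onto the open one `L'`,
-- and `L` is the disjoint union of the p^d translates of `L'` by digit vectors. The norm of F plays
-- no role here, only its topology.
theorem distribHaarChar_natCast_prime [ProperSpace F] (p : ℕ) [Fact p.Prime] [NormedAlgebra ℚ_[p] F]
    [FiniteDimensional ℚ_[p] F] (t : Fˣ) (ht : (t : F) = p) :
    (distribHaarChar F t : ℝ) = ((p : ℝ) ^ Module.finrank ℚ_[p] F)⁻¹ := by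
  borelize F
  have hp : p.Prime := Fact.out
  let e : F ≃L[ℚ_[p]] (Fin (Module.finrank ℚ_[p] F) → ℚ_[p]) :=
    ContinuousLinearEquiv.ofFinrankEq (by simp)
  let d := Module.finrank ℚ_[p] F
  let L : Set F := {x | ∀ i, ‖e x i‖ ≤ 1}
  let L' : Set F := {x | ∀ i, ‖e x i‖ < 1}
  have hLe : L = e ⁻¹' closedBall 0 1 := by
    ext x; simp [L, pi_norm_le_iff_of_nonneg]
  have hLo : IsOpen L' := by
    have : L' = ⋂ i, {x | ‖e x i‖ < 1} := by ext; simp [L']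
    rw [this]
    exact isOpen_iInter_of_finite fun i => isOpen_lt (by fun_prop) continuous_const
  have hLL : L' ⊆ L := fun x hx i => (hx i).le
  have hL0 : Measure.addHaar L ≠ 0 := by
    refine (lt_of_lt_of_le ?_ (measure_mono hLL)).ne'
    exact hLo.measure_pos _ ⟨0, by simp [L']⟩
  have hLc : IsCompact L := by
    rw [hLe]
    exact e.toHomeomorph.isCompact_preimage.2 (isCompact_closedBall _ _)
  -- The norm of `ℚ_[p]` takes no value strictly between p⁻¹ and 1, so the bounds ≤ p⁻¹ and < 1
  -- agree.
  have hsm : t • L = L' := by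
    ext x
    rw [Set.mem_smul_set_iff_inv_smul_mem]
    have h1 : t⁻¹ • x = (p : ℚ_[p])⁻¹ • x := by
      rw [Algebra.smul_def, map_inv₀, map_natCast, ← ht, Units.smul_def, Units.val_inv_eq_inv_val,
        smul_eq_mul]
    have hp0 : (0 : ℝ) < p := by exact_mod_cast hp.pos
    simp only [L, L', mem_ofPred_eq, h1, map_smul, Pi.smul_apply, smul_eq_mul, norm_mul, norm_inv,
      Padic.norm_p, inv_inv]
    refine forall_congr' fun i => ?_
    have := Padic.norm_le_pow_iff_norm_lt_pow_add_one (e x i) (-1)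
    simp only [zpow_neg, zpow_one, neg_add_cancel, zpow_zero] at this
    rw [← this, ← le_inv_mul_iff₀ hp0, mul_one]
  let v : (Fin d → Fin p) → F := fun k => e.symm fun i => ((k i : ℕ) : ℚ_[p])
  have hu : L = ⋃ k : Fin d → Fin p, (v k) +ᵥ L' := by
    ext x
    simp only [mem_iUnion, Set.mem_vadd_set_iff_neg_vadd_mem, vadd_eq_add]
    have hmem : ∀ k, -v k + x ∈ L' ↔ ∀ i, ‖e x i - ((k i : ℕ) : ℚ_[p])‖ < 1 := by
      intro k
      simp [L', v, neg_add_eq_sub]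
    simp only [hmem]
    constructor
    · intro hx
      have : ∀ i, ∃ n : Fin p, ‖e x i - ((n : ℕ) : ℚ_[p])‖ < 1 := by
        intro i
        obtain ⟨n, hn, h⟩ := PadicInt.exists_mem_range (⟨e x i, hx i⟩ : ℤ_[p])
        refine ⟨⟨n, hn⟩, ?_⟩
        rw [PadicInt.maximalIdeal_eq_span_p, Ideal.mem_span_singleton,
          ← PadicInt.norm_lt_one_iff_dvd, PadicInt.norm_def] at h
        exact h
      choose k hk using this
      exact ⟨k, hk⟩
    · rintro ⟨k, hk⟩ i
      have h2 : ‖((k i : ℕ) : ℚ_[p])‖ ≤ 1 := by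
        simpa using (((k i : ℕ) : ℤ_[p])).2
      calc ‖e x i‖ = ‖(e x i - ((k i : ℕ) : ℚ_[p])) + ((k i : ℕ) : ℚ_[p])‖ := by ring_nf
        _ ≤ max _ _ := Padic.nonarchimedean _ _
        _ ≤ 1 := max_le (hk i).le h2
  have hdisj : Pairwise (Function.onFun Disjoint fun k : Fin d → Fin p => (v k) +ᵥ L') := by
    intro k l hkl
    rw [Function.onFun, Set.disjoint_left]
    intro x hk hl
    apply hkl
    simp only [Set.mem_vadd_set_iff_neg_vadd_mem, vadd_eq_add, L', mem_ofPred_eq] at hk hl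
    ext i
    have h1 := hk i
    have h2 := hl i
    simp only [v, map_add, map_neg, e.apply_symm_apply, Pi.add_apply, Pi.neg_apply] at h1 h2
    have h3 : ‖((k i : ℕ) : ℚ_[p]) - ((l i : ℕ) : ℚ_[p])‖ < 1 := by
      calc ‖((k i : ℕ) : ℚ_[p]) - ((l i : ℕ) : ℚ_[p])‖
          = ‖(-((l i : ℕ) : ℚ_[p]) + e x i) + -(-((k i : ℕ) : ℚ_[p]) + e x i)‖ := by ring_nf
        _ ≤ max _ _ := Padic.nonarchimedean _ _
        _ < 1 := max_lt h2 (by rwa [norm_neg])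
    have h4 : ‖(((k i : ℕ) - (l i : ℕ) : ℤ) : ℚ_[p])‖ < 1 := by simpa using h3
    rw [Padic.norm_intCast_lt_one_iff] at h4
    have h5 := Int.eq_zero_of_abs_lt_dvd h4 (by
      rw [abs_lt]; constructor <;> have := (k i).2 <;> have := (l i).2 <;> omega)
    omega
  have hm : Measure.addHaar L = ((p ^ d : ℕ) : ℝ≥0∞) * Measure.addHaar L' := by
    conv_lhs => rw [hu]
    rw [measure_iUnion hdisj fun k => (hLo.measurableSet.const_vadd _)]
    simp [measure_vadd]
  have hq := distribHaarChar_mul (Measure.addHaar (G := F)) t L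
  rw [hsm] at hq
  have h6 : distribHaarChar F t = ((p : ℝ≥0) ^ d)⁻¹ := by
    refine distribHaarChar_eq_of_measure_smul_eq_mul hL0 hLc.measure_lt_top.ne ?_
    rw [hsm, hm, ← mul_assoc]
    have hp' : (p : ℝ≥0) ^ d ≠ 0 := pow_ne_zero _ (by exact_mod_cast hp.ne_zero)
    rw [ENNReal.coe_inv hp']
    push_cast
    rw [ENNReal.inv_mul_cancel, one_mul]
    · exact pow_ne_zero _ (by exact_mod_cast hp.ne_zero)
    · exact ENNReal.pow_ne_top (ENNReal.natCast_ne_top p)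
  rw [h6]
  simp [d]

/-- A positive multiplicative quantity that is monotone in `a` and agrees with `a ^ d` at one
point is `a ^ d`. -/
theorem eq_pow_of_zpow_le {a m q : ℝ} (ha : 0 < a) (hm : 0 < m) (hq : 1 < q) (d : ℕ)
    (h : ∀ n k : ℤ, a ^ n ≤ q ^ k → m ^ n ≤ (q ^ d) ^ k) : m = a ^ d := by
  have hl : 0 < Real.log q := Real.log_pos hq
  have hq0 : 0 < q := by linarith
  have key : ∀ n : ℤ, n * Real.log m ≤ d * (n * Real.log a + Real.log q) := by
    intro n
    -- The least k with a^n ≤ q^k overshoots by at most log q, independently of n.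
    set k := ⌈n * Real.log a / Real.log q⌉
    have h1 : n * Real.log a ≤ k * Real.log q := by
      rw [← div_le_iff₀ hl]; exact Int.le_ceil _
    have h2 : k * Real.log q ≤ n * Real.log a + Real.log q := by
      have h3 : (k : ℝ) < n * Real.log a / Real.log q + 1 := Int.ceil_lt_add_one _
      have h4 := mul_lt_mul_of_pos_right h3 hl
      rw [add_mul, div_mul_cancel₀ _ hl.ne', one_mul] at h4
      exact h4.le
    have h5 : a ^ n ≤ q ^ k := by
      rw [← Real.log_le_log_iff (by positivity) (by positivity), Real.log_zpow, Real.log_zpow]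
      exact h1
    have h6 := h n k h5
    rw [← Real.log_le_log_iff (by positivity) (by positivity), Real.log_zpow, Real.log_zpow,
      Real.log_pow] at h6
    calc n * Real.log m ≤ k * (d * Real.log q) := h6
      _ = d * (k * Real.log q) := by ring
      _ ≤ _ := by gcongr
  -- Using both n and -n bounds all multiples of the discrepancy by one constant, so it is zero.
  have hb : ∀ n : ℕ, (n : ℝ) * |Real.log m - d * Real.log a| ≤ d * Real.log q := by
    intro n
    have k1 := key n
    have k2 := key (-n)
    push_cast at k1 k2
    rcases abs_cases (Real.log m - d * Real.log a) with ⟨h, -⟩ | ⟨h, -⟩ <;> rw [h] <;> nlinarith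
  have h0 : |Real.log m - d * Real.log a| = 0 := by
    by_contra hne
    have hpos : 0 < |Real.log m - d * Real.log a| := lt_of_le_of_ne (abs_nonneg _) (Ne.symm hne)
    obtain ⟨n, hn⟩ := exists_nat_gt (d * Real.log q / |Real.log m - d * Real.log a|)
    rw [div_lt_iff₀ hpos] at hn
    exact absurd (hb n) (not_le.2 hn)
  rw [abs_eq_zero, sub_eq_zero, ← Real.log_pow] at h0
  exact Real.log_injOn_pos hm (pow_pos ha d) h0

omit [MeasurableSpace F] [BorelSpace F] in
-- At a finite place ‖t‖ need not be an integral power of p, as F may be ramified. Instead of using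
-- a uniformizer, compare t^n with p^k: if t^n p^k has norm at most 1, its scaling factor is at most
-- 1, and letting n grow determines the factor of t.
theorem distribHaarChar_eq_modulus [ProperSpace F] (t : Fˣ) :
    (distribHaarChar F t : ℝ) = ν.modulus (t : F) := by
  cases ν with
  | archimedean => exact distribHaarChar_real t
  | finite p =>
    have hp : p.Prime := Fact.out
    have hpF : (p : F) ≠ 0 := by
      rw [← map_natCast (algebraMap ℚ_[p] F), _root_.map_ne_zero]
      exact_mod_cast hp.ne_zero
    let q : Fˣ := Units.mk0 (p : F) hpF
    have hqn : ‖(p : F)‖ = (p : ℝ)⁻¹ := by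
      rw [← map_natCast (algebraMap ℚ_[p] F), norm_algebraMap', Padic.norm_p]
    have hp1 : (1 : ℝ) < p := by exact_mod_cast hp.one_lt
    refine eq_pow_of_zpow_le (q := p) (by simp) (by exact_mod_cast distribHaarChar_pos) hp1 _ ?_
    intro n k hnk
    have h1 : distribHaarChar F (t ^ n * q ^ k) ≤ 1 := by
      apply distribHaarChar_le_one
      simp only [Units.val_mul, Units.val_zpow_eq_zpow_val, norm_mul, norm_zpow, q, Units.val_mk0,
        hqn, inv_zpow]
      rwa [mul_inv_le_iff₀ (by positivity), one_mul]
    have h2 : (distribHaarChar F (t ^ n * q ^ k) : ℝ) ≤ 1 := by exact_mod_cast h1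
    rw [map_mul, map_zpow, map_zpow] at h2
    push_cast at h2
    rw [distribHaarChar_natCast_prime p q rfl, inv_zpow, mul_inv_le_iff₀ (by positivity),
      one_mul] at h2
    exact h2

/-! ### Change of variables under dilations -/

variable (μ : Measure F) [μ.IsAddHaarMeasure]

theorem map_mul_left [ProperSpace F] {t : F} (ht : t ≠ 0) :
    μ.map (fun x => t * x) = ENNReal.ofReal (ν.modulus t)⁻¹ • μ := by
  ext s hs
  rw [Measure.map_apply (by fun_prop) hs, Measure.smul_apply, smul_eq_mul]
  have h := distribHaarChar_mul μ (Units.mk0 t ht)⁻¹ s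
  have h1 : (Units.mk0 t ht)⁻¹ • s = (fun x => t * x) ⁻¹' s := by
    ext x
    rw [Set.mem_smul_set_iff_inv_smul_mem, inv_inv]
    rfl
  have h2 := ν.distribHaarChar_eq_modulus (Units.mk0 t ht)⁻¹
  rw [Units.val_inv_eq_inv_val, Units.val_mk0, modulus_inv] at h2
  rw [← h1, ← h, ← h2, ENNReal.ofReal_coe_nnreal]

theorem measurableEmbedding_mul_left {t : F} (ht : t ≠ 0) :
    MeasurableEmbedding fun x : F => t * x :=
  (Homeomorph.mulLeft₀ t ht).measurableEmbedding

theorem lintegral_comp_mul_left [ProperSpace F] {t : F} (ht : t ≠ 0) (f : F → ℝ≥0∞) :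
    ∫⁻ x, f (t * x) ∂μ = ENNReal.ofReal (ν.modulus t)⁻¹ * ∫⁻ x, f x ∂μ := by
  rw [← (measurableEmbedding_mul_left ht).lintegral_map, ν.map_mul_left μ ht,
    lintegral_smul_measure, smul_eq_mul]

theorem integral_comp_mul_left_smul [ProperSpace F] {E : Type*} [NormedAddCommGroup E]
    [NormedSpace ℝ E] {t : F} (ht : t ≠ 0) (f : F → E) :
    ∫ x, f (t * x) ∂μ = (ν.modulus t)⁻¹ • ∫ x, f x ∂μ := by
  rw [← (measurableEmbedding_mul_left ht).integral_map, ν.map_mul_left μ ht,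
    integral_smul_measure, ENNReal.toReal_ofReal (inv_nonneg.2 (ν.modulus_nonneg t))]

theorem integral_comp_mul_left [ProperSpace F] {t : F} (ht : t ≠ 0) (f : F → ℂ) :
    ∫ x, f (t * x) ∂μ = (ν.modulus t : ℂ)⁻¹ * ∫ x, f x ∂μ := by
  rw [ν.integral_comp_mul_left_smul μ ht, Complex.real_smul, Complex.ofReal_inv]

theorem integrable_comp_mul_left (ν : LocalPlace F) [ProperSpace F] {E : Type*} [NormedAddCommGroup E] {t : F}
    (ht : t ≠ 0) {f : F → E} :
    Integrable (fun x => f (t * x)) μ ↔ Integrable f μ := by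
  have h := (measurableEmbedding_mul_left ht).integrable_map_iff (g := f) (μ := μ)
  rw [ν.map_mul_left μ ht, integrable_smul_measure _ ENNReal.ofReal_ne_top] at h
  · exact h.symm
  · simpa using inv_pos.2 (ν.modulus_pos ht)

/-! ### Powers of the module -/

theorem nullSingletonClass (ν : LocalPlace F) [ProperSpace F] : NullSingletonClass μ := by
  obtain ⟨u, hu0, hu⟩ := ν.exists_norm_lt_one
  have : (𝓝[≠] (0 : F)).NeBot := by
    have : Tendsto (fun n : ℕ => u ^ n) atTop (𝓝[≠] (0 : F)) :=
      tendsto_nhdsWithin_iff.2 ⟨tendsto_pow_atTop_nhds_zero_of_norm_lt_one hu,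
        Eventually.of_forall fun n => pow_ne_zero n hu0⟩
    exact this.neBot
  infer_instance

theorem ae_ne_zero (ν : LocalPlace F) [ProperSpace F] : ∀ᵐ x ∂μ, x ≠ 0 := by
  have := ν.nullSingletonClass μ
  rw [ae_iff]
  simp

/-- Dilation by u multiplies the integral of |x|^a over a shell by |u|^{a+1}, so the sum over all
shells is dominated by a geometric series. Taking u small covers a neighbourhood of 0, taking its
inverse covers one of infinity. -/
theorem lintegral_modulus_rpow_lt_top [ProperSpace F] {u : F} (hu : u ≠ 0) {a : ℝ}
    (hua : ν.modulus u ^ (a + 1) < 1) {s : Set F} (hs : IsCompact s) (h0 : (0 : F) ∉ s) :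
    ∫⁻ x in ⋃ n : ℕ, (fun y => u ^ n * y) '' s, ENNReal.ofReal (ν.modulus x ^ a) ∂μ < ∞ := by
  have hm : Measurable fun x => ENNReal.ofReal (ν.modulus x ^ a) :=
    (ν.continuous_modulus.measurable.pow_const a).ennreal_ofReal
  have hI : ∫⁻ x in s, ENNReal.ofReal (ν.modulus x ^ a) ∂μ < ∞ := by
    have hc : ContinuousOn (fun x => ν.modulus x ^ a) s :=
      ν.continuous_modulus.continuousOn.rpow_const fun x hx =>
        Or.inl (ν.modulus_pos (by rintro rfl; exact h0 hx)).ne'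
    obtain ⟨C, hC⟩ := hs.exists_bound_of_continuousOn hc
    refine lt_of_le_of_lt (setLIntegral_mono' (g := fun _ => ENNReal.ofReal C)
      hs.isClosed.measurableSet fun x hx => ENNReal.ofReal_le_ofReal ?_) ?_
    · exact (le_abs_self _).trans (hC x hx)
    · rw [setLIntegral_const]
      exact ENNReal.mul_lt_top ENNReal.ofReal_lt_top hs.measure_lt_top
  have hn : ∀ n : ℕ, ∫⁻ x in (fun y => u ^ n * y) '' s, ENNReal.ofReal (ν.modulus x ^ a) ∂μ =
      ENNReal.ofReal (ν.modulus u ^ (a + 1)) ^ n *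
        ∫⁻ x in s, ENNReal.ofReal (ν.modulus x ^ a) ∂μ := by
    intro n
    have hun : u ^ n ≠ 0 := pow_ne_zero n hu
    have hsm : MeasurableSet ((fun y => u ^ n * y) '' s) :=
      (hs.image (by fun_prop)).isClosed.measurableSet
    have h1 := ν.lintegral_comp_mul_left μ hun
      (((fun y => u ^ n * y) '' s).indicator fun x => ENNReal.ofReal (ν.modulus x ^ a))
    rw [lintegral_indicator hsm] at h1
    have h2 : ∀ x, ((fun y => u ^ n * y) '' s).indicator
        (fun x => ENNReal.ofReal (ν.modulus x ^ a)) (u ^ n * x) =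
        ENNReal.ofReal ((ν.modulus u ^ n) ^ a) *
          s.indicator (fun x => ENNReal.ofReal (ν.modulus x ^ a)) x := by
      intro x
      have hinj : Function.Injective fun y => u ^ n * y := mul_right_injective₀ hun
      by_cases hx : x ∈ s
      · rw [indicator_of_mem (mem_image_of_mem _ hx), indicator_of_mem hx, modulus_mul,
          modulus_pow, Real.mul_rpow (pow_nonneg (ν.modulus_nonneg u) n) (ν.modulus_nonneg x),
          ENNReal.ofReal_mul (Real.rpow_nonneg (pow_nonneg (ν.modulus_nonneg u) n) _)]
      · rw [indicator_of_notMem (by rwa [hinj.mem_set_image]), indicator_of_notMem hx, mul_zero]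
    simp_rw [h2] at h1
    rw [lintegral_const_mul _ (hm.indicator hs.isClosed.measurableSet),
      lintegral_indicator hs.isClosed.measurableSet] at h1
    have hpos := ν.modulus_pos hu
    have hpn : 0 < ν.modulus u ^ n := pow_pos hpos n
    calc ∫⁻ x in (fun y => u ^ n * y) '' s, ENNReal.ofReal (ν.modulus x ^ a) ∂μ
        = ENNReal.ofReal (ν.modulus u ^ n) * (ENNReal.ofReal (ν.modulus (u ^ n))⁻¹ *
          ∫⁻ x in (fun y => u ^ n * y) '' s, ENNReal.ofReal (ν.modulus x ^ a) ∂μ) := by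
          rw [← mul_assoc, ← ENNReal.ofReal_mul hpn.le, modulus_pow, mul_inv_cancel₀ hpn.ne',
            ENNReal.ofReal_one, one_mul]
      _ = _ := by
          rw [← h1, ← mul_assoc, ← ENNReal.ofReal_mul hpn.le, ← ENNReal.ofReal_pow
            (Real.rpow_nonneg hpos.le _)]
          congr 2
          rw [← Real.rpow_natCast (ν.modulus u ^ (a + 1)), ← Real.rpow_mul hpos.le,
            ← Real.rpow_natCast, ← Real.rpow_mul hpos.le, ← Real.rpow_add hpos]
          ring_nf
  refine (lintegral_iUnion_le _ _).trans_lt ?_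
  simp_rw [hn]
  rw [ENNReal.tsum_mul_right, ENNReal.tsum_geometric]
  refine ENNReal.mul_lt_top ?_ hI
  rw [ENNReal.inv_lt_top, tsub_pos_iff_lt]
  exact ENNReal.ofReal_lt_one.2 hua

omit [μ.IsAddHaarMeasure] in
theorem integrableOn_modulus_rpow [ProperSpace F] {a : ℝ} {s : Set F} (h :
    ∫⁻ x in s, ENNReal.ofReal (ν.modulus x ^ a) ∂μ < ∞) :
    IntegrableOn (fun x => ν.modulus x ^ a) s μ := by
  refine ⟨(ν.continuous_modulus.measurable.pow_const a).aestronglyMeasurable, ?_⟩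
  rw [hasFiniteIntegral_iff_ofReal
    (Eventually.of_forall fun x => Real.rpow_nonneg (ν.modulus_nonneg x) a)]
  exact h

theorem integrableOn_modulus_rpow_closedBall [ProperSpace F] {a : ℝ} (ha : -1 < a) :
    IntegrableOn (fun x => ν.modulus x ^ a) (closedBall 0 1) μ := by
  obtain ⟨u, hu0, hu⟩ := ν.exists_norm_lt_one
  have hup := norm_pos_iff.2 hu0
  -- The annulus ‖u‖ ≤ ‖x‖ ≤ 1: its images under the powers of u cover the punctured unit ball.
  have hs : IsCompact (closedBall (0 : F) 1 ∩ {x | ‖u‖ ≤ ‖x‖}) :=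
    (isCompact_closedBall _ _).inter_right (isClosed_le continuous_const continuous_norm)
  have h := ν.lintegral_modulus_rpow_lt_top μ hu0 (a := a)
    (Real.rpow_lt_one (ν.modulus_nonneg u) (ν.modulus_lt_one hu) (by linarith)) hs
    (by simp [hu0])
  refine (ν.integrableOn_modulus_rpow μ h).mono_set_ae ?_
  filter_upwards [ν.ae_ne_zero μ] with x hx hx1
  have hx1' : ‖x‖ ≤ 1 := mem_closedBall_zero_iff.1 hx1
  obtain ⟨n, h1, h2⟩ := exists_nat_pow_near_of_lt_one (norm_pos_iff.2 hx) hx1' hup hu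
  refine mem_iUnion.2 ⟨n, (u ^ n)⁻¹ * x, ⟨?_, ?_⟩, mul_inv_cancel_left₀ (pow_ne_zero n hu0) x⟩
  · simp only [mem_closedBall, dist_zero_right, norm_mul, norm_inv, norm_pow]
    rw [inv_mul_le_iff₀ (by positivity), mul_one]
    exact h2
  · simp only [mem_ofPred_eq, norm_mul, norm_inv, norm_pow]
    rw [le_inv_mul_iff₀ (by positivity), ← pow_succ]
    exact h1.le

theorem integrableOn_modulus_rpow_compl [ProperSpace F] {a : ℝ} (ha : a < -1) :
    IntegrableOn (fun x => ν.modulus x ^ a) {x | 1 ≤ ‖x‖} μ := by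
  obtain ⟨u, hu0, hu⟩ := ν.exists_norm_lt_one
  have hup := norm_pos_iff.2 hu0
  have hs : IsCompact (closedBall (0 : F) ‖u‖⁻¹ ∩ {x | 1 ≤ ‖x‖}) :=
    (isCompact_closedBall _ _).inter_right (isClosed_le continuous_const continuous_norm)
  have h := ν.lintegral_modulus_rpow_lt_top μ (inv_ne_zero hu0) (a := a)
    (by
      rw [modulus_inv, Real.inv_rpow (ν.modulus_nonneg u), ← Real.rpow_neg (ν.modulus_nonneg u)]
      exact Real.rpow_lt_one (ν.modulus_nonneg u) (ν.modulus_lt_one hu) (by linarith)) hs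
    (by simp)
  refine (ν.integrableOn_modulus_rpow μ h).mono_set fun x hx => ?_
  obtain ⟨n, h1, h2⟩ := exists_nat_pow_near (x := ‖x‖) hx ((one_lt_inv₀ hup).2 hu)
  refine mem_iUnion.2 ⟨n, u ^ n * x, ⟨?_, ?_⟩, ?_⟩
  · simp only [mem_closedBall, dist_zero_right, norm_mul, norm_pow]
    rw [pow_succ, inv_pow, inv_mul_eq_div, lt_div_iff₀ (by positivity), mul_comm] at h2
    exact h2.le
  · simp only [mem_ofPred_eq, norm_mul, norm_pow]
    rw [inv_pow, inv_le_iff_one_le_mul₀ (by positivity), mul_comm] at h1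
    exact h1
  · simp [hu0]

theorem integrable_of_norm_le_rpow [ProperSpace F] {E : Type*} [NormedAddCommGroup E] {g : F → E}
    (hg : AEStronglyMeasurable g μ) {a b C : ℝ} (ha : -1 < a) (hb : b < -1)
    (h1 : ∀ x, x ≠ 0 → ‖x‖ ≤ 1 → ‖g x‖ ≤ C * ν.modulus x ^ a)
    (h2 : ∀ x, 1 ≤ ‖x‖ → ‖g x‖ ≤ C * ν.modulus x ^ b) : Integrable g μ := by
  have e1 : IntegrableOn g (closedBall 0 1) μ := by
    refine Integrable.mono' ((ν.integrableOn_modulus_rpow_closedBall μ ha).const_mul C)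
      hg.restrict ?_
    filter_upwards [ae_restrict_mem isClosed_closedBall.measurableSet,
      ae_restrict_of_ae (ν.ae_ne_zero μ)] with x hx hx0
    exact h1 x hx0 (by simpa using hx)
  have hm : MeasurableSet {x : F | 1 ≤ ‖x‖} :=
    (isClosed_le continuous_const continuous_norm).measurableSet
  have e2 : IntegrableOn g {x | 1 ≤ ‖x‖} μ := by
    refine Integrable.mono' ((ν.integrableOn_modulus_rpow_compl μ hb).const_mul C)
      hg.restrict ?_
    filter_upwards [ae_restrict_mem hm] with x hx
    exact h2 x hx
  have := e1.union e2
  rwa [show closedBall (0 : F) 1 ∪ {x | 1 ≤ ‖x‖} = univ by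
    ext x; simpa using le_total ‖x‖ 1, integrableOn_univ] at this

end LocalPlace

/-- A logarithm costs an arbitrarily small power at both ends; this is why A preserves convergence
on open strips. -/
theorem Real.abs_log_le_rpow_add_rpow {r ε : ℝ} (hr : 0 ≤ r) (hε : 0 < ε) :
    |Real.log r| ≤ (r ^ ε + r ^ (-ε)) / ε := by
  have h1 := Real.log_le_rpow_div hr hε
  have h2 := Real.log_le_rpow_div (inv_nonneg.2 hr) hε
  rw [Real.log_inv, Real.inv_rpow hr, ← Real.rpow_neg hr] at h2
  have h3 : 0 ≤ r ^ ε / ε := by positivity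
  have h4 : 0 ≤ r ^ (-ε) / ε := by positivity
  rw [add_div, abs_le]
  constructor <;> linarith

/-! ### Multiplication of Schwartz functions with `log ‖x‖` -/

theorem Function.hasTemperateGrowth_log_one_add_norm_sq (V : Type*) [NormedAddCommGroup V]
    [InnerProductSpace ℝ V] :
    Function.HasTemperateGrowth fun x : V => Real.log (1 + ‖x‖ ^ 2) := by
  have hd : ∀ x : V, HasFDerivAt (fun x : V => Real.log (1 + ‖x‖ ^ 2))
      ((1 + ‖x‖ ^ 2)⁻¹ • (2 • innerSL ℝ x)) x := by
    intro x
    have h1 : HasFDerivAt (fun x : V => 1 + ‖x‖ ^ 2) (2 • innerSL ℝ x) x := by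
      simpa using ((hasFDerivAt_id (𝕜 := ℝ) x).norm_sq).const_add 1
    exact h1.log (by positivity)
  refine Function.HasTemperateGrowth.of_fderiv (k := 2) (C := 1) ?_
    (fun x => (hd x).differentiableAt) ?_
  · have h2 : fderiv ℝ (fun x : V => Real.log (1 + ‖x‖ ^ 2)) =
        fun x => ((1 + ‖x‖ ^ 2) ^ (-1 : ℝ)) • ((2 • innerSL ℝ : V →L[ℝ] V →L[ℝ] ℝ) x) := by
      ext1 x
      rw [(hd x).fderiv, Real.rpow_neg_one]
      rfl
    rw [h2]
    exact (Function.hasTemperateGrowth_one_add_norm_sq_rpow V (-1)).smul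
      (ContinuousLinearMap.hasTemperateGrowth _)
  · intro x
    have h3 : (1 : ℝ) ≤ 1 + ‖x‖ ^ 2 := by nlinarith [norm_nonneg x]
    rw [Real.norm_of_nonneg (Real.log_nonneg h3)]
    have h4 := Real.log_le_sub_one_of_pos (show 0 < 1 + ‖x‖ ^ 2 by positivity)
    nlinarith [norm_nonneg x]

/-- Multiply by a bump that is 1 up to c and vanishes before the singularity at t = 1. -/
theorem exists_hasTemperateGrowth_eq_log_one_sub {c : ℝ} (hc0 : 0 < c) (hc : c < 1) :
    ∃ θ : ℝ → ℝ, θ.HasTemperateGrowth ∧ ∀ t, 0 ≤ t → t ≤ c → θ t = Real.log (1 - t) := by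
  let b : ContDiffBump (0 : ℝ) := ⟨c, (1 + c) / 2, hc0, by linarith⟩
  refine ⟨fun t => b t * Real.log (1 - t), ?_, fun t h0 h1 => ?_⟩
  · refine HasCompactSupport.hasTemperateGrowth b.hasCompactSupport.mul_right ?_
    rw [contDiff_iff_contDiffAt]
    intro t
    rcases lt_or_ge t 1 with ht | ht
    · refine b.contDiff.contDiffAt.mul (ContDiffAt.log (by fun_prop) (by linarith))
    · have : (fun t => b t * Real.log (1 - t)) =ᶠ[𝓝 t] fun _ => 0 := by
        have h1 : (1 + c) / 2 < t := by linarith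
        filter_upwards [lt_mem_nhds h1] with s hs
        rw [b.zero_of_le_dist, zero_mul]
        rw [Real.dist_eq, sub_zero]
        exact hs.le.trans (le_abs_self s)
      exact contDiffAt_const.congr_of_eventuallyEq this
  · show b t * _ = _
    rw [b.one_of_mem_closedBall, one_mul]
    simp only [mem_closedBall, Real.dist_eq, sub_zero, abs_of_nonneg h0]
    exact h1

/-- Write 2 log‖x‖ = log(1+‖x‖²) + log(1 - (1+‖x‖²)⁻¹). The first term has temperate growth; in the
second, the argument (1+‖x‖²)⁻¹ stays below a constant c < 1 where f may be nonzero, so the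
logarithm can be cut off near 1. -/
theorem SchwartzMap.exists_eq_log_norm_mul {V : Type*} [NormedAddCommGroup V]
    [InnerProductSpace ℝ V] (f : 𝓢(V, ℂ)) {ε : ℝ} (hε : 0 < ε) (hf : ∀ x, ‖x‖ < ε → f x = 0) :
    ∃ g : 𝓢(V, ℂ), ∀ x, g x = (Real.log ‖x‖ : ℂ) * f x := by
  have hc : (1 + ε ^ 2)⁻¹ < 1 := inv_lt_one_of_one_lt₀ (by nlinarith)
  obtain ⟨θ, hθ, hθe⟩ := exists_hasTemperateGrowth_eq_log_one_sub (by positivity) hc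
  have hu := hθ.comp (Function.hasTemperateGrowth_one_add_norm_sq_rpow V (-1))
  have hg := (Function.hasTemperateGrowth_log_one_add_norm_sq V).add hu
  have hg' : Function.HasTemperateGrowth fun x : V =>
      ((Real.log (1 + ‖x‖ ^ 2) + θ ((1 + ‖x‖ ^ 2) ^ (-1 : ℝ)) : ℝ) : ℂ) :=
    Function.HasTemperateGrowth.comp Function.Complex.hasTemperateGrowth_ofReal hg
  refine ⟨(2 : ℂ)⁻¹ • smulLeftCLM ℂ (fun x : V =>
    ((Real.log (1 + ‖x‖ ^ 2) + θ ((1 + ‖x‖ ^ 2) ^ (-1 : ℝ)) : ℝ) : ℂ)) f, fun x => ?_⟩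
  rw [smul_apply, smulLeftCLM_apply_apply hg']
  rcases lt_or_ge ‖x‖ ε with hx | hx
  · simp [hf x hx]
  · have hx0 : 0 < ‖x‖ := by linarith
    have h1 : θ ((1 + ‖x‖ ^ 2) ^ (-1 : ℝ)) = Real.log (1 - (1 + ‖x‖ ^ 2)⁻¹) := by
      rw [Real.rpow_neg_one]
      exact hθe _ (by positivity) (inv_anti₀ (by positivity) (by gcongr))
    have h2 : 1 - (1 + ‖x‖ ^ 2)⁻¹ = ‖x‖ ^ 2 / (1 + ‖x‖ ^ 2) := by field_simp; ring
    have h3 : Real.log (1 + ‖x‖ ^ 2) + θ ((1 + ‖x‖ ^ 2) ^ (-1 : ℝ)) = 2 * Real.log ‖x‖ := by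
      rw [h1, h2, Real.log_div (by positivity) (by positivity), Real.log_pow]
      push_cast; ring
    rw [h3, smul_eq_mul, smul_eq_mul]
    push_cast
    ring

/-! ### Normed fields over the reals -/

/-- The pulled-back norm is bounded on the compact unit sphere. Since it is multiplicative, powers
force it to be at most 1 there, and inverses force equality. -/
theorem AlgEquiv.norm_symm_eq {F K : Type*} [NormedField F] [NormedAlgebra ℝ F]
    [RCLike K] (e : F ≃ₐ[ℝ] K) (z : K) : ‖e.symm z‖ = ‖z‖ := by
  have : FiniteDimensional ℝ K := inferInstance
  have hcont : Continuous fun z : K => ‖e.symm z‖ :=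
    (LinearMap.continuous_of_finiteDimensional (e.symm.toLinearEquiv : K →ₗ[ℝ] F)).norm
  obtain ⟨C, hC⟩ := (isCompact_sphere (0 : K) 1).exists_bound_of_continuousOn hcont.continuousOn
  have hle : ∀ w : K, ‖w‖ = 1 → ‖e.symm w‖ ≤ 1 := by
    intro w hw
    by_contra! h
    obtain ⟨n, hn⟩ := pow_unbounded_of_one_lt C h
    have h1 := hC (w ^ n) (by simp [hw])
    rw [map_pow, norm_pow, norm_pow, norm_norm] at h1
    linarith
  have heq : ∀ w : K, ‖w‖ = 1 → ‖e.symm w‖ = 1 := by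
    intro w hw
    refine le_antisymm (hle w hw) ?_
    have h1 := hle w⁻¹ (by simp [hw])
    rw [map_inv₀, norm_inv] at h1
    have hw0 : w ≠ 0 := by rintro rfl; simp at hw
    exact (inv_le_one₀ (norm_pos_iff.2 (by simpa using hw0))).1 h1
  rcases eq_or_ne z 0 with rfl | hz
  · simp
  have hz' : z = algebraMap ℝ K ‖z‖ * ((algebraMap ℝ K ‖z‖)⁻¹ * z) := by
    rw [mul_inv_cancel_left₀]; simpa using hz
  conv_lhs => rw [hz']
  rw [map_mul, AlgEquiv.commutes, norm_mul, heq, mul_one, norm_algebraMap', norm_norm]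
  rw [norm_mul, norm_inv, norm_algebraMap', norm_norm, inv_mul_cancel₀ (by simpa using hz)]

/-- Needed because the norm of F is not given as a Euclidean one, while smoothness of log‖x‖ off the
origin rests on an inner product. -/
theorem NormedAlgebra.Real.exists_linearIsometryEquiv (F : Type*) [NormedField F]
    [NormedAlgebra ℝ F] : Nonempty (F ≃ₗᵢ[ℝ] ℝ) ∨ Nonempty (F ≃ₗᵢ[ℝ] ℂ) := by
  rcases NormedAlgebra.Real.nonempty_algEquiv_or F with ⟨⟨e⟩⟩ | ⟨⟨e⟩⟩
  · refine Or.inl ⟨⟨e.toLinearEquiv, fun x => ?_⟩⟩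
    have := AlgEquiv.norm_symm_eq e (e x)
    rw [e.symm_apply_apply] at this
    exact this.symm
  · refine Or.inr ⟨⟨e.toLinearEquiv, fun x => ?_⟩⟩
    have := AlgEquiv.norm_symm_eq e (e x)
    rw [e.symm_apply_apply] at this
    exact this.symm

theorem SchwartzMap.exists_eq_log_norm_mul_of_isometry {F V : Type*} [NormedAddCommGroup F]
    [NormedSpace ℝ F] [NormedAddCommGroup V] [InnerProductSpace ℝ V] (e : F ≃ₗᵢ[ℝ] V)
    (f : 𝓢(F, ℂ)) {ε : ℝ} (hε : 0 < ε) (hf : ∀ x, ‖x‖ < ε → f x = 0) :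
    ∃ g : 𝓢(F, ℂ), ∀ x, g x = (Real.log ‖x‖ : ℂ) * f x := by
  obtain ⟨g, hg⟩ := SchwartzMap.exists_eq_log_norm_mul
    (compCLMOfContinuousLinearEquiv ℂ (e.symm : V ≃L[ℝ] F) f) hε (fun x hx => hf _ (by simpa using hx))
  refine ⟨compCLMOfContinuousLinearEquiv ℂ (e : F ≃L[ℝ] V) g, fun x => ?_⟩
  simp [hg]

namespace LocalPlace

/-! ### Schwartz-Bruhat functions -/

variable {F : Type*} [NormedField F] (ν : LocalPlace F)

theorem isUltrametricDist_of_padic (p : ℕ) [Fact p.Prime] [NormedAlgebra ℚ_[p] F] :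
    IsUltrametricDist F := by
  refine IsUltrametricDist.isUltrametricDist_of_forall_norm_natCast_le_one fun n => ?_
  rw [← map_natCast (algebraMap ℚ_[p] F), norm_algebraMap']
  simpa using ((n : ℤ_[p])).2

variable {ν} {φ ψ : F → ℂ}

theorem schwartzBruhat_add (hφ : φ ∈ ν.schwartzBruhat) (hψ : ψ ∈ ν.schwartzBruhat) :
    (fun x => φ x + ψ x) ∈ ν.schwartzBruhat := by
  cases ν with
  | archimedean =>
    obtain ⟨f, rfl⟩ := hφ
    obtain ⟨g, rfl⟩ := hψ
    exact ⟨f + g, rfl⟩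
  | finite p => exact ⟨hφ.1.add hψ.1, hφ.2.add hψ.2⟩

theorem schwartzBruhat_const_mul (hφ : φ ∈ ν.schwartzBruhat) (c : ℂ) :
    (fun x => c * φ x) ∈ ν.schwartzBruhat := by
  cases ν with
  | archimedean =>
    obtain ⟨f, rfl⟩ := hφ
    exact ⟨c • f, rfl⟩
  | finite p => exact ⟨hφ.1.comp (c * ·), hφ.2.mul_left⟩

theorem schwartzBruhat_sub (hφ : φ ∈ ν.schwartzBruhat) (hψ : ψ ∈ ν.schwartzBruhat) :
    (fun x => φ x - ψ x) ∈ ν.schwartzBruhat := by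
  have := schwartzBruhat_add hφ (schwartzBruhat_const_mul hψ (-1))
  simpa [sub_eq_add_neg] using this

theorem schwartzBruhat_comp_sub (hφ : φ ∈ ν.schwartzBruhat) (a : F) :
    (fun x => φ (a - x)) ∈ ν.schwartzBruhat := by
  cases ν with
  | archimedean =>
    obtain ⟨f, rfl⟩ := hφ
    refine ⟨SchwartzMap.compSubConstCLM ℂ a
      (SchwartzMap.compCLMOfContinuousLinearEquiv ℂ (ContinuousLinearEquiv.neg ℝ) f), ?_⟩
    ext x
    simp
  | finite p =>
    exact ⟨hφ.1.comp_continuous (by fun_prop), hφ.2.comp_homeomorph (Homeomorph.subLeft a)⟩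

theorem schwartzBruhat_comp_neg (hφ : φ ∈ ν.schwartzBruhat) :
    (fun x => φ (-x)) ∈ ν.schwartzBruhat := by
  simpa using schwartzBruhat_comp_sub hφ 0

theorem schwartzBruhat_continuous (hφ : φ ∈ ν.schwartzBruhat) : Continuous φ := by
  cases ν with
  | archimedean =>
    obtain ⟨f, rfl⟩ := hφ
    exact f.continuous
  | finite p => exact hφ.1.continuous

theorem schwartzBruhat_decay (hφ : φ ∈ ν.schwartzBruhat) (n : ℕ) :
    ∃ C, 0 ≤ C ∧ ∀ x, (1 + ‖x‖) ^ n * ‖φ x‖ ≤ C := by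
  suffices ∃ C, ∀ x, (1 + ‖x‖) ^ n * ‖φ x‖ ≤ C by
    obtain ⟨C, hC⟩ := this
    exact ⟨C, le_trans (by positivity) (hC 0), hC⟩
  cases ν with
  | archimedean =>
    obtain ⟨f, rfl⟩ := hφ
    have := SchwartzMap.one_add_le_sup_seminorm_apply (𝕜 := ℝ) (m := (n, 0)) le_rfl le_rfl f
    simp only [norm_iteratedFDeriv_zero] at this
    exact ⟨_, this⟩
  | finite p =>
    have hc : Continuous fun x => (((1 + ‖x‖) ^ n : ℝ) : ℂ) * φ x := by
      have := hφ.1.continuous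
      fun_prop
    have hs : HasCompactSupport fun x => (((1 + ‖x‖) ^ n : ℝ) : ℂ) * φ x := hφ.2.mul_left
    obtain ⟨C, hC⟩ := hs.exists_bound_of_continuous hc
    refine ⟨C, fun x => ?_⟩
    have h := hC x
    rwa [norm_mul, Complex.norm_real, Real.norm_of_nonneg (by positivity)] at h

theorem schwartzBruhat_bounded (hφ : φ ∈ ν.schwartzBruhat) : ∃ C, 0 ≤ C ∧ ∀ x, ‖φ x‖ ≤ C := by
  simpa using schwartzBruhat_decay hφ 0

theorem one_add_norm_le_two_mul {E : Type*} [SeminormedAddCommGroup E] {x w : E}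
    (h : ‖w - x‖ ≤ 1) : 1 + ‖x‖ ≤ 2 * (1 + ‖w‖) := by
  have : ‖x‖ ≤ ‖w‖ + ‖w - x‖ := by
    calc ‖x‖ = ‖w - (w - x)‖ := by simp
      _ ≤ _ := norm_sub_le _ _
  nlinarith [norm_nonneg w]

/-- The fibres of f form an open cover of the compact support; a Lebesgue number of this cover
works, whether x or x + z lies in the support. -/
theorem exists_pos_forall_norm_lt_eq {X Y : Type*} [SeminormedAddCommGroup X] [Zero Y] {f : X → Y}
    (hf : IsLocallyConstant f) (hc : HasCompactSupport f) :
    ∃ δ > 0, ∀ x z, ‖z‖ < δ → f (x + z) = f x := by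
  obtain ⟨δ, hδ, h⟩ := lebesgue_number_lemma_of_metric (s := tsupport f)
    (c := fun y : Y => f ⁻¹' {y}) hc (fun y => hf.isOpen_fiber y)
    (fun x _ => mem_iUnion.2 ⟨f x, rfl⟩)
  refine ⟨δ, hδ, fun x z hz => ?_⟩
  by_cases hx : x ∈ tsupport f
  · obtain ⟨y, hy⟩ := h x hx
    have h1 : f x = y := hy (mem_ball_self hδ)
    have h2 : f (x + z) = y := hy (by simpa using hz)
    rw [h1, h2]
  by_cases hx' : x + z ∈ tsupport f
  · obtain ⟨y, hy⟩ := h _ hx'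
    have h1 : f x = y := hy (by simpa [dist_eq_norm] using hz)
    have h2 : f (x + z) = y := hy (mem_ball_self hδ)
    rw [h1, h2]
  · rw [image_eq_zero_of_notMem_tsupport hx, image_eq_zero_of_notMem_tsupport hx']

/-- At an archimedean place this is the mean value inequality with a decaying derivative. At a
finite place the difference vanishes for ‖z‖ < δ, and for larger z the factor ‖z‖/δ ≥ 1 is free. -/
theorem schwartzBruhat_lipschitz (hφ : φ ∈ ν.schwartzBruhat) (n : ℕ) :
    ∃ C, 0 ≤ C ∧ ∀ x z, ‖z‖ ≤ 1 → (1 + ‖x‖) ^ n * ‖φ (x - z) - φ x‖ ≤ C * ‖z‖ := by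
  cases hν : ν with
  | archimedean =>
    rw [hν] at hφ
    obtain ⟨f, rfl⟩ := hφ
    have := SchwartzMap.one_add_le_sup_seminorm_apply (𝕜 := ℝ) (m := (n, 0)) le_rfl le_rfl
      (SchwartzMap.fderivCLM ℝ F ℂ f)
    simp only [norm_iteratedFDeriv_zero, SchwartzMap.fderivCLM_apply] at this
    set C := (2 : ℝ) ^ n * ((Finset.Iic (n, 0)).sup fun m => SchwartzMap.seminorm ℝ m.1 m.2)
      (SchwartzMap.fderivCLM ℝ F ℂ f)
    have hC : 0 ≤ C := le_trans (by positivity) (this 0)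
    refine ⟨2 ^ n * C, by positivity, fun x z hz => ?_⟩
    have hb : ∀ w ∈ closedBall x ‖z‖, ‖fderiv ℝ f w‖ ≤ 2 ^ n * C / (1 + ‖x‖) ^ n := by
      intro w hw
      rw [le_div_iff₀ (by positivity)]
      have h1 : 1 + ‖x‖ ≤ 2 * (1 + ‖w‖) :=
        one_add_norm_le_two_mul ((by simpa [dist_eq_norm] using hw : ‖w - x‖ ≤ ‖z‖).trans hz)
      calc ‖fderiv ℝ f w‖ * (1 + ‖x‖) ^ n ≤ ‖fderiv ℝ f w‖ * (2 * (1 + ‖w‖)) ^ n := by gcongr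
        _ = 2 ^ n * ((1 + ‖w‖) ^ n * ‖fderiv ℝ f w‖) := by rw [mul_pow]; ring
        _ ≤ _ := by gcongr; exact this w
    have h2 := (convex_closedBall x ‖z‖).norm_image_sub_le_of_norm_fderiv_le
      (fun w _ => f.differentiableAt) hb (mem_closedBall_self (norm_nonneg z))
      (show x - z ∈ closedBall x ‖z‖ by simp)
    rw [show x - z - x = -z by ring, norm_neg, div_mul_eq_mul_div, le_div_iff₀ (by positivity)] at h2
    rw [mul_comm]
    exact h2
  | finite p =>
    rw [hν] at hφ
    obtain ⟨δ, hδ, h⟩ := exists_pos_forall_norm_lt_eq hφ.1 hφ.2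
    obtain ⟨C, hC0, hC⟩ := schwartzBruhat_decay hφ n
    refine ⟨(2 ^ n * C + C) / δ, by positivity, fun x z hz => ?_⟩
    rcases lt_or_ge ‖z‖ δ with hzδ | hzδ
    · have := h x (-z) (by simpa using hzδ)
      rw [← sub_eq_add_neg] at this
      rw [this, sub_self, norm_zero, mul_zero]
      positivity
    · have h1 : 1 + ‖x‖ ≤ 2 * (1 + ‖x - z‖) := one_add_norm_le_two_mul (by simpa using hz)
      calc (1 + ‖x‖) ^ n * ‖φ (x - z) - φ x‖
          ≤ (1 + ‖x‖) ^ n * ‖φ (x - z)‖ + (1 + ‖x‖) ^ n * ‖φ x‖ := by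
            rw [← mul_add]; gcongr; exact norm_sub_le _ _
        _ ≤ (2 * (1 + ‖x - z‖)) ^ n * ‖φ (x - z)‖ + (1 + ‖x‖) ^ n * ‖φ x‖ := by gcongr
        _ = 2 ^ n * ((1 + ‖x - z‖) ^ n * ‖φ (x - z)‖) + (1 + ‖x‖) ^ n * ‖φ x‖ := by
            rw [mul_pow]; ring
        _ ≤ 2 ^ n * C + C := by gcongr <;> apply hC
        _ = (2 ^ n * C + C) / δ * δ := by field_simp
        _ ≤ _ := by gcongr

variable (ν) in
theorem exists_bump (c : F) {r : ℝ} (hr : 0 < r) :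
    ∃ ρ : F → ℝ, (fun x => (ρ x : ℂ)) ∈ ν.schwartzBruhat ∧ (∀ x, 0 ≤ ρ x ∧ ρ x ≤ 1) ∧
      (∀ x ∈ closedBall c r, ρ x = 1) ∧ ∀ x ∉ closedBall c (2 * r), ρ x = 0 := by
  cases hν : ν with
  | archimedean =>
    let b : ContDiffBump c := ⟨r, 2 * r, hr, by linarith⟩
    have hsupp : HasCompactSupport fun x => (b x : ℂ) :=
      b.hasCompactSupport.comp_left (g := ((↑) : ℝ → ℂ)) Complex.ofReal_zero
    have hsm : ContDiff ℝ ((⊤ : ℕ∞) : WithTop ℕ∞) fun x => (b x : ℂ) :=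
      Complex.ofRealCLM.contDiff.comp b.contDiff
    refine ⟨b, ⟨hsupp.toSchwartzMap hsm, rfl⟩, fun x => ⟨b.nonneg, b.le_one⟩,
      fun x hx => b.one_of_mem_closedBall hx, fun x hx => b.zero_of_le_dist ?_⟩
    exact (not_le.1 hx).le
  | finite p =>
    have := isUltrametricDist_of_padic (F := F) p
    have : ProperSpace F := ν.properSpace
    classical
    have hcl : IsClopen (closedBall c r) := IsUltrametricDist.isClopen_closedBall c hr.ne'
    refine ⟨fun x => if x ∈ closedBall c r then 1 else 0, ⟨?_, ?_⟩, ?_, ?_, ?_⟩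
    · rw [IsLocallyConstant.iff_eventually_eq]
      intro x
      by_cases hx : x ∈ closedBall c r
      · filter_upwards [hcl.isOpen.mem_nhds hx] with y hy
        simp only [hx, hy]
      · filter_upwards [hcl.compl.isOpen.mem_nhds hx] with y hy
        have hy' : y ∉ closedBall c r := hy
        simp only [hx, hy']
    · refine HasCompactSupport.intro (isCompact_closedBall c r) fun x hx => by simp only [hx]; simp
    · intro x; dsimp only; split_ifs <;> simp
    · intro x hx; simp only [hx, if_true]
    · intro x hx
      have : x ∉ closedBall c r := fun h => hx (closedBall_subset_closedBall (by linarith) h)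
      simp only [this, if_false]

/-! ### Test functions on the punctured field -/

theorem exists_pos_forall_norm_lt_eq_zero (h0 : (0 : F) ∉ tsupport φ) :
    ∃ ε > 0, ∀ x, ‖x‖ < ε → φ x = 0 := by
  obtain ⟨ε, hε, h⟩ := Metric.isOpen_iff.1 (isClosed_tsupport φ).isOpen_compl 0 h0
  exact ⟨ε, hε, fun x hx => image_eq_zero_of_notMem_tsupport (h (by simpa using hx))⟩

/-- Vanishing near 0 removes the only singularity of log|x|. At a finite place the norm is locally
constant off 0 by the ultrametric inequality. This stability is what makes iterated commutators
meaningful on the punctured test functions. -/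
theorem opA_mem_schwartzBruhatPunctured (hφ : φ ∈ ν.schwartzBruhatPunctured) :
    ν.opA φ ∈ ν.schwartzBruhatPunctured := by
  obtain ⟨hφ, h0⟩ := hφ
  obtain ⟨ε, hε, hz⟩ := exists_pos_forall_norm_lt_eq_zero h0
  refine ⟨?_, fun h => h0 (closure_mono ?_ h)⟩
  swap
  · intro x hx hφx
    exact hx (by simp [opA, hφx])
  have hlog : ∀ x, ν.opA φ x = ν.degree * ((Real.log ‖x‖ : ℂ) * φ x) := by
    intro x
    simp [opA, modulus, Real.log_pow, mul_assoc]
  cases hν : ν with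
  | archimedean =>
    rw [hν] at hφ hlog
    obtain ⟨f, rfl⟩ := hφ
    have : ∃ g : 𝓢(F, ℂ), ∀ x, g x = (Real.log ‖x‖ : ℂ) * f x := by
      rcases NormedAlgebra.Real.exists_linearIsometryEquiv F with ⟨⟨e⟩⟩ | ⟨⟨e⟩⟩
      · exact SchwartzMap.exists_eq_log_norm_mul_of_isometry e f hε hz
      · exact SchwartzMap.exists_eq_log_norm_mul_of_isometry e f hε hz
    obtain ⟨g, hg⟩ := this
    refine ⟨((archimedean (F := F)).degree : ℂ) • g, ?_⟩
    ext x
    rw [hlog, ← hg]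
    rfl
  | finite p =>
    have := isUltrametricDist_of_padic (F := F) p
    rw [hν] at hφ hlog
    refine ⟨?_, HasCompactSupport.mul_left hφ.2⟩
    rw [IsLocallyConstant.iff_eventually_eq]
    intro x
    rcases eq_or_ne x 0 with rfl | hx
    · filter_upwards [ball_mem_nhds 0 hε] with y hy
      rw [hlog, hlog, hz y (by simpa using hy), hz 0 (by simpa using hε)]
      simp
    · filter_upwards [hφ.1.eventually_eq x, ball_mem_nhds x (norm_pos_iff.2 hx)] with y hy hy'
      have : ‖y‖ = ‖x‖ := by
        have h1 : ‖y - x‖ < ‖x‖ := by simpa [dist_eq_norm] using hy'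
        have h2 := IsUltrametricDist.norm_add_eq_max_of_norm_ne_norm h1.ne
        rw [sub_add_cancel, max_eq_right h1.le] at h2
        exact h2
      rw [hlog, hlog, hy, this]

end LocalPlace

/-! ### The basic additive character -/

theorem padicPolarPart_spec (p : ℕ) [Fact p.Prime] (a : ℚ_[p]) :
    (∃ m n : ℕ, m < p ^ n ∧ padicPolarPart p a = (m : ℚ) / (p : ℚ) ^ n) ∧
      ‖a - (padicPolarPart p a : ℚ_[p])‖ ≤ 1 :=
  (padic_exists_polarPart p a).choose_spec

theorem Padic.exists_int_eq_of_norm_le_one (p : ℕ) [Fact p.Prime] (k : ℤ) (n : ℕ)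
    (h : ‖(((k : ℚ) / (p : ℚ) ^ n : ℚ) : ℚ_[p])‖ ≤ 1) : ∃ j : ℤ, (k : ℚ) / (p : ℚ) ^ n = j := by
  have hp : p.Prime := Fact.out
  have hp0 : (0 : ℝ) < p := by exact_mod_cast hp.pos
  push_cast at h
  rw [norm_div, norm_pow, Padic.norm_p, div_le_iff₀ (by positivity), one_mul, inv_pow,
    ← zpow_natCast, ← zpow_neg, Padic.norm_int_le_pow_iff_dvd] at h
  obtain ⟨j, rfl⟩ := h
  refine ⟨j, ?_⟩
  have : (p : ℚ) ^ n ≠ 0 := pow_ne_zero _ (by exact_mod_cast hp.ne_zero)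
  push_cast
  field_simp

/-- Two fractions with p-power denominators that agree modulo p-adic integers differ by an ordinary
integer, which the exponential ignores. So any representative may replace the chosen polar part. -/
theorem exp_padicPolarPart_eq (p : ℕ) [Fact p.Prime] (a : ℚ_[p]) (k : ℤ) (n : ℕ)
    (h : ‖a - (((k : ℚ) / (p : ℚ) ^ n : ℚ) : ℚ_[p])‖ ≤ 1) :
    Complex.exp (2 * Real.pi * Complex.I * (padicPolarPart p a : ℚ)) =
      Complex.exp (2 * Real.pi * Complex.I * (((k : ℚ) / (p : ℚ) ^ n : ℚ) : ℂ)) := by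
  have hp : p.Prime := Fact.out
  have hp0 : (p : ℚ) ≠ 0 := by exact_mod_cast hp.ne_zero
  obtain ⟨⟨m, l, -, hm⟩, h2⟩ := padicPolarPart_spec p a
  have hdiff : padicPolarPart p a - (k : ℚ) / (p : ℚ) ^ n =
      ((m * p ^ n - k * p ^ l : ℤ) : ℚ) / (p : ℚ) ^ (l + n) := by
    rw [hm, pow_add]; push_cast; field_simp
  have hn : ‖((padicPolarPart p a - (k : ℚ) / (p : ℚ) ^ n : ℚ) : ℚ_[p])‖ ≤ 1 := by
    have : ((padicPolarPart p a - (k : ℚ) / (p : ℚ) ^ n : ℚ) : ℚ_[p]) =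
        (a - (((k : ℚ) / (p : ℚ) ^ n : ℚ) : ℚ_[p])) + -(a - (padicPolarPart p a : ℚ_[p])) := by
      push_cast; ring
    rw [this]
    exact (Padic.nonarchimedean _ _).trans (max_le h (by rwa [norm_neg]))
  rw [hdiff] at hn
  obtain ⟨j, hj⟩ := Padic.exists_int_eq_of_norm_le_one p _ _ hn
  rw [Complex.exp_eq_exp_iff_exists_int]
  refine ⟨j, ?_⟩
  have : padicPolarPart p a = (k : ℚ) / (p : ℚ) ^ n + j := by rw [← hj, ← hdiff]; ring
  rw [this]
  push_cast
  ring

theorem exp_padicPolarPart_add (p : ℕ) [Fact p.Prime] (a b : ℚ_[p]) :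
    Complex.exp (2 * Real.pi * Complex.I * (padicPolarPart p (a + b) : ℚ)) =
      Complex.exp (2 * Real.pi * Complex.I * (padicPolarPart p a : ℚ)) *
        Complex.exp (2 * Real.pi * Complex.I * (padicPolarPart p b : ℚ)) := by
  have hp : p.Prime := Fact.out
  have hp0 : (p : ℚ) ≠ 0 := by exact_mod_cast hp.ne_zero
  obtain ⟨⟨m, l, -, hm⟩, h2⟩ := padicPolarPart_spec p a
  obtain ⟨⟨m', l', -, hm'⟩, h2'⟩ := padicPolarPart_spec p b
  have hsum : padicPolarPart p a + padicPolarPart p b =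
      ((m * p ^ l' + m' * p ^ l : ℤ) : ℚ) / (p : ℚ) ^ (l + l') := by
    rw [hm, hm', pow_add]; push_cast; field_simp
  rw [exp_padicPolarPart_eq p (a + b) _ (l + l'), ← hsum, ← Complex.exp_add]
  · push_cast; ring_nf
  · rw [← hsum]
    push_cast
    rw [add_sub_add_comm]
    exact (Padic.nonarchimedean _ _).trans (max_le h2 h2')

theorem exp_padicPolarPart_of_norm_le_one (p : ℕ) [Fact p.Prime] {a : ℚ_[p]} (ha : ‖a‖ ≤ 1) :
    Complex.exp (2 * Real.pi * Complex.I * (padicPolarPart p a : ℚ)) = 1 := by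
  rw [exp_padicPolarPart_eq p a 0 0 (by simpa using ha)]
  simp

namespace LocalPlace

variable {F : Type*} [NormedField F] (ν : LocalPlace F)

theorem basicChar_add (x y : F) :
    ν.basicChar (x + y) = ν.basicChar x * ν.basicChar y := by
  cases ν with
  | archimedean =>
    simp only [basicChar, map_add, ← Complex.exp_add]
    push_cast; ring_nf
  | finite p =>
    simp only [basicChar, map_add]
    exact exp_padicPolarPart_add p _ _

@[simp] theorem basicChar_zero : ν.basicChar 0 = 1 := by
  cases ν with
  | archimedean => simp [basicChar]
  | finite p =>
    simp only [basicChar, map_zero]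
    exact exp_padicPolarPart_of_norm_le_one p (by simp)

@[simp] theorem norm_basicChar (x : F) : ‖ν.basicChar x‖ = 1 := by
  cases ν with
  | archimedean =>
    simp only [basicChar]
    rw [show -(2 * Real.pi * Complex.I * (Algebra.trace ℝ F x : ℂ)) =
      ((-(2 * Real.pi * Algebra.trace ℝ F x) : ℝ) : ℂ) * Complex.I by push_cast; ring]
    exact Complex.norm_exp_ofReal_mul_I _
  | finite p =>
    simp only [basicChar]
    rw [show (2 * Real.pi * Complex.I * (padicPolarPart p (Algebra.trace ℚ_[p] F x) : ℂ)) =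
      ((2 * Real.pi * (padicPolarPart p (Algebra.trace ℚ_[p] F x) : ℝ) : ℝ) : ℂ) * Complex.I by
        push_cast; ring]
    exact Complex.norm_exp_ofReal_mul_I _

theorem exists_basicChar_eq_one (p : ℕ) [Fact p.Prime] [NormedAlgebra ℚ_[p] F]
    [FiniteDimensional ℚ_[p] F] :
    ∃ δ > 0, ∀ x : F, ‖x‖ < δ → (finite p : LocalPlace F).basicChar x = 1 := by
  have hc : Continuous (Algebra.trace ℚ_[p] F) := LinearMap.continuous_of_finiteDimensional _
  obtain ⟨δ, hδ, h⟩ := Metric.continuous_iff.1 hc 0 1 one_pos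
  refine ⟨δ, hδ, fun x hx => ?_⟩
  apply exp_padicPolarPart_of_norm_le_one
  have := h x (by simpa using hx)
  rw [map_zero, dist_zero_right] at this
  exact this.le

theorem continuous_basicChar : Continuous ν.basicChar := by
  cases hν : ν with
  | archimedean =>
    have hc : Continuous (Algebra.trace ℝ F) := LinearMap.continuous_of_finiteDimensional _
    unfold basicChar
    fun_prop
  | finite p =>
    obtain ⟨δ, hδ, h⟩ := exists_basicChar_eq_one (F := F) p
    refine IsLocallyConstant.continuous ((IsLocallyConstant.iff_eventually_eq _).2 fun x => ?_)
    filter_upwards [ball_mem_nhds x hδ] with y hy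
    rw [show y = (y - x) + x by ring, basicChar_add, h _ (by simpa [dist_eq_norm] using hy), one_mul]

theorem exists_basicChar_ne_one (p : ℕ) [Fact p.Prime] [NormedAlgebra ℚ_[p] F]
    [FiniteDimensional ℚ_[p] F] : ∃ x : F, (finite p : LocalPlace F).basicChar x ≠ 1 := by
  have hp : p.Prime := Fact.out
  -- An element of trace 1/p: its character value is exp(2πi/p). The cast form matches
  -- `exp_padicPolarPart_eq`.
  obtain ⟨x, hx⟩ := Algebra.trace_surjective ℚ_[p] F (((1 : ℤ) / (p : ℚ) ^ 1 : ℚ) : ℚ_[p])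
  refine ⟨x, ?_⟩
  show Complex.exp _ ≠ 1
  rw [hx, exp_padicPolarPart_eq p _ 1 1 (by simp), Ne, Complex.exp_eq_one_iff]
  rintro ⟨n, hn⟩
  have h2 : (2 * Real.pi * Complex.I : ℂ) ≠ 0 := Complex.two_pi_I_ne_zero
  rw [mul_comm, mul_left_inj' h2] at hn
  have h3 : (1 : ℚ) / p = n := by
    have h7 : ((((1 : ℤ) / (p : ℚ) ^ 1 : ℚ)) : ℂ) = ((n : ℚ) : ℂ) := by rw [hn]; simp
    have h8 := Rat.cast_injective h7
    simpa using h8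
  have hp0 : (p : ℚ) ≠ 0 := by exact_mod_cast hp.ne_zero
  rw [div_eq_iff hp0] at h3
  have h4 : (1 : ℤ) = n * p := by exact_mod_cast h3
  have h5 : (p : ℤ) ∣ 1 := ⟨n, by rw [h4]; ring⟩
  have h6 : p ∣ 1 := by exact_mod_cast h5
  exact hp.one_lt.ne' (Nat.dvd_one.1 h6)

end LocalPlace

/-! ### The Fourier transform at an archimedean place -/

theorem ContinuousLinearEquiv.exists_integral_comp {E V : Type*}
    [NormedAddCommGroup E] [NormedSpace ℝ E] [MeasurableSpace E] [BorelSpace E]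
    [NormedAddCommGroup V] [NormedSpace ℝ V] [FiniteDimensional ℝ V] [MeasurableSpace V]
    [BorelSpace V] (e : E ≃L[ℝ] V) (μ : Measure E) [μ.IsAddHaarMeasure]
    (μ' : Measure V) [μ'.IsAddHaarMeasure] :
    ∃ c : ℝ, 0 < c ∧ ∀ f : V → ℂ, ∫ x, f (e x) ∂μ = c * ∫ v, f v ∂μ' := by
  have : (μ.map e).IsAddHaarMeasure := e.isAddHaarMeasure_map μ
  refine ⟨Measure.addHaarScalarFactor (μ.map e) μ',
    NNReal.coe_pos.2 (Measure.addHaarScalarFactor_pos_of_isAddHaarMeasure _ _), fun f => ?_⟩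
  have h0 : ∫ y, f y ∂(μ.map e) = ∫ x, f (e x) ∂μ :=
    e.toHomeomorph.measurableEmbedding.integral_map f
  have h := Measure.isAddLeftInvariant_eq_smul (μ.map e) μ'
  rw [← h0]
  conv_lhs => rw [h]
  rw [integral_smul_nnreal_measure]
  simp [NNReal.smul_def]

namespace LocalPlace

open scoped FourierTransform

/-- The trace form is nondegenerate, so by Riesz representation it is the inner product twisted by a
linear isomorphism. This turns the transform attached to λ into the Euclidean one. -/
theorem exists_inner_eq_trace {F : Type*} [NormedField F] [NormedAlgebra ℝ F]
    [FiniteDimensional ℝ F] {V : Type*} [NormedAddCommGroup V] [InnerProductSpace ℝ V]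
    [FiniteDimensional ℝ V] (e : F ≃L[ℝ] V) :
    ∃ M : F ≃L[ℝ] V, ∀ y x, inner ℝ (M y) (e x) = Algebra.trace ℝ F (y * x) := by
  let M₀ : F →ₗ[ℝ] V :=
    { toFun := fun y => (InnerProductSpace.toDual ℝ V).symm
        (LinearMap.toContinuousLinearMap ((Algebra.traceForm ℝ F y).comp
          (e.symm : V →ₗ[ℝ] F)))
      map_add' := fun y z => by
        rw [← map_add, map_add, LinearMap.add_comp, map_add]
      map_smul' := fun r y => by
        rw [map_smul, LinearMap.smul_comp, map_smul, map_smulₛₗ]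
        simp }
  have hM : ∀ y x, inner ℝ (M₀ y) (e x) = Algebra.trace ℝ F (y * x) := by
    intro y x
    show inner ℝ ((InnerProductSpace.toDual ℝ V).symm _) (e x) = _
    rw [InnerProductSpace.toDual_symm_apply]
    show Algebra.trace ℝ F (y * e.symm (e x)) = _
    rw [e.symm_apply_apply]
  have hinj : Function.Injective M₀ := by
    rw [injective_iff_map_eq_zero]
    intro y hy
    refine (traceForm_nondegenerate ℝ F).1 y fun x => ?_
    have := hM y x
    rw [hy, inner_zero_left] at this
    exact this.symm
  exact ⟨(LinearMap.linearEquivOfInjective M₀ hinj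
    e.toLinearEquiv.finrank_eq).toContinuousLinearEquiv, hM⟩

theorem exists_fourierWith_of_linearEquiv {F : Type*} [NormedField F] [MeasurableSpace F]
    [BorelSpace F] [NormedAlgebra ℝ F] [FiniteDimensional ℝ F] {V : Type*} [NormedAddCommGroup V]
    [InnerProductSpace ℝ V] [FiniteDimensional ℝ V] [MeasurableSpace V] [BorelSpace V]
    (e : F ≃L[ℝ] V) (μ : Measure F) [μ.IsAddHaarMeasure] :
    ∃ κ : ℝ, 0 < κ ∧ ∀ φ ∈ (archimedean : LocalPlace F).schwartzBruhat,
      (archimedean : LocalPlace F).fourierWith μ φ ∈ (archimedean : LocalPlace F).schwartzBruhat ∧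
      ∀ x, (archimedean : LocalPlace F).fourierWith μ
        ((archimedean : LocalPlace F).fourierWith μ φ) x = κ * φ (-x) := by
  obtain ⟨M, hM⟩ := exists_inner_eq_trace e
  obtain ⟨c, hc, hce⟩ := e.exists_integral_comp μ (volume : Measure V)
  obtain ⟨c', hc', hce'⟩ := (e.symm.trans M).exists_integral_comp (volume : Measure V)
    (volume : Measure V)
  -- The archimedean λ has a minus sign in its exponent, so λ(-yx) = exp(2πi Tr(yx)) is the kernel
  -- of Mathlib's inverse transform.
  have hF : ∀ f : 𝓢(F, ℂ), (archimedean : LocalPlace F).fourierWith μ f = fun y =>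
      (c : ℂ) * (𝓕⁻ (SchwartzMap.compCLMOfContinuousLinearEquiv ℂ e.symm f) : 𝓢(V, ℂ)) (M y) := by
    intro f
    ext y
    rw [SchwartzMap.fourierInv_coe, Real.fourierInv_eq', ← hce]
    unfold fourierWith basicChar
    congr 1
    ext x
    simp only [SchwartzMap.compCLMOfContinuousLinearEquiv_apply, Function.comp_apply,
      e.symm_apply_apply, smul_eq_mul]
    rw [mul_comm, map_neg, ← hM, real_inner_comm]
    push_cast
    ring_nf
  refine ⟨c ^ 2 * c', by positivity, ?_⟩
  rintro _ ⟨f, rfl⟩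
  let f' : 𝓢(V, ℂ) := 𝓕⁻ (SchwartzMap.compCLMOfContinuousLinearEquiv ℂ e.symm f)
  let g : 𝓢(F, ℂ) := (c : ℂ) • SchwartzMap.compCLMOfContinuousLinearEquiv ℂ M f'
  have hg : (archimedean : LocalPlace F).fourierWith μ f = g := hF f
  refine ⟨⟨g, hg.symm⟩, fun x => ?_⟩
  rw [hg, hF g]
  beta_reduce
  rw [SchwartzMap.fourierInv_coe, Real.fourierInv_eq']
  have h1 : ∀ v : V, Complex.exp (((2 * Real.pi * inner ℝ v (M x) : ℝ) : ℂ) * Complex.I) •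
      (SchwartzMap.compCLMOfContinuousLinearEquiv ℂ e.symm g) v =
      (fun w => c * (Complex.exp (((2 * Real.pi * inner ℝ w (e x) : ℝ) : ℂ) * Complex.I) •
        f' w)) ((e.symm.trans M) v) := by
    intro v
    -- Symmetry of the trace form lets the twist pass to the other argument, so that Euclidean
    -- inversion applies after the substitution w = M e⁻¹ v.
    have h2 : inner ℝ v (M x) = inner ℝ (M (e.symm v)) (e x) := by
      rw [hM, real_inner_comm]
      conv_lhs => rw [← e.apply_symm_apply v]
      rw [hM, mul_comm]
    simp only [SchwartzMap.compCLMOfContinuousLinearEquiv_apply, Function.comp_apply, g,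
      smul_apply, h2, ContinuousLinearEquiv.trans_apply, smul_eq_mul]
    ring
  rw [(integral_congr_ae (Eventually.of_forall h1)).trans (hce' fun w => c * (Complex.exp
    (((2 * Real.pi * inner ℝ w (e x) : ℝ) : ℂ) * Complex.I) • f' w)), integral_const_mul, ← Real.fourierInv_eq', Real.fourierInv_eq_fourier_neg,
    ← SchwartzMap.fourier_coe, FourierTransform.fourier_fourierInv_eq]
  simp only [SchwartzMap.compCLMOfContinuousLinearEquiv_apply, Function.comp_apply, map_neg,
    e.symm_apply_apply]
  push_cast
  ring

theorem exists_fourierWith_archimedean {F : Type*} [NormedField F] [MeasurableSpace F]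
    [BorelSpace F] [NormedAlgebra ℝ F] [FiniteDimensional ℝ F] (μ : Measure F)
    [μ.IsAddHaarMeasure] :
    ∃ κ : ℝ, 0 < κ ∧ ∀ φ ∈ (archimedean : LocalPlace F).schwartzBruhat,
      (archimedean : LocalPlace F).fourierWith μ φ ∈ (archimedean : LocalPlace F).schwartzBruhat ∧
      ∀ x, (archimedean : LocalPlace F).fourierWith μ
        ((archimedean : LocalPlace F).fourierWith μ φ) x = κ * φ (-x) :=
  exists_fourierWith_of_linearEquiv (ContinuousLinearEquiv.ofFinrankEq (by simp) :
    F ≃L[ℝ] EuclideanSpace ℝ (Fin (Module.finrank ℝ F))) μ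

end LocalPlace

namespace LocalPlace

variable {F : Type*} [NormedField F] (ν : LocalPlace F)

/-! ### The Fourier transform at a finite place -/

/-- The dual lattice of the unit ball, with respect to `λ(xy)`, is a ball. -/
theorem exists_forall_basicChar_eq_one_iff (p : ℕ) [Fact p.Prime] [NormedAlgebra ℚ_[p] F]
    [FiniteDimensional ℚ_[p] F] :
    ∃ y₀ : F, y₀ ≠ 0 ∧ ∀ y : F,
      (∀ x, ‖x‖ ≤ 1 → (finite p : LocalPlace F).basicChar (y * x) = 1) ↔ ‖y‖ ≤ ‖y₀‖ := by
  set ν : LocalPlace F := finite p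
  have : ProperSpace F := ν.properSpace
  -- `D` contains with y everything of norm at most ‖y‖, is closed, and is bounded because λ is
  -- nontrivial; an element of maximal norm is the desired radius. It is nonzero because λ is
  -- trivial near 0.
  let D : Set F := {y | ∀ x, ‖x‖ ≤ 1 → ν.basicChar (y * x) = 1}
  have hD : ∀ y y' : F, y ∈ D → ‖y'‖ ≤ ‖y‖ → y' ∈ D := by
    intro y y' hy hyy x hx
    rcases eq_or_ne y 0 with rfl | hy0
    · have : y' = 0 := by simpa using hyy
      simp [this]
    · have h1 := hy (y' / y * x) (by
        rw [norm_mul, norm_div]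
        exact mul_le_one₀ (div_le_one_of_le₀ hyy (norm_nonneg _)) (norm_nonneg _) hx)
      rwa [← mul_assoc, mul_div_cancel₀ _ hy0] at h1
  have hcl : IsClosed D := by
    have : D = ⋂ x : F, ⋂ _ : ‖x‖ ≤ 1, {y | ν.basicChar (y * x) = 1} := by
      ext; simp [D]
    rw [this]
    refine isClosed_iInter fun x => isClosed_iInter fun _ => isClosed_eq ?_ continuous_const
    exact ν.continuous_basicChar.comp (by fun_prop)
  obtain ⟨w, hw⟩ := exists_basicChar_ne_one (F := F) p
  have hbd : D ⊆ closedBall 0 ‖w‖ := by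
    intro y hy
    by_contra hyw
    have h1 : ‖w‖ < ‖y‖ := by simpa using hyw
    have h2 : y ≠ 0 := norm_pos_iff.1 ((norm_nonneg w).trans_lt h1)
    apply hw
    have := hy (w / y) (by rw [norm_div]; exact div_le_one_of_le₀ h1.le (norm_nonneg _))
    rwa [mul_div_cancel₀ _ h2] at this
  have hcomp : IsCompact D := (isCompact_closedBall 0 ‖w‖).of_isClosed_subset hcl hbd
  obtain ⟨y₀, hy₀, hmax⟩ := hcomp.exists_isMaxOn ⟨0, fun x _ => by simp⟩ continuous_norm.continuousOn
  obtain ⟨δ, hδ, h⟩ := exists_basicChar_eq_one (F := F) p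
  obtain ⟨u, hu0, hu⟩ := ν.exists_norm_lt_one
  obtain ⟨n, hn⟩ := exists_pow_lt_of_lt_one hδ hu
  have hun : u ^ n ∈ D := by
    intro x hx
    apply h
    rw [norm_mul, norm_pow]
    exact (mul_le_of_le_one_right (by positivity) hx).trans_lt hn
  refine ⟨y₀, ?_, fun y => ⟨fun hy => hmax hy, fun hy => hD _ _ hy₀ hy⟩⟩
  rintro rfl
  have : ‖u ^ n‖ ≤ ‖(0 : F)‖ := hmax hun
  exact absurd (norm_le_zero_iff.1 (this.trans norm_zero.le)) (pow_ne_zero n hu0)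

theorem forall_basicChar_mul_eq_one_iff {y₀ : F} (h₀ : ∀ y : F,
      (∀ x, ‖x‖ ≤ 1 → ν.basicChar (y * x) = 1) ↔ ‖y‖ ≤ ‖y₀‖) {t : F} (ht : t ≠ 0) (y : F) :
    (∀ x, ‖x‖ ≤ ‖t‖ → ν.basicChar (y * x) = 1) ↔ ‖y‖ ≤ ‖y₀ / t‖ := by
  rw [norm_div, le_div_iff₀ (norm_pos_iff.2 ht), ← norm_mul, ← h₀]
  constructor
  · intro h x hx
    rw [mul_assoc]
    exact h _ (by rw [norm_mul]; exact mul_le_of_le_one_right (norm_nonneg _) hx)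
  · intro h x hx
    have := h (x / t) (by rw [norm_div]; exact div_le_one_of_le₀ hx (norm_nonneg _))
    rwa [mul_assoc, mul_div_cancel₀ _ ht] at this

theorem exists_norm_le_of_isCompact {s : Set F} (ν : LocalPlace F) (hs : IsCompact s) :
    ∃ T : F, T ≠ 0 ∧ ∀ x ∈ s, ‖x‖ ≤ ‖T‖ := by
  obtain ⟨R, hR⟩ := hs.isBounded.exists_norm_le
  obtain ⟨u, hu0, hu⟩ := ν.exists_norm_lt_one
  obtain ⟨n, hn⟩ := pow_unbounded_of_one_lt R ((one_lt_inv₀ (norm_pos_iff.2 hu0)).2 hu)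
  refine ⟨u⁻¹ ^ n, by simp [hu0], fun x hx => (hR x hx).trans ?_⟩
  rw [norm_pow, norm_inv]
  exact hn.le

theorem exists_norm_lt (ν : LocalPlace F) {δ : ℝ} (hδ : 0 < δ) : ∃ t : F, t ≠ 0 ∧ ‖t‖ < δ := by
  obtain ⟨u, hu0, hu⟩ := ν.exists_norm_lt_one
  obtain ⟨n, hn⟩ := exists_pow_lt_of_lt_one hδ hu
  exact ⟨u ^ n, pow_ne_zero _ hu0, by rwa [norm_pow]⟩

variable [MeasurableSpace F] [BorelSpace F] (μ : Measure F) [μ.IsAddHaarMeasure]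

theorem measure_closedBall_norm [ProperSpace F] {t : F} (ht : t ≠ 0) (a : F) :
    μ.real (closedBall a ‖t‖) = ν.modulus t * μ.real (closedBall 0 1) := by
  have h1 : closedBall a ‖t‖ = a +ᵥ (Units.mk0 t ht • closedBall (0 : F) 1) := by
    ext x
    rw [Set.mem_vadd_set_iff_neg_vadd_mem, Set.mem_smul_set_iff_inv_smul_mem]
    simp only [mem_closedBall, dist_eq_norm, vadd_eq_add, Units.smul_def,
      Units.val_inv_eq_inv_val, Units.val_mk0, smul_eq_mul, norm_mul, norm_inv, sub_zero]
    rw [inv_mul_le_iff₀ (norm_pos_iff.2 ht), mul_one, neg_add_eq_sub]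
  rw [measureReal_def, h1, measure_vadd, ← distribHaarChar_mul, ENNReal.toReal_mul,
    ENNReal.coe_toReal, ν.distribHaarChar_eq_modulus, measureReal_def]
  rfl

/-- Orthogonality of characters: the ball is a group, and translating by an x in it with λ(wx) ≠ 1
multiplies the integral by λ(wx). -/
theorem setIntegral_basicChar [IsUltrametricDist F] [ProperSpace F] {y₀ : F}
    (h₀ : ∀ y : F, (∀ x, ‖x‖ ≤ 1 → ν.basicChar (y * x) = 1) ↔ ‖y‖ ≤ ‖y₀‖)
    {t : F} (ht : t ≠ 0) (w : F) :
    ∫ y in closedBall 0 ‖t‖, ν.basicChar (w * y) ∂μ =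
      if ‖w‖ ≤ ‖y₀ / t‖ then (μ.real (closedBall 0 ‖t‖) : ℂ) else 0 := by
  split_ifs with h
  · have h1 := (ν.forall_basicChar_mul_eq_one_iff h₀ ht w).2 h
    rw [setIntegral_congr_fun (g := fun _ => (1 : ℂ)) isClosed_closedBall.measurableSet
      (fun y hy => h1 y (by simpa using hy))]
    simp
  · rw [← ν.forall_basicChar_mul_eq_one_iff h₀ ht w] at h
    push Not at h
    obtain ⟨x, hx, hne⟩ := h
    have h1 : ∫ y in closedBall 0 ‖t‖, ν.basicChar (w * y) ∂μ =
        ν.basicChar (w * x) * ∫ y in closedBall 0 ‖t‖, ν.basicChar (w * y) ∂μ := by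
      rw [← integral_indicator isClosed_closedBall.measurableSet, ← integral_const_mul,
        ← integral_add_left_eq_self _ x]
      congr 1
      ext y
      have hiff : x + y ∈ closedBall (0 : F) ‖t‖ ↔ y ∈ closedBall (0 : F) ‖t‖ := by
        simp only [mem_closedBall, dist_zero_right]
        constructor
        · intro hxy
          calc ‖y‖ = ‖(x + y) + -x‖ := by ring_nf
            _ ≤ max _ _ := IsUltrametricDist.norm_add_le_max _ _
            _ ≤ ‖t‖ := max_le hxy (by rwa [norm_neg])
        · intro hy
          exact (IsUltrametricDist.norm_add_le_max _ _).trans (max_le hx hy)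
      by_cases hy : y ∈ closedBall (0 : F) ‖t‖
      · rw [indicator_of_mem (hiff.2 hy), indicator_of_mem hy, mul_add, basicChar_add]
      · rw [indicator_of_notMem (mt hiff.1 hy), indicator_of_notMem hy, mul_zero]
    have h2 : (1 - ν.basicChar (w * x)) * ∫ y in closedBall 0 ‖t‖, ν.basicChar (w * y) ∂μ = 0 := by
      rw [sub_mul, one_mul, ← h1, sub_self]
    exact (mul_eq_zero.1 h2).resolve_left (sub_ne_zero.2 hne.symm)

/-- Balls of radii ‖t‖ and ‖y₀/t‖ are dual to each other: invariance of φ under the first becomes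
support of its transform in the second, and conversely. Integrating the second transform over that
support collapses it to a mean of φ over the ball of radius ‖t‖ around -x, where φ is constant. -/
theorem exists_fourierWith_finite (p : ℕ) [Fact p.Prime] [NormedAlgebra ℚ_[p] F]
    [FiniteDimensional ℚ_[p] F] :
    ∃ κ : ℝ, 0 < κ ∧ ∀ φ ∈ (finite p : LocalPlace F).schwartzBruhat,
      (finite p : LocalPlace F).fourierWith μ φ ∈ (finite p : LocalPlace F).schwartzBruhat ∧
      ∀ x, (finite p : LocalPlace F).fourierWith μ
        ((finite p : LocalPlace F).fourierWith μ φ) x = κ * φ (-x) := by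
  have : IsUltrametricDist F := isUltrametricDist_of_padic p
  obtain ⟨y₀, hy₀, h₀⟩ := exists_forall_basicChar_eq_one_iff (F := F) p
  set ν : LocalPlace F := finite p with hν
  have : ProperSpace F := ν.properSpace
  have hB : 0 < μ.real (closedBall (0 : F) 1) :=
    ENNReal.toReal_pos (measure_closedBall_pos _ _ one_pos).ne'
      (isCompact_closedBall _ _).measure_lt_top.ne
  -- The constant is the product of the volumes of two dual balls, in which |t| cancels.
  refine ⟨ν.modulus y₀ * μ.real (closedBall 0 1) ^ 2, mul_pos (ν.modulus_pos hy₀) (by positivity),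
    fun φ hφ => ?_⟩
  obtain ⟨δ, hδ, hinv⟩ := exists_pos_forall_norm_lt_eq hφ.1 hφ.2
  obtain ⟨t, ht0, ht⟩ := ν.exists_norm_lt hδ
  obtain ⟨T, hT0, hT⟩ := ν.exists_norm_le_of_isCompact hφ.2
  have hφc := hφ.1.continuous
  have hφi : Integrable φ μ := hφc.integrable_of_hasCompactSupport hφ.2
  have hsupp : ∀ y, y ∉ closedBall (0 : F) ‖y₀ / t‖ → ν.fourierWith μ φ y = 0 := by
    intro y hy
    have hy' : ¬ ‖-y‖ ≤ ‖y₀ / t‖ := by simpa using hy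
    rw [← ν.forall_basicChar_mul_eq_one_iff h₀ ht0] at hy'
    push Not at hy'
    obtain ⟨x, hx, hne⟩ := hy'
    have h1 : ν.fourierWith μ φ y = ν.basicChar (-y * x) * ν.fourierWith μ φ y := by
      unfold fourierWith
      rw [← integral_const_mul, ← integral_add_right_eq_self _ x]
      congr 1
      ext z
      rw [hinv z x (hx.trans_lt ht), mul_add, neg_add, basicChar_add]
      ring_nf
    have h2 : (1 - ν.basicChar (-y * x)) * ν.fourierWith μ φ y = 0 := by
      rw [sub_mul, one_mul, ← h1, sub_self]
    exact (mul_eq_zero.1 h2).resolve_left (sub_ne_zero.2 hne.symm)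
  have hmem : ν.fourierWith μ φ ∈ ν.schwartzBruhat := by
    refine ⟨?_, HasCompactSupport.intro (isCompact_closedBall 0 ‖y₀ / t‖) hsupp⟩
    rw [IsLocallyConstant.iff_eventually_eq]
    intro y
    have hpos : 0 < ‖y₀ / T‖ := norm_pos_iff.2 (div_ne_zero hy₀ hT0)
    filter_upwards [ball_mem_nhds y hpos] with z hz
    unfold fourierWith
    congr 1
    ext x
    by_cases hx : x ∈ tsupport φ
    · have h1 : ν.basicChar ((y - z) * x) = 1 := by
        refine (ν.forall_basicChar_mul_eq_one_iff h₀ hT0 (y - z)).2 ?_ x (hT x hx)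
        rw [norm_sub_rev]
        exact (by simpa [dist_eq_norm] using hz : ‖z - y‖ < ‖y₀ / T‖).le
      rw [show -(z * x) = (y - z) * x + -(y * x) by ring, basicChar_add, h1, one_mul]
    · rw [image_eq_zero_of_notMem_tsupport hx, zero_mul, zero_mul]
  refine ⟨hmem, fun x => ?_⟩
  have hs0 : y₀ / t ≠ 0 := div_ne_zero hy₀ ht0
  have hbm : MeasurableSet (closedBall (0 : F) ‖y₀ / t‖) := isClosed_closedBall.measurableSet
  calc ν.fourierWith μ (ν.fourierWith μ φ) x
      = ∫ y in closedBall 0 ‖y₀ / t‖, ν.fourierWith μ φ y * ν.basicChar (-(x * y)) ∂μ := by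
        rw [← integral_indicator hbm]
        conv_lhs => unfold fourierWith
        congr 1
        ext y
        by_cases hy : y ∈ closedBall (0 : F) ‖y₀ / t‖
        · rw [indicator_of_mem hy]; rfl
        · rw [indicator_of_notMem hy]
          have := hsupp y hy
          unfold fourierWith at this
          rw [this, zero_mul]
    _ = ∫ y in closedBall 0 ‖y₀ / t‖, ∫ z, φ z * ν.basicChar (-(x + z) * y) ∂μ ∂μ := by
        congr 1
        ext y
        rw [fourierWith, ← integral_mul_const]
        congr 1
        ext z
        rw [show -(x + z) * y = -(y * z) + -(x * y) by ring, basicChar_add, mul_assoc]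
    _ = ∫ z, ∫ y in closedBall 0 ‖y₀ / t‖, φ z * ν.basicChar (-(x + z) * y) ∂μ ∂μ := by
        apply integral_integral_swap
        have hfin : IsFiniteMeasure (μ.restrict (closedBall (0 : F) ‖y₀ / t‖)) :=
          ⟨by simpa using (isCompact_closedBall (0 : F) ‖y₀ / t‖).measure_lt_top⟩
        have h1 : Integrable (fun q : F × F => φ q.2)
            ((μ.restrict (closedBall (0 : F) ‖y₀ / t‖)).prod μ) := hφi.comp_snd _
        refine h1.mul_bdd (c := 1) ?_ (Eventually.of_forall fun q => by simp)
        have := ν.continuous_basicChar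
        exact (by fun_prop : Continuous fun q : F × F =>
          ν.basicChar (-(x + q.2) * q.1)).aestronglyMeasurable
    _ = ∫ z in closedBall (-x) ‖t‖, (μ.real (closedBall (0 : F) ‖y₀ / t‖) : ℂ) * φ (-x) ∂μ := by
        rw [← integral_indicator isClosed_closedBall.measurableSet]
        congr 1
        ext z
        rw [integral_const_mul, ν.setIntegral_basicChar μ h₀ hs0, div_div_cancel₀ hy₀, norm_neg]
        have hiff : z ∈ closedBall (-x) ‖t‖ ↔ ‖x + z‖ ≤ ‖t‖ := by
          rw [mem_closedBall, dist_eq_norm, sub_neg_eq_add, add_comm]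
        by_cases hz : ‖x + z‖ ≤ ‖t‖
        · rw [indicator_of_mem (hiff.2 hz), if_pos hz]
          have h2 : φ z = φ (-x) := by
            have := hinv (-x) (x + z) (hz.trans_lt ht)
            rwa [neg_add_cancel_left] at this
          rw [h2, mul_comm]
        · rw [indicator_of_notMem (mt hiff.1 hz), if_neg hz, mul_zero]
    _ = _ := by
        rw [setIntegral_const, ν.measure_closedBall_norm μ ht0, ν.measure_closedBall_norm μ hs0,
          div_eq_mul_inv, modulus_mul, modulus_inv]
        have : (ν.modulus t : ℂ) ≠ 0 := by exact_mod_cast (ν.modulus_pos ht0).ne'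
        rw [Complex.real_smul]
        push_cast
        field_simp

/-! ### The self-dual Haar measure -/

theorem exists_fourierWith_fourierWith (ν : LocalPlace F) (μ : Measure F) [μ.IsAddHaarMeasure] :
    ∃ κ : ℝ, 0 < κ ∧ ∀ φ ∈ ν.schwartzBruhat, ν.fourierWith μ φ ∈ ν.schwartzBruhat ∧
      ∀ x, ν.fourierWith μ (ν.fourierWith μ φ) x = κ * φ (-x) := by
  cases ν with
  | archimedean => exact exists_fourierWith_archimedean μ
  | finite p => exact exists_fourierWith_finite μ p

omit [BorelSpace F] [μ.IsAddHaarMeasure] in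
theorem fourierWith_smul_measure (c : ℝ≥0) (φ : F → ℂ) :
    ν.fourierWith (c • μ) φ = fun y => (c : ℂ) * ν.fourierWith μ φ y := by
  ext y
  unfold fourierWith
  rw [integral_smul_nnreal_measure]
  simp [NNReal.smul_def]

omit [BorelSpace F] [μ.IsAddHaarMeasure] in
theorem fourierWith_const_mul (c : ℂ) (φ : F → ℂ) :
    ν.fourierWith μ (fun x => c * φ x) = fun y => c * ν.fourierWith μ φ y := by
  ext y
  unfold fourierWith
  simp_rw [mul_assoc]
  rw [integral_const_mul]

/-- Scaling the measure by c scales the double transform by c², so c is forced to be the inverse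
square root of the inversion constant; one bump tested at 0 gives uniqueness. -/
theorem existsUnique_isSelfDualHaar : ∃! μ : Measure F, ν.IsSelfDualHaar μ := by
  have : ProperSpace F := ν.properSpace
  obtain ⟨κ, hκ, h⟩ := ν.exists_fourierWith_fourierWith (Measure.addHaar (G := F))
  have key : ∀ (c : ℝ≥0), ∀ φ ∈ ν.schwartzBruhat, ∀ x,
      ν.fourierWith (c • Measure.addHaar) (ν.fourierWith (c • Measure.addHaar) φ) x =
        ((c ^ 2 * κ : ℝ) : ℂ) * φ (-x) := by
    intro c φ hφ x
    simp only [fourierWith_smul_measure, fourierWith_const_mul, (h φ hφ).2]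
    push_cast
    ring
  let c₀ : ℝ≥0 := ⟨(Real.sqrt κ)⁻¹, by positivity⟩
  have hc₀ : (c₀ : ℝ) ^ 2 * κ = 1 := by
    show (Real.sqrt κ)⁻¹ ^ 2 * κ = 1
    rw [inv_pow, Real.sq_sqrt hκ.le, inv_mul_cancel₀ hκ.ne']
  have hc₀pos : (0 : ℝ) < c₀ := by show 0 < (Real.sqrt κ)⁻¹; positivity
  refine ⟨c₀ • Measure.addHaar, ⟨?_, fun φ hφ x => ?_⟩, ?_⟩
  · have h1 : ((c₀ : ℝ≥0∞) • (Measure.addHaar : Measure F)).IsAddHaarMeasure :=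
      Measure.IsAddHaarMeasure.smul _ (by exact_mod_cast hc₀pos.ne') ENNReal.coe_ne_top
    exact h1
  · rw [key c₀ φ hφ x, hc₀]
    simp
  · rintro μ ⟨hμ, hμ'⟩
    rw [Measure.isAddLeftInvariant_eq_smul μ Measure.addHaar] at hμ' ⊢
    set c := Measure.addHaarScalarFactor μ Measure.addHaar
    congr 1
    obtain ⟨ρ, hρ, -, hρ1, -⟩ := ν.exists_bump (0 : F) one_pos
    have h1 := hμ' _ hρ 0
    rw [key c _ hρ 0, neg_zero, hρ1 0 (by simp)] at h1
    have h2 : (c : ℝ) ^ 2 * κ = 1 := by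
      have : (((c ^ 2 * κ : ℝ) : ℂ)) = ((1 : ℝ) : ℂ) := by simpa using h1
      exact_mod_cast this
    have h3 : (c : ℝ) ^ 2 = c₀ ^ 2 := mul_right_cancel₀ hκ.ne' (h2.trans hc₀.symm)
    exact NNReal.coe_injective ((pow_left_inj₀ c.coe_nonneg c₀.coe_nonneg two_ne_zero).1 h3)

theorem isSelfDualHaar_haar : ν.IsSelfDualHaar ν.haar :=
  Classical.epsilon_spec ν.existsUnique_isSelfDualHaar.exists

theorem isAddHaarMeasure_haar : ν.haar.IsAddHaarMeasure := ν.isSelfDualHaar_haar.1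

end LocalPlace

/-- Domination of |x|^{-s}, uniform for Re s in a closed interval, by its two end values. -/
theorem Real.rpow_neg_le_add {r σ₁ σ₂ τ : ℝ} (hr : 0 < r) (h1 : σ₁ ≤ τ) (h2 : τ ≤ σ₂) :
    r ^ (-τ) ≤ r ^ (-σ₁) + r ^ (-σ₂) := by
  rcases le_total 1 r with h | h
  · exact (Real.rpow_le_rpow_of_exponent_le h (neg_le_neg h1)).trans
      (le_add_of_nonneg_right (Real.rpow_nonneg hr.le _))
  · exact (Real.rpow_le_rpow_of_exponent_ge hr h (neg_le_neg h2)).trans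
      (le_add_of_nonneg_left (Real.rpow_nonneg hr.le _))

namespace LocalPlace

variable {F : Type*} [NormedField F] (ν : LocalPlace F)

/-! ### Homogeneous functions -/

section Homogeneous

variable (χ : Fˣ →ₜ* Circle) (s t : ℂ)

@[simp] theorem homogeneous_zero : ν.homogeneous χ s 0 = 0 := by simp [homogeneous]

theorem homogeneous_of_ne {x : F} (hx : x ≠ 0) :
    ν.homogeneous χ s x = (χ (Units.mk0 x hx) : ℂ) * (ν.modulus x : ℂ) ^ s := by
  simp [homogeneous, hx]

theorem norm_homogeneous {x : F} (hx : x ≠ 0) :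
    ‖ν.homogeneous χ s x‖ = ν.modulus x ^ s.re := by
  rw [homogeneous_of_ne _ _ _ hx, norm_mul, Circle.norm_coe, one_mul,
    Complex.norm_cpow_eq_rpow_re_of_pos (ν.modulus_pos hx)]

theorem homogeneous_mul (x y : F) :
    ν.homogeneous χ s (x * y) = ν.homogeneous χ s x * ν.homogeneous χ s y := by
  rcases eq_or_ne x 0 with rfl | hx
  · simp
  rcases eq_or_ne y 0 with rfl | hy
  · simp
  rw [homogeneous_of_ne _ _ _ hx, homogeneous_of_ne _ _ _ hy, homogeneous_of_ne _ _ _ (mul_ne_zero hx hy),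
    modulus_mul, Complex.ofReal_mul, Complex.mul_cpow_ofReal_nonneg (ν.modulus_nonneg x)
    (ν.modulus_nonneg y), show Units.mk0 (x * y) (mul_ne_zero hx hy) = Units.mk0 x hx * Units.mk0 y hy
    from Units.ext rfl, map_mul, Circle.coe_mul]
  ring

theorem homogeneous_mul_homogeneous_inv {x : F} (hx : x ≠ 0) :
    ν.homogeneous χ s x * ν.homogeneous χ⁻¹ t x = (ν.modulus x : ℂ) ^ (s + t) := by
  have h0 : (ν.modulus x : ℂ) ≠ 0 := by exact_mod_cast (ν.modulus_pos hx).ne'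
  have h1 : (χ⁻¹ (Units.mk0 x hx) : ℂ) = (χ (Units.mk0 x hx) : ℂ)⁻¹ := by
    rw [← Circle.coe_inv]; rfl
  rw [homogeneous_of_ne _ _ _ hx, homogeneous_of_ne _ _ _ hx, h1, Complex.cpow_add _ _ h0]
  have h2 : (χ (Units.mk0 x hx) : ℂ) ≠ 0 := Circle.coe_ne_zero _
  field_simp

theorem continuousOn_homogeneous : ContinuousOn (ν.homogeneous χ s) {0}ᶜ := by
  rw [continuousOn_iff_continuous_domRestrict]
  have h1 : ({0}ᶜ : Set F).domRestrict (ν.homogeneous χ s) = fun x : ({0}ᶜ : Set F) =>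
      (χ (Units.mk0 (x : F) x.2) : ℂ) * (ν.modulus x : ℂ) ^ s := by
    ext x
    exact homogeneous_of_ne _ _ _ x.2
  rw [h1]
  have h2 : Continuous fun x : ({0}ᶜ : Set F) => Units.mk0 (x : F) x.2 :=
    Units.isEmbedding_val₀.continuous_iff.2 continuous_subtype_val
  refine (continuous_subtype_val.comp (χ.continuous_toFun.comp h2)).mul ?_
  refine Continuous.cpow ?_ continuous_const fun x => ?_
  · exact Complex.continuous_ofReal.comp (ν.continuous_modulus.comp continuous_subtype_val)
  · exact Or.inl (by simpa using ν.modulus_pos x.2)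

theorem measurable_homogeneous [MeasurableSpace F] [BorelSpace F] :
    Measurable (ν.homogeneous χ s) :=
  measurable_of_continuousOn_compl_singleton 0 (ν.continuousOn_homogeneous χ s)

end Homogeneous

variable [MeasurableSpace F] [BorelSpace F]

/-! ### Mellin transforms -/

/-- `∫ |x|^{-σ} g(x) dx` converges absolutely for `a < σ < b`. -/
def IsMellin (a b : ℝ) (g : F → ℂ) : Prop :=
  Measurable g ∧ ∀ σ, a < σ → σ < b →
    Integrable (fun x => ((ν.modulus x ^ (-σ) : ℝ) : ℂ) * g x) ν.haar

/-- The Mellin transform `∫ χ(x) |x|^{-s} g(x) dx`. -/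
noncomputable def mellinTransform (χ : Fˣ →ₜ* Circle) (g : F → ℂ) (s : ℂ) : ℂ :=
  ∫ x, ν.homogeneous χ (-s) x * g x ∂ν.haar

variable {ν} {a b : ℝ} {g h : F → ℂ}

omit [BorelSpace F] in
theorem IsMellin.add (hg : ν.IsMellin a b g) (hh : ν.IsMellin a b h) :
    ν.IsMellin a b (fun x => g x + h x) :=
  ⟨hg.1.add hh.1, fun σ h1 h2 => by
    simp only [mul_add]
    exact (hg.2 σ h1 h2).add (hh.2 σ h1 h2)⟩

omit [BorelSpace F] in
theorem IsMellin.sub (hg : ν.IsMellin a b g) (hh : ν.IsMellin a b h) :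
    ν.IsMellin a b (fun x => g x - h x) :=
  ⟨hg.1.sub hh.1, fun σ h1 h2 => by
    simp only [mul_sub]
    exact (hg.2 σ h1 h2).sub (hh.2 σ h1 h2)⟩

theorem IsMellin.measurable_opA (hg : Measurable g) : Measurable (ν.opA g) :=
  (Complex.measurable_ofReal.comp
    (Real.measurable_log.comp ν.continuous_modulus.measurable)).mul hg

omit [BorelSpace F] in
theorem IsMellin.integrable_norm (hg : ν.IsMellin a b g) {σ : ℝ} (h1 : a < σ) (h2 : σ < b) :
    Integrable (fun x => ν.modulus x ^ (-σ) * ‖g x‖) ν.haar := by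
  refine (hg.2 σ h1 h2).norm.congr (Eventually.of_forall fun x => ?_)
  simp [abs_of_nonneg (Real.rpow_nonneg (ν.modulus_nonneg x) _)]

/-- The strip is open, so the logarithm is absorbed by moving σ slightly to both sides. -/
theorem IsMellin.opA (hg : ν.IsMellin a b g) : ν.IsMellin a b (ν.opA g) := by
  refine ⟨IsMellin.measurable_opA hg.1, fun σ h1 h2 => ?_⟩
  obtain ⟨ε, hε, hε1, hε2⟩ : ∃ ε > 0, a < σ - ε ∧ σ + ε < b := by
    refine ⟨min (σ - a) (b - σ) / 2, ?_, ?_, ?_⟩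
    · have : 0 < min (σ - a) (b - σ) := lt_min (by linarith) (by linarith)
      linarith
    · have := min_le_left (σ - a) (b - σ); linarith
    · have := min_le_right (σ - a) (b - σ); linarith
  refine Integrable.mono' (((hg.integrable_norm (σ := σ - ε) (by linarith) (by linarith)).add
    (hg.integrable_norm (σ := σ + ε) (by linarith) (by linarith))).const_mul ε⁻¹) ?_ ?_
  · exact ((Complex.measurable_ofReal.comp
      (ν.continuous_modulus.measurable.pow_const _)).mul
      (IsMellin.measurable_opA hg.1)).aestronglyMeasurable
  · refine Eventually.of_forall fun x => ?_
    rcases eq_or_ne x 0 with rfl | hx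
    · have : ‖((ν.modulus 0 ^ (-σ) : ℝ) : ℂ) * ν.opA g 0‖ = 0 := by simp [LocalPlace.opA]
      rw [this]
      have := Real.rpow_nonneg (ν.modulus_nonneg 0) (-(σ - ε))
      have := Real.rpow_nonneg (ν.modulus_nonneg 0) (-(σ + ε))
      simp only [Pi.add_apply]
      positivity
    · have hp := ν.modulus_pos hx
      have hl := Real.abs_log_le_rpow_add_rpow hp.le hε
      simp only [LocalPlace.opA, norm_mul, Complex.norm_real, Pi.add_apply, Real.norm_eq_abs,
        abs_of_nonneg (Real.rpow_nonneg hp.le _)]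
      calc ν.modulus x ^ (-σ) * (|Real.log (ν.modulus x)| * ‖g x‖)
          ≤ ν.modulus x ^ (-σ) * ((ν.modulus x ^ ε + ν.modulus x ^ (-ε)) / ε * ‖g x‖) := by gcongr
        _ = _ := by
          rw [show -(σ - ε) = -σ + ε by ring, show -(σ + ε) = -σ + -ε by ring,
            Real.rpow_add hp, Real.rpow_add hp]
          ring

theorem IsMellin.integrable_homogeneous_mul (hg : ν.IsMellin a b g) (χ : Fˣ →ₜ* Circle) {s : ℂ}
    (h1 : a < s.re) (h2 : s.re < b) :
    Integrable (fun x => ν.homogeneous χ (-s) x * g x) ν.haar := by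
  refine Integrable.mono' (hg.integrable_norm h1 h2)
    ((ν.measurable_homogeneous χ _).mul hg.1).aestronglyMeasurable (Eventually.of_forall fun x => ?_)
  rw [norm_mul]
  rcases eq_or_ne x 0 with rfl | hx
  · simp only [homogeneous_zero, norm_zero, zero_mul]
    have := Real.rpow_nonneg (ν.modulus_nonneg 0) (-s.re)
    positivity
  · rw [norm_homogeneous _ _ _ hx, Complex.neg_re]

omit [BorelSpace F] in
theorem mellinTransform_add (χ : Fˣ →ₜ* Circle) {s : ℂ}
    (hg : Integrable (fun x => ν.homogeneous χ (-s) x * g x) ν.haar)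
    (hh : Integrable (fun x => ν.homogeneous χ (-s) x * h x) ν.haar) :
    ν.mellinTransform χ (fun x => g x + h x) s =
      ν.mellinTransform χ g s + ν.mellinTransform χ h s := by
  simp only [mellinTransform, mul_add]
  exact integral_add hg hh

omit [BorelSpace F] in
theorem mellinTransform_sub (χ : Fˣ →ₜ* Circle) {s : ℂ}
    (hg : Integrable (fun x => ν.homogeneous χ (-s) x * g x) ν.haar)
    (hh : Integrable (fun x => ν.homogeneous χ (-s) x * h x) ν.haar) :
    ν.mellinTransform χ (fun x => g x - h x) s =
      ν.mellinTransform χ g s - ν.mellinTransform χ h s := by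
  simp only [mellinTransform, mul_sub]
  exact integral_sub hg hh

omit [MeasurableSpace F] [BorelSpace F] in
theorem hasDerivAt_homogeneous (χ : Fˣ →ₜ* Circle) (s : ℂ) (x : F) :
    HasDerivAt (fun s => ν.homogeneous χ (-s) x)
      (-(ν.homogeneous χ (-s) x * (Real.log (ν.modulus x) : ℂ))) s := by
  rcases eq_or_ne x 0 with rfl | hx
  · simpa using hasDerivAt_const s (0 : ℂ)
  · simp only [homogeneous_of_ne _ _ _ hx]
    have h0 : (ν.modulus x : ℂ) ≠ 0 := by exact_mod_cast (ν.modulus_pos hx).ne'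
    have h := ((hasDerivAt_neg s).const_cpow (c := (ν.modulus x : ℂ)) (Or.inl h0)).const_mul
      (χ (Units.mk0 x hx) : ℂ)
    refine h.congr_deriv ?_
    rw [← Complex.ofReal_log (ν.modulus_nonneg x)]
    ring

/-- A is -∂/∂s on Mellin transforms: differentiation under the integral, dominated by the two
exponents Re s ± ε. -/
theorem IsMellin.hasDerivAt (hg : ν.IsMellin a b g) (χ : Fˣ →ₜ* Circle) {s : ℂ}
    (h1 : a < s.re) (h2 : s.re < b) :
    HasDerivAt (ν.mellinTransform χ g) (-ν.mellinTransform χ (ν.opA g) s) s := by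
  obtain ⟨ε, hε, hε1, hε2⟩ : ∃ ε > 0, a < s.re - ε ∧ s.re + ε < b := by
    refine ⟨min (s.re - a) (b - s.re) / 2, ?_, ?_, ?_⟩
    · have : 0 < min (s.re - a) (b - s.re) := lt_min (by linarith) (by linarith)
      linarith
    · have := min_le_left (s.re - a) (b - s.re); linarith
    · have := min_le_right (s.re - a) (b - s.re); linarith
  have hA := hg.opA
  have h := hasDerivAt_integral_of_dominated_loc_of_deriv_le (μ := ν.haar) (𝕜 := ℂ)
    (F := fun s x => ν.homogeneous χ (-s) x * g x)
    (F' := fun s x => -(ν.homogeneous χ (-s) x * ν.opA g x)) (x₀ := s)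
    (bound := fun x => ν.modulus x ^ (-(s.re - ε)) * ‖ν.opA g x‖ +
      ν.modulus x ^ (-(s.re + ε)) * ‖ν.opA g x‖)
    (ball_mem_nhds s hε)
    (Eventually.of_forall fun s => ((ν.measurable_homogeneous χ _).mul hg.1).aestronglyMeasurable)
    (hg.integrable_homogeneous_mul χ h1 h2)
    ((ν.measurable_homogeneous χ _).mul hA.1).neg.aestronglyMeasurable
    (Eventually.of_forall fun x s' hs' => ?_)
    ((hA.integrable_norm (by linarith) (by linarith)).add
      (hA.integrable_norm (by linarith) (by linarith)))
    (Eventually.of_forall fun x s' hs' => ?_)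
  · refine h.2.congr_deriv ?_
    rw [mellinTransform, integral_neg]
  · have hre : |s'.re - s.re| < ε := by
      rw [← Complex.sub_re]
      exact (Complex.abs_re_le_norm _).trans_lt (by simpa [dist_eq_norm] using hs')
    rw [abs_lt] at hre
    rw [norm_neg, norm_mul, ← add_mul]
    gcongr
    rcases eq_or_ne x 0 with rfl | hx
    · rw [homogeneous_zero, norm_zero]
      exact add_nonneg (Real.rpow_nonneg (ν.modulus_nonneg 0) _)
        (Real.rpow_nonneg (ν.modulus_nonneg 0) _)
    · rw [norm_homogeneous _ _ _ hx, Complex.neg_re]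
      exact Real.rpow_neg_le_add (ν.modulus_pos hx) (by linarith) (by linarith)
  · refine ((hasDerivAt_homogeneous χ s' x).mul_const (g x)).congr_deriv ?_
    simp only [LocalPlace.opA]
    ring

/-- The substitution `y = ux` in a product of Mellin transforms. -/
theorem IsMellin.mellinTransform_mul_mellinTransform [ProperSpace F] [ν.haar.IsAddHaarMeasure]
    {f k : F → ℂ} (hf : ν.IsMellin 0 1 f) (hk : ν.IsMellin 0 1 k) (χ : Fˣ →ₜ* Circle) {s : ℂ}
    (h0 : 0 < s.re) (h1 : s.re < 1) :
    ν.mellinTransform χ f (1 - s) * ν.mellinTransform χ⁻¹ k s =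
      ∫ u, ν.homogeneous χ (s - 1) u * ∫ x, k x * f (u * x) ∂ν.haar ∂ν.haar := by
  have hs1 : -(1 - s) = s - 1 := by ring
  have hfi := hf.integrable_homogeneous_mul χ (s := 1 - s) (by simpa using h1) (by simpa using h0)
  have hki := hk.integrable_homogeneous_mul χ⁻¹ h0 h1
  rw [hs1] at hfi
  -- The characters cancel and the powers at x combine to |x|⁻¹; the compensating |x| is the
  -- Jacobian of u ↦ xu.
  have key : ∀ x : F, x ≠ 0 → ∀ u, ν.homogeneous χ (s - 1) u * (k x * f (u * x)) =
      (ν.modulus x : ℂ) * (ν.homogeneous χ⁻¹ (-s) x * k x) *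
        (ν.homogeneous χ (s - 1) (x * u) * f (x * u)) := by
    intro x hx u
    have h2 := ν.homogeneous_mul_homogeneous_inv χ (s - 1) (-s) hx
    rw [show s - 1 + -s = -1 by ring, Complex.cpow_neg_one] at h2
    have h3 : (ν.modulus x : ℂ) ≠ 0 := by exact_mod_cast (ν.modulus_pos hx).ne'
    have h4 : (ν.modulus x : ℂ) * (ν.homogeneous χ (s - 1) x * ν.homogeneous χ⁻¹ (-s) x) = 1 := by
      rw [h2, mul_inv_cancel₀ h3]
    rw [homogeneous_mul, mul_comm u x]
    linear_combination (-(ν.homogeneous χ (s - 1) u * k x * f (x * u))) * h4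
  have hint : ∀ x : F, x ≠ 0 →
      Integrable (fun u => ν.homogeneous χ (s - 1) u * (k x * f (u * x))) ν.haar := by
    intro x hx
    simp_rw [key x hx]
    exact ((ν.integrable_comp_mul_left ν.haar hx).2 hfi).const_mul _
  have hnorm : ∀ x : F, x ≠ 0 →
      ∫ u, ‖ν.homogeneous χ (s - 1) u * (k x * f (u * x))‖ ∂ν.haar =
        ‖ν.homogeneous χ⁻¹ (-s) x * k x‖ * ∫ y, ‖ν.homogeneous χ (s - 1) y * f y‖ ∂ν.haar := by
    intro x hx
    have hp := ν.modulus_pos hx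
    simp_rw [key x hx, norm_mul _ (ν.homogeneous χ (s - 1) (x * _) * f (x * _))]
    rw [integral_const_mul, ν.integral_comp_mul_left_smul ν.haar hx
      fun y => ‖ν.homogeneous χ (s - 1) y * f y‖, norm_mul, Complex.norm_real,
      Real.norm_of_nonneg hp.le, smul_eq_mul]
    field_simp
  have hmeas : Measurable fun q : F × F => ν.homogeneous χ (s - 1) q.2 * (k q.1 * f (q.2 * q.1)) := by
    have := ν.measurable_homogeneous χ (s - 1)
    have hk1 := hk.1
    have hf1 := hf.1
    fun_prop
  have hprod : Integrable (fun q : F × F => ν.homogeneous χ (s - 1) q.2 * (k q.1 * f (q.2 * q.1)))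
      (ν.haar.prod ν.haar) := by
    rw [integrable_prod_iff hmeas.aestronglyMeasurable]
    constructor
    · filter_upwards [ν.ae_ne_zero ν.haar] with x hx using hint x hx
    · refine (hki.norm.mul_const (∫ y, ‖ν.homogeneous χ (s - 1) y * f y‖ ∂ν.haar)).congr ?_
      filter_upwards [ν.ae_ne_zero ν.haar] with x hx using (hnorm x hx).symm
  calc ν.mellinTransform χ f (1 - s) * ν.mellinTransform χ⁻¹ k s
      = ∫ x, ∫ u, ν.homogeneous χ (s - 1) u * (k x * f (u * x)) ∂ν.haar ∂ν.haar := by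
        rw [mul_comm, mellinTransform, mellinTransform, ← integral_mul_const, hs1]
        refine integral_congr_ae ?_
        filter_upwards [ν.ae_ne_zero ν.haar] with x hx
        simp_rw [key x hx]
        have h3 : (ν.modulus x : ℂ) ≠ 0 := by exact_mod_cast (ν.modulus_pos hx).ne'
        rw [integral_const_mul, ν.integral_comp_mul_left ν.haar hx
          fun y => ν.homogeneous χ (s - 1) y * f y]
        field_simp
    _ = ∫ u, ∫ x, ν.homogeneous χ (s - 1) u * (k x * f (u * x)) ∂ν.haar ∂ν.haar :=
        integral_integral_swap hprod
    _ = _ := by simp_rw [integral_const_mul]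

/-! ### Mellin transforms of Schwartz-Bruhat functions -/

theorem isMellin_of_bounds [ProperSpace F] [ν.haar.IsAddHaarMeasure] (hg : Measurable g) {a b C : ℝ}
    (h1 : ∀ x, x ≠ 0 → ‖x‖ ≤ 1 → ‖g x‖ ≤ C * ν.modulus x ^ (b - 1))
    (h2 : ∀ x, 1 ≤ ‖x‖ → ‖g x‖ ≤ C * ν.modulus x ^ (a - 1)) : ν.IsMellin a b g := by
  refine ⟨hg, fun σ ha hb => ?_⟩
  refine ν.integrable_of_norm_le_rpow ν.haar ?_ (a := b - 1 - σ) (b := a - 1 - σ) (C := C)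
    (by linarith) (by linarith) (fun x hx hx1 => ?_) (fun x hx1 => ?_)
  · exact ((Complex.measurable_ofReal.comp
      (ν.continuous_modulus.measurable.pow_const _)).mul hg).aestronglyMeasurable
  · have hp := ν.modulus_pos hx
    rw [norm_mul, Complex.norm_real, Real.norm_of_nonneg (Real.rpow_nonneg hp.le _),
      sub_eq_add_neg _ σ, Real.rpow_add hp]
    calc _ ≤ ν.modulus x ^ (-σ) * (C * ν.modulus x ^ (b - 1)) := by
          gcongr
          exact h1 x hx hx1
      _ = _ := by ring
  · have hx : x ≠ 0 := by rintro rfl; norm_num at hx1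
    have hp := ν.modulus_pos hx
    rw [norm_mul, Complex.norm_real, Real.norm_of_nonneg (Real.rpow_nonneg hp.le _),
      sub_eq_add_neg _ σ, Real.rpow_add hp]
    calc _ ≤ ν.modulus x ^ (-σ) * (C * ν.modulus x ^ (a - 1)) := by
          gcongr
          exact h2 x hx1
      _ = _ := by ring

variable {φ : F → ℂ}

omit [MeasurableSpace F] [BorelSpace F] in
theorem norm_schwartzBruhat_le_rpow (hφ : φ ∈ ν.schwartzBruhat) (a : ℝ) :
    ∃ C, 0 ≤ C ∧ ∀ x, 1 ≤ ‖x‖ → ‖φ x‖ ≤ C * ν.modulus x ^ a := by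
  obtain ⟨n, hn⟩ := exists_nat_ge (-a)
  obtain ⟨C, hC0, hC⟩ := schwartzBruhat_decay hφ (ν.degree * n)
  refine ⟨C, hC0, fun x hx => ?_⟩
  have hm : 1 ≤ ν.modulus x := ν.one_le_modulus hx
  have hp : 0 < ν.modulus x := by linarith
  have h1 : ν.modulus x ^ (-a) ≤ (1 + ‖x‖) ^ (ν.degree * n) := by
    calc ν.modulus x ^ (-a) ≤ ν.modulus x ^ (n : ℝ) := Real.rpow_le_rpow_of_exponent_le hm hn
      _ = ‖x‖ ^ (ν.degree * n) := by rw [Real.rpow_natCast, modulus, pow_mul]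
      _ ≤ _ := by gcongr; linarith
  have h2 : ν.modulus x ^ (-a) * ‖φ x‖ ≤ C := le_trans (by gcongr) (hC x)
  rw [Real.rpow_neg hp.le, inv_mul_le_iff₀ (Real.rpow_pos_of_pos hp _)] at h2
  linarith

variable [ProperSpace F] [ν.haar.IsAddHaarMeasure]

theorem isMellin_schwartzBruhat (hφ : φ ∈ ν.schwartzBruhat) (a : ℝ) : ν.IsMellin a 1 φ := by
  obtain ⟨C₁, h1, hC₁⟩ := schwartzBruhat_bounded hφ
  obtain ⟨C₂, h2, hC₂⟩ := norm_schwartzBruhat_le_rpow hφ (a - 1)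
  refine isMellin_of_bounds (schwartzBruhat_continuous hφ).measurable (C := max C₁ C₂)
    (fun x hx hx1 => ?_) fun x hx1 => ?_
  · rw [sub_self, Real.rpow_zero, mul_one]
    exact (hC₁ x).trans (le_max_left _ _)
  · refine (hC₂ x hx1).trans ?_
    have := Real.rpow_nonneg (ν.modulus_nonneg x) (a - 1)
    gcongr
    exact le_max_right _ _

/-- If `φ(0) = 0` then the Mellin transform converges beyond `Re s = 1`. -/
theorem isMellin_schwartzBruhat_of_apply_zero (hφ : φ ∈ ν.schwartzBruhat) (h0 : φ 0 = 0) (a : ℝ) :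
    ν.IsMellin a (1 + (ν.degree : ℝ)⁻¹) φ := by
  -- The Lipschitz bound at 0 gives |φ(x)| ≤ C‖x‖ = C|x|^{1/d}, with d the degree; this is the gain
  -- past Re s = 1.
  obtain ⟨C₁, h1, hC₁⟩ := schwartzBruhat_lipschitz hφ 0
  obtain ⟨C₂, h2, hC₂⟩ := norm_schwartzBruhat_le_rpow hφ (a - 1)
  refine isMellin_of_bounds (schwartzBruhat_continuous hφ).measurable (C := max C₁ C₂)
    (fun x hx hx1 => ?_) fun x hx1 => ?_
  · have h3 := hC₁ 0 (-x) (by simpa using hx1)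
    simp only [norm_zero, add_zero, one_pow, one_mul, sub_neg_eq_add, zero_add, h0, sub_zero,
      norm_neg] at h3
    rw [add_sub_cancel_left, modulus, Real.pow_rpow_inv_natCast (norm_nonneg x) ν.degree_pos.ne']
    exact h3.trans (by gcongr; exact le_max_left _ _)
  · refine (hC₂ x hx1).trans ?_
    have := Real.rpow_nonneg (ν.modulus_nonneg x) (a - 1)
    gcongr
    exact le_max_right _ _

omit [BorelSpace F] [ProperSpace F] [ν.haar.IsAddHaarMeasure] in
theorem IsMellin.integrable {a b : ℝ} (hg : ν.IsMellin a b g) (ha : a < 0) (hb : 0 < b) :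
    Integrable g ν.haar := by
  simpa using hg.2 0 ha hb

/-- The product of a function with a Mellin transform and a bounded function with a
singularity of type `|x|^{-σ}`. -/
theorem IsMellin.integrable_mul_schwartzBruhat (hg : ν.IsMellin 0 1 g) (hφ : φ ∈ ν.schwartzBruhat) :
    Integrable (fun x => g x * φ x) ν.haar := by
  obtain ⟨C₁, h1, hC₁⟩ := schwartzBruhat_bounded hφ
  obtain ⟨C₂, h2, hC₂⟩ := norm_schwartzBruhat_le_rpow hφ (-(1 / 2 : ℝ))
  refine Integrable.mono' ((hg.integrable_norm (σ := 1 / 2) (by norm_num) (by norm_num)).const_mul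
    (max C₁ C₂)) (hg.1.mul (schwartzBruhat_continuous hφ).measurable).aestronglyMeasurable ?_
  filter_upwards [ν.ae_ne_zero ν.haar] with x hx
  have hp := ν.modulus_pos hx
  have : ‖φ x‖ ≤ max C₁ C₂ * ν.modulus x ^ (-(1 / 2 : ℝ)) := by
    rcases le_total ‖x‖ 1 with hx1 | hx1
    · calc ‖φ x‖ ≤ max C₁ C₂ * 1 := by rw [mul_one]; exact (hC₁ x).trans (le_max_left _ _)
        _ ≤ _ := by
          gcongr
          exact Real.one_le_rpow_of_pos_of_le_one_of_nonpos hp (ν.modulus_le_one hx1) (by norm_num)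
    · exact (hC₂ x hx1).trans (by gcongr; exact le_max_right _ _)
  rw [norm_mul]
  calc ‖g x‖ * ‖φ x‖ ≤ ‖g x‖ * (max C₁ C₂ * ν.modulus x ^ (-(1 / 2 : ℝ))) := by gcongr
    _ = _ := by ring

/-- Near any `s`, some Schwartz-Bruhat function supported close to `1` has a nonvanishing Mellin
transform. -/
theorem exists_mellinTransform_ne_zero (χ : Fˣ →ₜ* Circle) (s : ℂ) :
    ∃ φ ∈ ν.schwartzBruhat, φ 0 = 0 ∧ ν.mellinTransform χ φ s ≠ 0 := by
  have hcont : ContinuousAt (ν.homogeneous χ (-s)) 1 :=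
    (ν.continuousOn_homogeneous χ (-s)).continuousAt (isOpen_compl_singleton.mem_nhds (by simp))
  have h1 : ν.homogeneous χ (-s) 1 = 1 := by
    have : Units.mk0 (1 : F) one_ne_zero = 1 := Units.ext rfl
    rw [homogeneous_of_ne _ _ _ one_ne_zero, this]
    simp
  obtain ⟨r, hr, hball⟩ := Metric.continuousAt_iff.1 hcont (1 / 2) (by norm_num)
  rw [h1] at hball
  -- Then the support, within radius 2r' of 1, avoids 0 and stays where the homogeneous factor is
  -- within 1/2 of its value 1, so the integrand has real part at least ρ/2.
  set r' := min (r / 3) (1 / 3)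
  have hr' : 0 < r' := by positivity
  obtain ⟨ρ, hρ, hρ01, hρ1, hρ0⟩ := ν.exists_bump 1 hr'
  have h0 : ρ 0 = 0 := by
    apply hρ0
    rw [mem_closedBall, dist_eq_norm, zero_sub, norm_neg, norm_one, not_le]
    have := min_le_right (r / 3) (1 / 3)
    linarith
  refine ⟨_, hρ, by simp [h0], fun hZ => ?_⟩
  have hM := isMellin_schwartzBruhat_of_apply_zero hρ (by simp [h0]) (min (-1) (s.re - 1))
  have hρi : Integrable ρ ν.haar := by
    have := (hM.integrable (by have := min_le_left (-1) (s.re - 1); linarith)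
      (by positivity)).re
    simpa using this
  have hre : ∀ x, ρ x * (1 / 2) ≤ (ν.homogeneous χ (-s) x * ρ x).re := by
    intro x
    rw [Complex.re_mul_ofReal, mul_comm (ρ x)]
    by_cases hx : x ∈ closedBall (1 : F) (2 * r')
    · have h2 := hball (x := x) (by
        have := min_le_left (r / 3) (1 / 3)
        exact (mem_closedBall.1 hx).trans_lt (by linarith))
      have h3 : |(ν.homogeneous χ (-s) x - 1).re| < 1 / 2 :=
        (Complex.abs_re_le_norm _).trans_lt (by rwa [dist_eq_norm] at h2)
      rw [abs_lt, Complex.sub_re, Complex.one_re] at h3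
      have := (hρ01 x).1
      gcongr
      linarith
    · simp [hρ0 x hx]
  have hi : Integrable (fun x => ν.homogeneous χ (-s) x * ρ x) ν.haar := by
    obtain ⟨C, hC⟩ := (isCompact_closedBall (1 : F) (2 * r')).exists_bound_of_continuousOn
      (f := ν.homogeneous χ (-s)) ((ν.continuousOn_homogeneous χ (-s)).mono fun x hx => by
        rintro rfl
        rw [mem_closedBall, dist_eq_norm, zero_sub, norm_neg, norm_one] at hx
        have := min_le_right (r / 3) (1 / 3)
        linarith)
    refine Integrable.mono' (hρi.const_mul C) ((ν.measurable_homogeneous χ _).mul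
      (schwartzBruhat_continuous hρ).measurable).aestronglyMeasurable
      (Eventually.of_forall fun x => ?_)
    rw [norm_mul, Complex.norm_real, Real.norm_of_nonneg (hρ01 x).1]
    by_cases hx : x ∈ closedBall (1 : F) (2 * r')
    · have := (hρ01 x).1
      gcongr
      exact hC x hx
    · simp [hρ0 x hx]
  have h4 : 0 < ∫ x, ρ x ∂ν.haar := by
    rw [integral_pos_iff_support_of_nonneg (fun x => (hρ01 x).1) hρi]
    refine lt_of_lt_of_le (measure_closedBall_pos ν.haar (1 : F) hr') (measure_mono fun x hx => ?_)
    simp [hρ1 x hx]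
  have h5 : ∫ x, ρ x * (1 / 2) ∂ν.haar ≤ ∫ x, (ν.homogeneous χ (-s) x * ρ x).re ∂ν.haar :=
    integral_mono (hρi.mul_const _) hi.re hre
  have h6 : ∫ x, (ν.homogeneous χ (-s) x * ρ x).re ∂ν.haar = (ν.mellinTransform χ (fun x => ρ x) s).re :=
    integral_re hi
  rw [h6, hZ, integral_mul_const, Complex.zero_re] at h5
  linarith

end LocalPlace

theorem isOpen_criticalStrip : IsOpen criticalStrip :=
  (isOpen_lt continuous_const Complex.continuous_re).inter
    (isOpen_lt Complex.continuous_re continuous_const)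

namespace LocalPlace

variable {F : Type*} [NormedField F] [MeasurableSpace F] {ν : LocalPlace F} {φ f g : F → ℂ}

/-! ### The Fourier transform -/

theorem fourierInv_eq (g : F → ℂ) (x : F) : ν.fourierInv g x = ν.fourier g (-x) := by
  simp [fourierInv, fourier, fourierWith]

theorem norm_fourier_le (g : F → ℂ) (x : F) : ‖ν.fourier g x‖ ≤ ∫ y, ‖g y‖ ∂ν.haar := by
  refine (norm_integral_le_integral_norm _).trans_eq ?_
  simp

variable [BorelSpace F]

theorem fourier_mem (hφ : φ ∈ ν.schwartzBruhat) : ν.fourier φ ∈ ν.schwartzBruhat := by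
  have := ν.isAddHaarMeasure_haar
  obtain ⟨κ, -, h⟩ := ν.exists_fourierWith_fourierWith ν.haar
  exact (h φ hφ).1

theorem fourier_fourier (hφ : φ ∈ ν.schwartzBruhat) (x : F) :
    ν.fourier (ν.fourier φ) x = φ (-x) :=
  ν.isSelfDualHaar_haar.2 φ hφ x

theorem fourierInv_fourier (hφ : φ ∈ ν.schwartzBruhat) : ν.fourierInv (ν.fourier φ) = φ := by
  ext x
  rw [fourierInv_eq, fourier_fourier hφ, neg_neg]

theorem fourierInv_mem (hφ : φ ∈ ν.schwartzBruhat) : ν.fourierInv φ ∈ ν.schwartzBruhat := by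
  have : ν.fourierInv φ = fun x => ν.fourier φ (-x) := funext (fourierInv_eq φ)
  rw [this]
  exact schwartzBruhat_comp_neg (fourier_mem hφ)

variable [ν.haar.IsAddHaarMeasure] [ProperSpace F]

theorem fourier_comp_neg (g : F → ℂ) (x : F) :
    ν.fourier (fun y => g (-y)) x = ν.fourier g (-x) := by
  simp only [fourier, fourierWith]
  rw [← integral_neg_eq_self]
  simp

theorem fourier_fourierInv (hφ : φ ∈ ν.schwartzBruhat) : ν.fourier (ν.fourierInv φ) = φ := by
  ext x
  have : ν.fourierInv φ = fun x => ν.fourier φ (-x) := funext (fourierInv_eq φ)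
  rw [this, fourier_comp_neg, fourier_fourier hφ, neg_neg]

omit [ν.haar.IsAddHaarMeasure] [ProperSpace F] in
theorem integrable_mul_basicChar (hg : Integrable g ν.haar) {h : F → F} (hh : Continuous h) :
    Integrable (fun y => g y * ν.basicChar (h y)) ν.haar :=
  hg.mul_bdd (c := 1) (ν.continuous_basicChar.comp hh).aestronglyMeasurable
    (Eventually.of_forall fun y => by simp)

omit [ν.haar.IsAddHaarMeasure] [ProperSpace F] in
theorem continuous_fourier (hg : Integrable g ν.haar) : Continuous (ν.fourier g) := by
  have hc := ν.continuous_basicChar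
  refine continuous_of_dominated (bound := fun y => ‖g y‖) (fun x => ?_) (fun x => ?_) hg.norm ?_
  · exact (integrable_mul_basicChar hg (by fun_prop)).aestronglyMeasurable
  · exact Eventually.of_forall fun y => by simp
  · exact Eventually.of_forall fun y => by fun_prop

omit [ν.haar.IsAddHaarMeasure] [ProperSpace F] in
theorem fourier_sub (hf : Integrable f ν.haar) (hg : Integrable g ν.haar) (x : F) :
    ν.fourier (fun y => f y - g y) x = ν.fourier f x - ν.fourier g x := by
  simp only [fourier, fourierWith, sub_mul]
  exact integral_sub (integrable_mul_basicChar hf (by fun_prop))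
    (integrable_mul_basicChar hg (by fun_prop))

theorem integral_fourierInv_mul (hf : Integrable f ν.haar) (hg : Integrable g ν.haar) :
    ∫ x, ν.fourierInv f x * g x ∂ν.haar = ∫ x, f x * ν.fourierInv g x ∂ν.haar := by
  have hc := ν.continuous_basicChar
  have hint : Integrable (fun q : F × F => f q.2 * ν.basicChar (q.1 * q.2) * g q.1)
      (ν.haar.prod ν.haar) := by
    have h1 : Integrable (fun q : F × F => g q.1 * f q.2) (ν.haar.prod ν.haar) := hg.mul_prod hf
    have h2 := h1.mul_bdd (c := 1) (g := fun q : F × F => ν.basicChar (q.1 * q.2))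
      (by fun_prop : Continuous fun q : F × F => ν.basicChar (q.1 * q.2)).aestronglyMeasurable
      (Eventually.of_forall fun q => by simp)
    refine h2.congr (Eventually.of_forall fun q => ?_)
    dsimp only
    ring
  calc ∫ x, ν.fourierInv f x * g x ∂ν.haar
      = ∫ x, ∫ y, f y * ν.basicChar (x * y) * g x ∂ν.haar ∂ν.haar := by
        simp_rw [integral_mul_const]; rfl
    _ = ∫ y, ∫ x, f y * ν.basicChar (x * y) * g x ∂ν.haar ∂ν.haar := integral_integral_swap hint
    _ = _ := by
        congr 1
        ext y
        rw [fourierInv, ← integral_const_mul]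
        congr 1
        ext x
        rw [mul_comm x y]
        ring

theorem integral_fourier_mul (hf : Integrable f ν.haar) (hg : Integrable g ν.haar) :
    ∫ x, ν.fourier f x * g x ∂ν.haar = ∫ x, f x * ν.fourier g x ∂ν.haar := by
  have h := integral_fourierInv_mul hf (g := fun x => g (-x)) hg.comp_neg
  rw [← integral_neg_eq_self] at h
  simp only [fourierInv_eq, neg_neg, fourier_comp_neg] at h
  exact h

theorem integrable_schwartzBruhat (hφ : φ ∈ ν.schwartzBruhat) : Integrable φ ν.haar :=
  (isMellin_schwartzBruhat hφ (-1)).integrable (by norm_num) one_pos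

theorem integrable_opA_schwartzBruhat (hφ : φ ∈ ν.schwartzBruhat) :
    Integrable (ν.opA φ) ν.haar :=
  (isMellin_schwartzBruhat hφ (-1)).opA.integrable (by norm_num) one_pos

/-! ### The functional equation -/

theorem fourierInv_fourier_comp_mul_left (hφ : φ ∈ ν.schwartzBruhat) {u : F} (hu : u ≠ 0) (y : F) :
    ν.fourierInv (fun x => ν.fourier φ (u * x)) y = (ν.modulus u : ℂ)⁻¹ * φ (u⁻¹ * y) := by
  have h := ν.integral_comp_mul_left ν.haar hu
    fun x => ν.fourier φ x * ν.basicChar (u⁻¹ * y * x)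
  rw [← congrFun (fourierInv_fourier hφ) (u⁻¹ * y)]
  unfold fourierInv
  rw [← h]
  congr 1
  ext x
  congr 2
  field_simp

/-- Both products are Mellin integrals over u of pairings of one function with a dilate of another,
and the pairings agree by Parseval and the behaviour of ℱ under dilation. Only Mellin convergence of
g and ℱ⁻¹g and integrability of g are used, so that g = Aℱα is admissible. -/
theorem functional_equation {β : F → ℂ} (hg : ν.IsMellin 0 1 g) (hgi : Integrable g ν.haar)
    (hg' : ν.IsMellin 0 1 (ν.fourierInv g)) (hβ : β ∈ ν.schwartzBruhat) (χ : Fˣ →ₜ* Circle)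
    {s : ℂ} (h0 : 0 < s.re) (h1 : s.re < 1) :
    ν.mellinTransform χ g (1 - s) * ν.mellinTransform χ⁻¹ β s =
      ν.mellinTransform χ⁻¹ (ν.fourierInv g) s * ν.mellinTransform χ (ν.fourier β) (1 - s) := by
  rw [hg.mellinTransform_mul_mellinTransform (isMellin_schwartzBruhat hβ 0) χ h0 h1, mul_comm,
    (isMellin_schwartzBruhat (fourier_mem hβ) 0).mellinTransform_mul_mellinTransform hg' χ h0 h1]
  refine integral_congr_ae ?_
  filter_upwards [ν.ae_ne_zero ν.haar] with u hu
  congr 1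
  have h2 : Integrable (fun x => ν.fourier β (u * x)) ν.haar :=
    (ν.integrable_comp_mul_left ν.haar hu).2 (integrable_schwartzBruhat (fourier_mem hβ))
  rw [integral_fourierInv_mul hgi h2]
  simp_rw [fourierInv_fourier_comp_mul_left hβ hu]
  have h3 := ν.integral_comp_mul_left ν.haar hu fun y => β (u⁻¹ * y) * g y
  simp_rw [inv_mul_cancel_left₀ hu] at h3
  rw [h3, ← integral_const_mul]
  congr 1
  ext y
  ring

theorem functional_equation_schwartzBruhat {α β : F → ℂ} (hα : α ∈ ν.schwartzBruhat)
    (hβ : β ∈ ν.schwartzBruhat) (χ : Fˣ →ₜ* Circle) {s : ℂ} (h0 : 0 < s.re) (h1 : s.re < 1) :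
    ν.mellinTransform χ (ν.fourier α) (1 - s) * ν.mellinTransform χ⁻¹ β s =
      ν.mellinTransform χ⁻¹ α s * ν.mellinTransform χ (ν.fourier β) (1 - s) := by
  have hF := fourier_mem hα
  have := functional_equation (isMellin_schwartzBruhat hF 0) (integrable_schwartzBruhat hF)
    (by rw [fourierInv_fourier hα]; exact isMellin_schwartzBruhat hα 0) hβ χ h0 h1
  rwa [fourierInv_fourier hα] at this

/-! ### The Gamma function -/

omit [BorelSpace F] [ν.haar.IsAddHaarMeasure] [ProperSpace F] in
theorem isGammaFactor_iff (χ : Fˣ →ₜ* Circle) (s c : ℂ) :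
    ν.IsGammaFactor χ s c ↔ ∀ α ∈ ν.schwartzBruhat,
      ν.mellinTransform χ (ν.fourier α) (1 - s) = c * ν.mellinTransform χ⁻¹ α s := by
  simp only [IsGammaFactor, mellinTransform, neg_sub, mul_comm (ν.homogeneous _ _ _)]

variable (χ : Fˣ →ₜ* Circle) {s : ℂ}

theorem isGammaFactor_div {β : F → ℂ} (hβ : β ∈ ν.schwartzBruhat)
    (h : ν.mellinTransform χ⁻¹ β s ≠ 0) (hs : s ∈ criticalStrip) :
    ν.IsGammaFactor χ s
      (ν.mellinTransform χ (ν.fourier β) (1 - s) / ν.mellinTransform χ⁻¹ β s) := by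
  rw [isGammaFactor_iff]
  intro α hα
  rw [div_mul_eq_mul_div, eq_div_iff h,
    functional_equation_schwartzBruhat hα hβ χ hs.1 hs.2, mul_comm]

theorem existsUnique_isGammaFactor (hs : s ∈ criticalStrip) : ∃! c, ν.IsGammaFactor χ s c := by
  obtain ⟨β, hβ, -, h⟩ := exists_mellinTransform_ne_zero (ν := ν) χ⁻¹ s
  refine ⟨_, isGammaFactor_div χ hβ h hs, fun c hc => ?_⟩
  rw [eq_div_iff h, ← (isGammaFactor_iff χ s c).1 hc β hβ]

theorem isGammaFactor_gamma (hs : s ∈ criticalStrip) : ν.IsGammaFactor χ s (ν.gamma χ s) :=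
  Classical.epsilon_spec (existsUnique_isGammaFactor χ hs).exists

theorem mellinTransform_fourier (hφ : φ ∈ ν.schwartzBruhat) (hs : s ∈ criticalStrip) :
    ν.mellinTransform χ (ν.fourier φ) (1 - s) = ν.gamma χ s * ν.mellinTransform χ⁻¹ φ s :=
  (isGammaFactor_iff χ s _).1 (isGammaFactor_gamma χ hs) φ hφ

theorem gamma_eq_div {β : F → ℂ} (hβ : β ∈ ν.schwartzBruhat)
    (h : ν.mellinTransform χ⁻¹ β s ≠ 0) (hs : s ∈ criticalStrip) :
    ν.gamma χ s = ν.mellinTransform χ (ν.fourier β) (1 - s) / ν.mellinTransform χ⁻¹ β s :=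
  (existsUnique_isGammaFactor χ hs).unique (isGammaFactor_gamma χ hs) (isGammaFactor_div χ hβ h hs)

omit [ν.haar.IsAddHaarMeasure] [ProperSpace F] in
theorem IsMellin.hasDerivAt_one_sub (hg : ν.IsMellin 0 1 g) (hs : s ∈ criticalStrip) :
    HasDerivAt (fun s => ν.mellinTransform χ g (1 - s)) (ν.mellinTransform χ (ν.opA g) (1 - s)) s := by
  have h1 := hg.hasDerivAt χ (s := 1 - s) (by simpa using hs.2) (by simpa using hs.1)
  exact (h1.comp s ((hasDerivAt_id s).const_sub 1)).congr_deriv (by ring)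

/-- A single β with nonzero Mellin transform at s exhibits Γ as a quotient of differentiable
functions on a whole neighbourhood of s. -/
theorem differentiableAt_gamma (hs : s ∈ criticalStrip) : DifferentiableAt ℂ (ν.gamma χ) s := by
  obtain ⟨β, hβ, -, h⟩ := exists_mellinTransform_ne_zero (ν := ν) χ⁻¹ s
  have h1 := (isMellin_schwartzBruhat hβ 0).hasDerivAt χ⁻¹ hs.1 hs.2
  have h2 := (isMellin_schwartzBruhat (fourier_mem hβ) 0).hasDerivAt_one_sub χ hs
  refine (h2.differentiableAt.div h1.differentiableAt h).congr_of_eventuallyEq ?_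
  filter_upwards [isOpen_criticalStrip.mem_nhds hs, h1.continuousAt.eventually_ne h] with t ht hne
  exact gamma_eq_div χ hβ hne ht

theorem analyticOnNhd_gamma : AnalyticOnNhd ℂ (ν.gamma χ) criticalStrip :=
  DifferentiableOn.analyticOnNhd
    (fun _ hs => (differentiableAt_gamma χ hs).differentiableWithinAt) isOpen_criticalStrip

/-- A zero would kill the Mellin transform at 1 - s of every ℱα, hence of every Schwartz–Bruhat
function, as ℱ is onto. -/
theorem gamma_ne_zero (hs : s ∈ criticalStrip) : ν.gamma χ s ≠ 0 := by
  intro h0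
  obtain ⟨β, hβ, -, h⟩ := exists_mellinTransform_ne_zero (ν := ν) χ (1 - s)
  apply h
  have := mellinTransform_fourier χ (fourierInv_mem hβ) hs
  rwa [fourier_fourierInv hβ, h0, zero_mul] at this

end LocalPlace

namespace LocalPlace

variable {F : Type*} [NormedField F] [MeasurableSpace F] {ν : LocalPlace F} {α φ f g : F → ℂ}

/-! ### The operator `B` as a singular integral -/

omit [MeasurableSpace F] in
theorem homogeneous_one_neg_one (x : F) : ν.homogeneous 1 (-1) x = (ν.modulus x : ℂ)⁻¹ := by
  rcases eq_or_ne x 0 with rfl | hx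
  · simp [modulus_zero]
  · rw [homogeneous_of_ne _ _ _ hx, Complex.cpow_neg_one]
    simp

theorem fourier_const_mul (c : ℂ) (g : F → ℂ) (x : F) :
    ν.fourier (fun y => c * g y) x = c * ν.fourier g x := by
  simp only [fourier, fourierWith, mul_assoc, integral_const_mul]

variable [BorelSpace F] [ν.haar.IsAddHaarMeasure] [ProperSpace F]

theorem mellinTransform_one_zero (g : F → ℂ) : ν.mellinTransform 1 g 0 = ∫ x, g x ∂ν.haar := by
  refine integral_congr_ae ?_
  filter_upwards [ν.ae_ne_zero ν.haar] with x hx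
  rw [homogeneous_of_ne _ _ _ hx]
  simp

omit [ν.haar.IsAddHaarMeasure] [ProperSpace F] in
theorem integral_fourier (hφ : φ ∈ ν.schwartzBruhat) : ∫ y, ν.fourier φ y ∂ν.haar = φ 0 := by
  have h := fourier_fourier hφ 0
  rw [neg_zero] at h
  rw [← h]
  simp [fourier, fourierWith]

theorem hasDerivAt_mellinTransform_fourier (hα : α ∈ ν.schwartzBruhat) :
    HasDerivAt (ν.mellinTransform 1 (ν.fourier α)) (-∫ y, ν.opA (ν.fourier α) y ∂ν.haar) 0 := by
  have h := (isMellin_schwartzBruhat (fourier_mem hα) (-1)).hasDerivAt 1 (s := 0) (by simp) (by simp)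
  rwa [mellinTransform_one_zero] at h

theorem differentiableAt_mellinTransform_one_sub (hα : α ∈ ν.schwartzBruhat) (h0 : α 0 = 0) :
    DifferentiableAt ℂ (fun t => ν.mellinTransform 1 α (1 - t)) 0 := by
  have hd : 0 < (ν.degree : ℝ)⁻¹ := by have := ν.degree_pos; positivity
  have h := (isMellin_schwartzBruhat_of_apply_zero hα h0 0).hasDerivAt 1 (s := 1 - 0) (by simp)
    (by simpa using hd)
  exact (h.comp (0 : ℂ) ((hasDerivAt_id (0 : ℂ)).const_sub 1)).differentiableAt

/-- This is the first-order term, at t = 0, of the functional equation for the trivial character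
with s = 1 - t. The value of Z(1,ℱα,t) at 0 is ∫ℱα = α(0) = 0, so only one term of each product rule
survives; α(0) = β(0) = 0 also makes Z(1,α,1-t) and Z(1,β,1-t) differentiable at t = 0. -/
theorem integral_opA_fourier_mul_mellinTransform {β : F → ℂ} (hα : α ∈ ν.schwartzBruhat)
    (hα0 : α 0 = 0) (hβ : β ∈ ν.schwartzBruhat) (hβ0 : β 0 = 0) :
    (∫ y, ν.opA (ν.fourier α) y ∂ν.haar) * ν.mellinTransform 1 β 1 =
      ν.mellinTransform 1 α 1 * ∫ y, ν.opA (ν.fourier β) y ∂ν.haar := by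
  have h1 := ((hasDerivAt_mellinTransform_fourier hα).mul
    (differentiableAt_mellinTransform_one_sub hβ hβ0).hasDerivAt)
  have h2 := ((differentiableAt_mellinTransform_one_sub hα hα0).hasDerivAt.mul
    (hasDerivAt_mellinTransform_fourier hβ))
  rw [mellinTransform_one_zero, integral_fourier hα, hα0] at h1
  rw [mellinTransform_one_zero, integral_fourier hβ, hβ0] at h2
  -- The functional equation is available only for 0 < t < 1, so the derivatives are compared from
  -- the right.
  have h1' := (HasDerivAt.comp_ofReal (z := 0) h1).hasDerivWithinAt (s := Ioi 0)
  have h2' := (HasDerivAt.comp_ofReal (z := 0) h2).hasDerivWithinAt (s := Ioi 0)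
  have heq : (fun t : ℝ => ν.mellinTransform 1 (ν.fourier α) t * ν.mellinTransform 1 β (1 - t))
      =ᶠ[𝓝[>] 0]
      fun t : ℝ => ν.mellinTransform 1 α (1 - t) * ν.mellinTransform 1 (ν.fourier β) t := by
    filter_upwards [Ioo_mem_nhdsGT (zero_lt_one' ℝ)] with t ht
    have h3 := functional_equation_schwartzBruhat hα hβ 1 (s := 1 - t) (by simpa using ht.2)
      (by simpa using ht.1)
    rwa [sub_sub_cancel, inv_one] at h3
  have h3 := (uniqueDiffWithinAt_Ioi (0 : ℝ)).eq_deriv _ (h1'.congr_of_eventuallyEq heq.symm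
    (by simp [mellinTransform_one_zero, integral_fourier hα, integral_fourier hβ, hα0, hβ0])) h2'
  simp only [sub_zero, zero_mul, add_zero, mul_zero, zero_add] at h3
  linear_combination -h3

/-- On functions that vanish at the origin, the distribution `ℱ(log |y|)` is a multiple
of `|x|⁻¹`. -/
theorem exists_integral_opA_fourier_eq (ν : LocalPlace F) [ν.haar.IsAddHaarMeasure] :
    ∃ k : ℂ, ∀ α ∈ ν.schwartzBruhat, α 0 = 0 →
      ∫ y, ν.opA (ν.fourier α) y ∂ν.haar = k * ∫ z, (ν.modulus z : ℂ)⁻¹ * α z ∂ν.haar := by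
  obtain ⟨β, hβ, hβ0, h⟩ := exists_mellinTransform_ne_zero (ν := ν) 1 1
  refine ⟨(∫ y, ν.opA (ν.fourier β) y ∂ν.haar) / ν.mellinTransform 1 β 1, fun α hα hα0 => ?_⟩
  have h1 := integral_opA_fourier_mul_mellinTransform hα hα0 hβ hβ0
  have h2 : ∫ z, (ν.modulus z : ℂ)⁻¹ * α z ∂ν.haar = ν.mellinTransform 1 α 1 := by
    simp only [mellinTransform, homogeneous_one_neg_one]
  rw [h2]
  field_simp
  rw [h1, mul_comm]

theorem fourier_comp_sub (g : F → ℂ) (x y : F) :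
    ν.fourier (fun z => g (x - z)) y = ν.fourierInv g y * ν.basicChar (-(x * y)) := by
  simp only [fourier, fourierWith, fourierInv]
  rw [← integral_sub_left_eq_self _ _ x, ← integral_mul_const]
  congr 1
  ext z
  rw [sub_sub_cancel, mul_assoc, ← basicChar_add]
  congr 2
  ring

/-- B commutes with translations: its value at x is the distribution ℱ(log|y|) applied to z ↦ g(x -
z). -/
theorem opB_eq_integral (g : F → ℂ) (x : F) :
    ν.opB g x = ∫ y, ν.opA (ν.fourier fun z => g (x - z)) y ∂ν.haar := by
  simp only [opB, fourier, fourierWith, opA]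
  congr 1
  ext y
  have := fourier_comp_sub (ν := ν) g x y
  simp only [fourier, fourierWith] at this
  rw [this]
  ring

/-- The constant `k` in `B α (x) = k ∫ α(x - z) / |z| dz`. -/
theorem exists_opB_eq (ν : LocalPlace F) [ν.haar.IsAddHaarMeasure] :
    ∃ k : ℂ, ∀ α ∈ ν.schwartzBruhat, ∀ ρ ∈ ν.schwartzBruhat, ρ 0 = 1 → ∀ x,
      ν.opB α x = k * (∫ z, (ν.modulus z : ℂ)⁻¹ * (α (x - z) - α x * ρ z) ∂ν.haar) +
        α x * ∫ y, ν.opA (ν.fourier ρ) y ∂ν.haar := by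
  obtain ⟨k, hk⟩ := exists_integral_opA_fourier_eq ν
  refine ⟨k, fun α hα ρ hρ hρ0 x => ?_⟩
  -- Subtracting α(x)ρ from z ↦ α(x - z) makes it vanish at z = 0, where the formula with |z|⁻¹
  -- applies.
  have h1 := schwartzBruhat_comp_sub hα x
  have h2 := schwartzBruhat_const_mul hρ (α x)
  rw [opB_eq_integral, ← hk _ (schwartzBruhat_sub h1 h2) (by simp [hρ0]), ← integral_const_mul,
    ← integral_add]
  · congr 1
    ext y
    simp only [opA]
    rw [fourier_sub (integrable_schwartzBruhat h1) (integrable_schwartzBruhat h2),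
      fourier_const_mul]
    ring
  · exact integrable_opA_schwartzBruhat (fourier_mem (schwartzBruhat_sub h1 h2))
  · exact (integrable_opA_schwartzBruhat (fourier_mem hρ)).const_mul _

/-! ### Decay of `B α` -/

theorem measurable_opB (hα : α ∈ ν.schwartzBruhat) : Measurable (ν.opB α) :=
  (continuous_fourier (integrable_opA_schwartzBruhat (fourierInv_mem hα))).measurable

theorem integrable_indicator_norm_mul_inv_modulus (ν : LocalPlace F) [ν.haar.IsAddHaarMeasure] :
    Integrable ((closedBall (0 : F) 1).indicator fun z => ‖z‖ * (ν.modulus z)⁻¹) ν.haar := by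
  have hd : 0 < (ν.degree : ℝ)⁻¹ := by have := ν.degree_pos; positivity
  have hm : Measurable ((closedBall (0 : F) 1).indicator fun z => ‖z‖ * (ν.modulus z)⁻¹) :=
    (measurable_norm.mul ν.continuous_modulus.measurable.inv).indicator measurableSet_closedBall
  have h0 : ∀ z : F, 0 ≤ (closedBall (0 : F) 1).indicator (fun z => ‖z‖ * (ν.modulus z)⁻¹) z :=
    fun z => indicator_nonneg (fun z _ => mul_nonneg (norm_nonneg z)
      (inv_nonneg.2 (ν.modulus_nonneg z))) z
  refine ν.integrable_of_norm_le_rpow ν.haar hm.aestronglyMeasurable (a := (ν.degree : ℝ)⁻¹ - 1)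
    (b := -2) (C := 2 ^ ν.degree) (by linarith) (by norm_num) (fun z hz hz1 => ?_) fun z hz1 => ?_
  · have hp := ν.modulus_pos hz
    rw [Real.norm_of_nonneg (h0 z), indicator_of_mem (by simpa using hz1), Real.rpow_sub hp,
      Real.rpow_one]
    have : ν.modulus z ^ (ν.degree : ℝ)⁻¹ = ‖z‖ := by
      rw [modulus, Real.pow_rpow_inv_natCast (norm_nonneg z) ν.degree_pos.ne']
    rw [this, div_eq_mul_inv]
    exact le_mul_of_one_le_left (by positivity) (one_le_pow₀ (by norm_num))
  · rw [Real.norm_of_nonneg (h0 z)]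
    by_cases hz : z ∈ closedBall (0 : F) 1
    · have : ‖z‖ = 1 := le_antisymm (by simpa using hz) hz1
      rw [indicator_of_mem hz]
      simp only [modulus, this, one_pow, inv_one, mul_one, Real.one_rpow]
      exact one_le_pow₀ (by norm_num)
    · rw [indicator_of_notMem hz]
      have := Real.rpow_nonneg (ν.modulus_nonneg z) (-2)
      positivity

theorem integrable_pow_mul_schwartzBruhat (hα : α ∈ ν.schwartzBruhat) :
    Integrable (fun z => (1 + ‖z‖) ^ ν.degree * ‖α z‖) ν.haar := by
  -- One multiple of the degree pays for the weight, two give decay |z|⁻² for integrability at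
  -- infinity.
  obtain ⟨C, hC0, hC⟩ := schwartzBruhat_decay hα (ν.degree * 3)
  have hm := (schwartzBruhat_continuous hα)
  refine ν.integrable_of_norm_le_rpow ν.haar (by fun_prop) (a := 0)
    (b := -2) (C := C) (by norm_num) (by norm_num) (fun z hz hz1 => ?_) fun z hz1 => ?_
  · rw [Real.norm_of_nonneg (by positivity), Real.rpow_zero, mul_one]
    refine le_trans ?_ (hC z)
    gcongr
    · linarith [norm_nonneg z]
    · omega
  · have hz : z ≠ 0 := by rintro rfl; norm_num at hz1
    have hp := ν.modulus_pos hz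
    rw [Real.norm_of_nonneg (by positivity), Real.rpow_neg hp.le, ← div_eq_mul_inv,
      le_div_iff₀ (by positivity)]
    refine le_trans ?_ (hC z)
    rw [show (2 : ℝ) = (2 : ℕ) by norm_num, Real.rpow_natCast, modulus, ← pow_mul,
      show ν.degree * 3 = ν.degree + ν.degree * 2 by ring, pow_add]
    calc (1 + ‖z‖) ^ ν.degree * ‖α z‖ * ‖z‖ ^ (ν.degree * 2)
        ≤ (1 + ‖z‖) ^ ν.degree * ‖α z‖ * (1 + ‖z‖) ^ (ν.degree * 2) := by
          gcongr
          linarith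
      _ = _ := by ring

/-- In the regularised convolution, for ‖z‖ ≤ 1 the weighted Lipschitz bound beats the pole. For ‖z‖
> 1 the quotient |x|/|z| is at most (1+‖x-z‖)^d, d the degree, which the decay of α(x - z) absorbs.
The remaining terms carry α(x) and decay by themselves. -/
theorem exists_modulus_mul_norm_opB_le (hα : α ∈ ν.schwartzBruhat) :
    ∃ C, ∀ x, 1 ≤ ‖x‖ → ν.modulus x * ‖ν.opB α x‖ ≤ C := by
  obtain ⟨k, hk⟩ := exists_opB_eq ν
  obtain ⟨ρ, hρ, hρ01, hρ1, -⟩ := ν.exists_bump 0 one_pos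
  have hρ0 : ρ 0 = 1 := hρ1 0 (by simp)
  obtain ⟨C₁, hC₁0, hC₁⟩ := schwartzBruhat_lipschitz hα ν.degree
  obtain ⟨C₂, hC₂0, hC₂⟩ := schwartzBruhat_decay hα ν.degree
  have hρi : Integrable ρ ν.haar := by simpa using (integrable_schwartzBruhat hρ).re
  set b₁ := (closedBall (0 : F) 1).indicator fun z => ‖z‖ * (ν.modulus z)⁻¹
  set b₂ := fun z => (1 + ‖z‖) ^ ν.degree * ‖α z‖
  have hb₁ : Integrable b₁ ν.haar := integrable_indicator_norm_mul_inv_modulus ν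
  have hb₁0 : ∀ z, 0 ≤ b₁ z := indicator_nonneg fun z _ => mul_nonneg (norm_nonneg z)
      (inv_nonneg.2 (ν.modulus_nonneg z))
  have hb₂ : Integrable b₂ ν.haar := integrable_pow_mul_schwartzBruhat hα
  have hle : ∀ x : F, ν.modulus x ≤ (1 + ‖x‖) ^ ν.degree := fun x => by
    rw [modulus]
    gcongr
    linarith
  refine ⟨‖k‖ * (C₁ * ∫ z, b₁ z ∂ν.haar + ∫ z, b₂ z ∂ν.haar + C₂ * ∫ z, ρ z ∂ν.haar) +
    C₂ * ‖∫ y, ν.opA (ν.fourier fun y => ρ y) y ∂ν.haar‖, fun x hx => ?_⟩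
  have hxp := ν.modulus_nonneg x
  have hαx : ν.modulus x * ‖α x‖ ≤ C₂ :=
    (mul_le_mul_of_nonneg_right (hle x) (norm_nonneg _)).trans (hC₂ x)
  have hb₂x : Integrable (fun z => b₂ (x - z)) ν.haar := hb₂.comp_sub_left x
  have hsum : Integrable (fun z => C₁ * b₁ z + b₂ (x - z)) ν.haar := (hb₁.const_mul _).add hb₂x
  have hint : ‖∫ z, (ν.modulus x : ℂ) * ((ν.modulus z : ℂ)⁻¹ * (α (x - z) - α x * ρ z)) ∂ν.haar‖ ≤
      C₁ * ∫ z, b₁ z ∂ν.haar + ∫ z, b₂ z ∂ν.haar + C₂ * ∫ z, ρ z ∂ν.haar := by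
    have h1 : ∫ z, (C₁ * b₁ z + b₂ (x - z) + C₂ * ρ z) ∂ν.haar =
        C₁ * ∫ z, b₁ z ∂ν.haar + ∫ z, b₂ z ∂ν.haar + C₂ * ∫ z, ρ z ∂ν.haar := by
      rw [integral_add hsum (hρi.const_mul _),
        integral_add (hb₁.const_mul _) hb₂x, integral_const_mul, integral_const_mul,
        integral_sub_left_eq_self]
    rw [← h1]
    refine norm_integral_le_of_norm_le (hsum.add (hρi.const_mul _)) ?_
    filter_upwards [ν.ae_ne_zero ν.haar] with z hz
    have hzp := ν.modulus_pos hz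
    rw [norm_mul, norm_mul, norm_inv, Complex.norm_real, Complex.norm_real,
      Real.norm_of_nonneg hxp, Real.norm_of_nonneg hzp.le]
    have hb₂0 : 0 ≤ b₂ (x - z) := by positivity
    have hρz := hρ01 z
    by_cases hz1 : z ∈ closedBall (0 : F) 1
    · have h2 := hC₁ x z (by simpa using hz1)
      rw [hρ1 z hz1, Complex.ofReal_one, mul_one]
      have h3 : b₁ z = ‖z‖ * (ν.modulus z)⁻¹ := indicator_of_mem hz1 _
      calc ν.modulus x * ((ν.modulus z)⁻¹ * ‖α (x - z) - α x‖)
          = (ν.modulus x * ‖α (x - z) - α x‖) * (ν.modulus z)⁻¹ := by ring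
        _ ≤ (C₁ * ‖z‖) * (ν.modulus z)⁻¹ := mul_le_mul_of_nonneg_right
          ((mul_le_mul_of_nonneg_right (hle x) (norm_nonneg _)).trans h2) (inv_nonneg.2 hzp.le)
        _ = C₁ * b₁ z := by rw [h3]; ring
        _ ≤ _ := by nlinarith [mul_nonneg hC₂0 hρz.1]
    · have hz2 : 1 ≤ ‖z‖ := by simpa using (not_le.1 (by simpa using hz1)).le
      have h3 : ν.modulus x * (ν.modulus z)⁻¹ ≤ (1 + ‖x - z‖) ^ ν.degree := by
        rw [mul_inv_le_iff₀ hzp, modulus, modulus, ← mul_pow]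
        gcongr
        have := norm_add_le (x - z) z
        rw [sub_add_cancel] at this
        nlinarith [norm_nonneg (x - z)]
      have h4 : (ν.modulus z)⁻¹ ≤ 1 := inv_le_one_of_one_le₀ (ν.one_le_modulus hz2)
      calc ν.modulus x * ((ν.modulus z)⁻¹ * ‖α (x - z) - α x * ρ z‖)
          ≤ ν.modulus x * ((ν.modulus z)⁻¹ * (‖α (x - z)‖ + ‖α x‖ * ρ z)) := by
            gcongr
            refine (norm_sub_le _ _).trans_eq ?_
            rw [norm_mul, Complex.norm_real, Real.norm_of_nonneg hρz.1]
        _ = ν.modulus x * (ν.modulus z)⁻¹ * ‖α (x - z)‖ +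
            (ν.modulus z)⁻¹ * (ν.modulus x * ‖α x‖ * ρ z) := by ring
        _ ≤ (1 + ‖x - z‖) ^ ν.degree * ‖α (x - z)‖ + 1 * (C₂ * ρ z) := by
            have := hρz.1
            gcongr
        _ ≤ C₁ * b₁ z + b₂ (x - z) + C₂ * ρ z := by
            rw [one_mul]
            have := mul_nonneg hC₁0 (hb₁0 z)
            linarith
  rw [integral_const_mul, norm_mul, Complex.norm_real, Real.norm_of_nonneg hxp] at hint
  rw [hk α hα _ hρ (by simp [hρ0]) x]
  refine (mul_le_mul_of_nonneg_left (norm_add_le _ _) hxp).trans ?_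
  rw [mul_add, norm_mul, norm_mul]
  refine add_le_add ?_ ?_
  · rw [mul_left_comm]
    gcongr
  · rw [← mul_assoc]
    gcongr

/-- Boundedness near 0 and O(|x|⁻¹) at infinity are exactly what the strip 0 < σ < 1 requires. -/
theorem isMellin_opB (hα : α ∈ ν.schwartzBruhat) : ν.IsMellin 0 1 (ν.opB α) := by
  obtain ⟨C₁, h1⟩ := exists_modulus_mul_norm_opB_le hα
  refine isMellin_of_bounds (measurable_opB hα)
    (C := max C₁ (∫ y, ‖ν.opA (ν.fourierInv α) y‖ ∂ν.haar)) (fun x hx hx1 => ?_) fun x hx1 => ?_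
  · rw [sub_self, Real.rpow_zero, mul_one]
    exact (norm_fourier_le _ _).trans (le_max_right _ _)
  · have hx : x ≠ 0 := by rintro rfl; norm_num at hx1
    have hp := ν.modulus_pos hx
    rw [zero_sub, Real.rpow_neg_one, ← div_eq_mul_inv, le_div_iff₀ hp, mul_comm]
    exact (h1 x hx1).trans (le_max_left _ _)

end LocalPlace

namespace LocalPlace

variable {F : Type*} [NormedField F] [MeasurableSpace F] {ν : LocalPlace F} {α β : F → ℂ}

/-! ### The spectral identities -/

omit [MeasurableSpace F] in
theorem opA_mul (f g : F → ℂ) (x : F) : ν.opA f x * g x = f x * ν.opA g x := by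
  simp only [opA]; ring

theorem commutatorOp_apply (α : F → ℂ) (x : F) :
    ν.commutatorOp α x = -Complex.I * ν.higherCommutator 1 α x := by
  simp only [commutatorOp, higherCommutator, conductorOp, opA, Pi.smul_apply, Pi.sub_apply,
    Pi.add_apply, smul_eq_mul]
  ring

variable [BorelSpace F] [ν.haar.IsAddHaarMeasure] [ProperSpace F]

theorem fourierInv_opA_fourier (α : F → ℂ) : ν.fourierInv (ν.opA (ν.fourier α)) = ν.opB α := by
  ext x
  rw [fourierInv_eq, ← fourier_comp_neg, opB]
  congr 1
  ext y
  simp only [opA, modulus_neg, fourierInv_eq]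

theorem isMellin_conductorOp (hα : α ∈ ν.schwartzBruhat) : ν.IsMellin 0 1 (ν.conductorOp α) :=
  (isMellin_schwartzBruhat hα 0).opA.add (isMellin_opB hα)

theorem integral_opB_mul (hα : α ∈ ν.schwartzBruhat) (hβ : β ∈ ν.schwartzBruhat) :
    ∫ x, ν.opB α x * β x ∂ν.haar = ∫ x, α x * ν.opB β x ∂ν.haar := by
  rw [opB, integral_fourier_mul (integrable_opA_schwartzBruhat (fourierInv_mem hα))
    (integrable_schwartzBruhat hβ)]
  simp_rw [opA_mul]
  rw [integral_fourierInv_mul (integrable_schwartzBruhat hα)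
    (integrable_opA_schwartzBruhat (fourier_mem hβ)), fourierInv_opA_fourier]

theorem isTransposeOn_conductorOp :
    ν.IsTransposeOn ν.schwartzBruhat ν.conductorOp ν.conductorOp := by
  intro α hα β hβ
  have h : ∀ {f g : F → ℂ}, f ∈ ν.schwartzBruhat → g ∈ ν.schwartzBruhat →
      Integrable (fun x => f x * ν.conductorOp g x) ν.haar := fun hf hg =>
    ((isMellin_conductorOp hg).integrable_mul_schwartzBruhat hf).congr
      (Eventually.of_forall fun x => mul_comm _ _)
  refine ⟨(isMellin_conductorOp hα).integrable_mul_schwartzBruhat hβ, h hα hβ, ?_⟩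
  have h1 := (isMellin_schwartzBruhat hα 0).opA.integrable_mul_schwartzBruhat hβ
  have h2 := (isMellin_opB hα).integrable_mul_schwartzBruhat hβ
  have h3 : Integrable (fun x => α x * ν.opA β x) ν.haar :=
    h1.congr (Eventually.of_forall fun x => opA_mul _ _ _)
  have h4 : Integrable (fun x => α x * ν.opB β x) ν.haar :=
    ((isMellin_opB hβ).integrable_mul_schwartzBruhat hα).congr
      (Eventually.of_forall fun x => mul_comm _ _)
  simp only [conductorOp, Pi.add_apply, add_mul, mul_add]
  rw [integral_add h1 h2, integral_add h3 h4, integral_opB_mul hα hβ]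
  simp_rw [opA_mul]

variable (χ : Fˣ →ₜ* Circle) {s : ℂ}

/-- The exchange identity for g = Aℱα, whose inverse transform is Bα; the auxiliary factor
Z(χ⁻¹,β,s) cancels. -/
theorem mellinTransform_opA_fourier (hα : α ∈ ν.schwartzBruhat) (hs : s ∈ criticalStrip) :
    ν.mellinTransform χ (ν.opA (ν.fourier α)) (1 - s) =
      ν.gamma χ s * ν.mellinTransform χ⁻¹ (ν.opB α) s := by
  obtain ⟨β, hβ, -, h⟩ := exists_mellinTransform_ne_zero (ν := ν) χ⁻¹ s
  have hF := fourier_mem hα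
  have h1 := functional_equation (ν := ν) (isMellin_schwartzBruhat hF 0).opA
    (integrable_opA_schwartzBruhat hF) (by rw [fourierInv_opA_fourier]; exact isMellin_opB hα) hβ χ
    hs.1 hs.2
  rw [fourierInv_opA_fourier, mellinTransform_fourier χ hβ hs] at h1
  refine mul_right_cancel₀ h ?_
  rw [h1]
  ring

/-- Differentiate Z(χ,ℱα,1-s) = Γ Z(χ⁻¹,α,s). The left side gives Z(χ,Aℱα,1-s) = Γ Z(χ⁻¹,Bα,s), the
right side Γ' Z(χ⁻¹,α,s) - Γ Z(χ⁻¹,Aα,s); divide by Γ. -/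
theorem mellinTransform_conductorOp (hα : α ∈ ν.schwartzBruhat) (hs : s ∈ criticalStrip) :
    ν.mellinTransform χ⁻¹ (ν.conductorOp α) s =
      logDeriv (ν.gamma χ) s * ν.mellinTransform χ⁻¹ α s := by
  have hM : ν.IsMellin 0 1 α := isMellin_schwartzBruhat hα 0
  have h1 := (isMellin_schwartzBruhat (ν := ν) (fourier_mem hα) 0).hasDerivAt_one_sub χ hs
  have h2 := (differentiableAt_gamma (ν := ν) χ hs).hasDerivAt.mul (hM.hasDerivAt χ⁻¹ hs.1 hs.2)
  have h3 := h1.unique (h2.congr_of_eventuallyEq (by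
    filter_upwards [isOpen_criticalStrip.mem_nhds hs] with t ht
    exact mellinTransform_fourier χ hα ht))
  rw [mellinTransform_opA_fourier χ hα hs] at h3
  have h4 : ν.mellinTransform χ⁻¹ (ν.conductorOp α) s =
      ν.mellinTransform χ⁻¹ (ν.opA α) s + ν.mellinTransform χ⁻¹ (ν.opB α) s :=
    mellinTransform_add χ⁻¹ (hM.opA.integrable_homogeneous_mul χ⁻¹ hs.1 hs.2)
      ((isMellin_opB hα).integrable_homogeneous_mul χ⁻¹ hs.1 hs.2)
  have h5 := gamma_ne_zero (ν := ν) χ hs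
  rw [h4, logDeriv_apply]
  field_simp
  linear_combination h3

theorem distributionEigen_conductorOp (hs : s ∈ criticalStrip) :
    ν.DistributionEigen ν.schwartzBruhat ν.conductorOp (ν.homogeneous χ⁻¹ (-s))
      (logDeriv (ν.gamma χ) s) :=
  ⟨ν.conductorOp, isTransposeOn_conductorOp, fun _ hα =>
    ⟨(isMellin_schwartzBruhat hα 0).integrable_homogeneous_mul χ⁻¹ hs.1 hs.2,
    (isMellin_conductorOp hα).integrable_homogeneous_mul χ⁻¹ hs.1 hs.2,
    mellinTransform_conductorOp χ hα hs⟩⟩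

/-! ### Higher commutators -/

theorem isMellin_higherCommutator (N : ℕ) (hα : α ∈ ν.schwartzBruhatPunctured) :
    ν.IsMellin 0 1 (ν.higherCommutator N α) := by
  induction N generalizing α with
  | zero => exact isMellin_conductorOp hα.1
  | succ N ih => exact (ih hα).opA.sub (ih (opA_mem_schwartzBruhatPunctured hα))

/-- A and H are symmetric, and transposition reverses the order in each commutator. -/
theorem integral_higherCommutator_mul (N : ℕ) (hα : α ∈ ν.schwartzBruhatPunctured)
    (hβ : β ∈ ν.schwartzBruhatPunctured) :
    ∫ x, ν.higherCommutator N α x * β x ∂ν.haar =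
      (-1) ^ N * ∫ x, α x * ν.higherCommutator N β x ∂ν.haar := by
  induction N generalizing α β with
  | zero => simpa [higherCommutator] using (isTransposeOn_conductorOp α hα.1 β hβ.1).2.2
  | succ N ih =>
    have hAα := opA_mem_schwartzBruhatPunctured hα
    have hAβ := opA_mem_schwartzBruhatPunctured hβ
    have hi : ∀ {f g : F → ℂ}, f ∈ ν.schwartzBruhatPunctured → g ∈ ν.schwartzBruhatPunctured →
        Integrable (fun x => ν.higherCommutator N f x * g x) ν.haar := fun hf hg =>
      (isMellin_higherCommutator N hf).integrable_mul_schwartzBruhat hg.1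
    have hi' : ∀ {f g : F → ℂ}, f ∈ ν.schwartzBruhatPunctured → g ∈ ν.schwartzBruhatPunctured →
        Integrable (fun x => f x * ν.higherCommutator N g x) ν.haar := fun hf hg =>
      (hi hg hf).congr (Eventually.of_forall fun x => mul_comm _ _)
    have e1 : ∀ x, ν.higherCommutator (N + 1) α x * β x =
        ν.higherCommutator N α x * ν.opA β x - ν.higherCommutator N (ν.opA α) x * β x := fun x => by
      rw [← opA_mul, higherCommutator, Pi.sub_apply, sub_mul]
    have e2 : ∀ x, α x * ν.higherCommutator (N + 1) β x =
        ν.opA α x * ν.higherCommutator N β x - α x * ν.higherCommutator N (ν.opA β) x := fun x => by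
      rw [opA_mul, higherCommutator, Pi.sub_apply, mul_sub]
    simp_rw [e1, e2]
    rw [integral_sub (hi hα hAβ) (hi hAα hβ), integral_sub (hi' hAα hβ) (hi' hα hAβ), ih hα hAβ,
      ih hAα hβ, pow_succ]
    ring

theorem analyticOnNhd_logDeriv_gamma : AnalyticOnNhd ℂ (logDeriv (ν.gamma χ)) criticalStrip :=
  (analyticOnNhd_gamma χ).deriv.div (analyticOnNhd_gamma χ) fun _ hs => gamma_ne_zero χ hs

/-- In Z(A K_N α) - Z(K_N Aα) the first term is -∂/∂s of (eigenvalue · Z(α)). The part where Z(α) is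
differentiated cancels the second term, leaving minus the derivative of the eigenvalue. -/
theorem mellinTransform_higherCommutator (N : ℕ) (hα : α ∈ ν.schwartzBruhatPunctured)
    (hs : s ∈ criticalStrip) :
    ν.mellinTransform χ⁻¹ (ν.higherCommutator N α) s =
      (-1) ^ N * iteratedDeriv N (logDeriv (ν.gamma χ)) s * ν.mellinTransform χ⁻¹ α s := by
  induction N generalizing α s with
  | zero => simpa [higherCommutator] using mellinTransform_conductorOp χ hα.1 hs
  | succ N ih =>
    have hAα := opA_mem_schwartzBruhatPunctured hα
    have hM := isMellin_higherCommutator N hα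
    have h1 : ν.mellinTransform χ⁻¹ (ν.higherCommutator (N + 1) α) s =
        ν.mellinTransform χ⁻¹ (ν.opA (ν.higherCommutator N α)) s -
          ν.mellinTransform χ⁻¹ (ν.higherCommutator N (ν.opA α)) s :=
      mellinTransform_sub χ⁻¹ (hM.opA.integrable_homogeneous_mul χ⁻¹ hs.1 hs.2)
        ((isMellin_higherCommutator N hAα).integrable_homogeneous_mul χ⁻¹ hs.1 hs.2)
    have h2 : DifferentiableAt ℂ (iteratedDeriv N (logDeriv (ν.gamma χ))) s := by
      rw [iteratedDeriv_eq_iterate]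
      exact ((analyticOnNhd_logDeriv_gamma χ).iterated_deriv N s hs).differentiableAt
    have h3 := (h2.hasDerivAt.const_mul ((-1) ^ N)).mul
      ((isMellin_schwartzBruhat hα.1 0).hasDerivAt χ⁻¹ hs.1 hs.2)
    have h4 := (hM.hasDerivAt χ⁻¹ hs.1 hs.2).unique (h3.congr_of_eventuallyEq (by
      filter_upwards [isOpen_criticalStrip.mem_nhds hs] with t ht
      exact ih hα ht))
    rw [h1, ih hAα hs, iteratedDeriv_succ, pow_succ]
    linear_combination -h4

/-- The constant covers both K = -iK_1 and K_N itself. The sign (-1)^N of the transpose meets the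
sign (-1)^N of the Mellin identity. -/
theorem distributionEigen_const_mul_higherCommutator {O : (F → ℂ) → F → ℂ} {c : ℂ} (N : ℕ)
    (hO : ∀ α x, O α x = c * ν.higherCommutator N α x) (hs : s ∈ criticalStrip) :
    ν.DistributionEigen ν.schwartzBruhatPunctured O (ν.homogeneous χ⁻¹ (-s))
      (c * iteratedDeriv N (logDeriv (ν.gamma χ)) s) := by
  refine ⟨fun α x => (-1) ^ N * O α x, fun α hα β hβ => ⟨?_, ?_, ?_⟩, fun α hα => ⟨?_, ?_, ?_⟩⟩
  · simp only [hO, mul_assoc]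
    exact ((isMellin_higherCommutator N hα).integrable_mul_schwartzBruhat hβ.1).const_mul c
  · refine (((isMellin_higherCommutator N hβ).integrable_mul_schwartzBruhat hα.1).const_mul
      ((-1) ^ N * c)).congr (Eventually.of_forall fun x => ?_)
    simp only [hO]
    ring
  · simp only [hO, mul_assoc]
    rw [integral_const_mul, integral_higherCommutator_mul N hα hβ, ← integral_const_mul,
      ← integral_const_mul]
    congr 1
    ext x
    ring
  · exact (isMellin_schwartzBruhat hα.1 0).integrable_homogeneous_mul χ⁻¹ hs.1 hs.2
  · refine (((isMellin_higherCommutator N hα).integrable_homogeneous_mul χ⁻¹ hs.1 hs.2).const_mul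
      ((-1) ^ N * c)).congr (Eventually.of_forall fun x => ?_)
    simp only [hO]
    ring
  · have h1 : ∫ x, ν.homogeneous χ⁻¹ (-s) x * ((-1) ^ N * O α x) ∂ν.haar =
        (-1) ^ N * c * ν.mellinTransform χ⁻¹ (ν.higherCommutator N α) s := by
      rw [mellinTransform, ← integral_const_mul]
      congr 1
      ext x
      rw [hO]
      ring
    rw [h1, mellinTransform_higherCommutator χ N hα hs]
    have h2 : ((-1 : ℂ) ^ N) * (-1) ^ N = 1 := by rw [← mul_pow]; norm_num
    change _ = _ * ν.mellinTransform χ⁻¹ α s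
    linear_combination (c * iteratedDeriv N (logDeriv (ν.gamma χ)) s * ν.mellinTransform χ⁻¹ α s) * h2

end LocalPlace

theorem MeasureTheory.lintegral_mul_sq_le {X : Type*} [MeasurableSpace X] (μ : Measure X)
    {f g : X → ℝ≥0∞} (hf : AEMeasurable f μ) (hg : AEMeasurable g μ) :
    (∫⁻ x, f x * g x ∂μ) ^ 2 ≤ (∫⁻ x, f x ^ 2 ∂μ) * ∫⁻ x, g x ^ 2 ∂μ := by
  have h := ENNReal.lintegral_mul_le_Lp_mul_Lq μ Real.HolderConjugate.two_two hf hg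
  have h2 : ∀ a : ℝ≥0∞, (a ^ (1 / 2 : ℝ)) ^ 2 = a := fun a => by
    rw [← ENNReal.rpow_two, ← ENNReal.rpow_mul]
    norm_num
  calc (∫⁻ x, f x * g x ∂μ) ^ 2 ≤ _ := pow_le_pow_left' h 2
    _ = _ := by
      rw [mul_pow, h2, h2]
      simp_rw [ENNReal.rpow_two]

namespace LocalPlace

variable {F : Type*} [NormedField F] {ν : LocalPlace F} {α β : F → ℂ}

/-! ### The higher commutators as integral operators -/

theorem schwartzBruhatPunctured_sub (hα : α ∈ ν.schwartzBruhatPunctured)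
    (hβ : β ∈ ν.schwartzBruhatPunctured) :
    (fun x => α x - β x) ∈ ν.schwartzBruhatPunctured := by
  refine ⟨schwartzBruhat_sub hα.1 hβ.1, notMem_tsupport_iff_eventuallyEq.2 ?_⟩
  filter_upwards [notMem_tsupport_iff_eventuallyEq.1 hα.2,
    notMem_tsupport_iff_eventuallyEq.1 hβ.2] with x h1 h2
  simp [h1, h2]

theorem schwartzBruhatPunctured_const_mul (hα : α ∈ ν.schwartzBruhatPunctured) (c : ℂ) :
    (fun x => c * α x) ∈ ν.schwartzBruhatPunctured := by
  refine ⟨schwartzBruhat_const_mul hα.1 c, notMem_tsupport_iff_eventuallyEq.2 ?_⟩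
  filter_upwards [notMem_tsupport_iff_eventuallyEq.1 hα.2] with x h1
  simp [h1]

/-- Multiplication with `(c - log |y|) ^ N`. -/
theorem log_pow_mul_mem (hα : α ∈ ν.schwartzBruhatPunctured) (c : ℝ) (N : ℕ) :
    (fun y => ((c - Real.log (ν.modulus y) : ℝ) : ℂ) ^ N * α y) ∈ ν.schwartzBruhatPunctured := by
  induction N with
  | zero => simpa using hα
  | succ N ih =>
    convert schwartzBruhatPunctured_sub (schwartzBruhatPunctured_const_mul ih c)
      (opA_mem_schwartzBruhatPunctured ih) using 2 with y
    simp only [opA]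
    push_cast
    ring

variable [MeasurableSpace F] [BorelSpace F] [ν.haar.IsAddHaarMeasure] [ProperSpace F]

theorem opB_const_mul_sub (hα : α ∈ ν.schwartzBruhat) (hβ : β ∈ ν.schwartzBruhat) (c : ℂ) (x : F) :
    ν.opB (fun y => c * α y - β y) x = c * ν.opB α x - ν.opB β x := by
  have hα' := schwartzBruhat_comp_sub hα x
  have hβ' := schwartzBruhat_comp_sub hβ x
  have hcα := schwartzBruhat_const_mul hα' c
  rw [opB_eq_integral, opB_eq_integral, opB_eq_integral, ← integral_const_mul, ← integral_sub
    ((integrable_opA_schwartzBruhat (fourier_mem hα')).const_mul c)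
    (integrable_opA_schwartzBruhat (fourier_mem hβ'))]
  congr 1
  ext y
  simp only [opA]
  rw [fourier_sub (integrable_schwartzBruhat hcα) (integrable_schwartzBruhat hβ'),
    fourier_const_mul]
  ring

theorem opB_log_pow_succ_mul (hα : α ∈ ν.schwartzBruhatPunctured) (c : ℝ) (N : ℕ) (x : F) :
    ν.opB (fun y => ((c - Real.log (ν.modulus y) : ℝ) : ℂ) ^ (N + 1) * α y) x =
      c * ν.opB (fun y => ((c - Real.log (ν.modulus y) : ℝ) : ℂ) ^ N * α y) x -
        ν.opB (fun y => ((c - Real.log (ν.modulus y) : ℝ) : ℂ) ^ N * ν.opA α y) x := by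
  rw [← opB_const_mul_sub (log_pow_mul_mem hα c N).1
    (log_pow_mul_mem (opA_mem_schwartzBruhatPunctured hα) c N).1]
  congr 1
  ext y
  simp only [opA]
  push_cast
  ring

/-- A commutator with A multiplies an integral kernel by log|x| - log|y|. With x frozen, log|x| is a
mere constant inside B, and the expansion `opB_log_pow_succ_mul` drives the induction. -/
theorem higherCommutator_eq_opB (hα : α ∈ ν.schwartzBruhatPunctured) (N : ℕ) (x : F) :
    ν.higherCommutator (N + 1) α x = ν.opB (fun y =>
      ((Real.log (ν.modulus x) - Real.log (ν.modulus y) : ℝ) : ℂ) ^ (N + 1) * α y) x := by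
  induction N generalizing α with
  | zero =>
    rw [opB_log_pow_succ_mul hα]
    simp only [pow_zero, one_mul]
    -- The summand A of H commutes with A and drops out.
    change (Real.log (ν.modulus x) : ℂ) * (ν.opA α x + ν.opB α x) -
      ((Real.log (ν.modulus x) : ℂ) * ν.opA α x + ν.opB (ν.opA α) x) =
      (Real.log (ν.modulus x) : ℂ) * ν.opB α x - ν.opB (ν.opA α) x
    ring
  | succ N ih =>
    rw [opB_log_pow_succ_mul hα, ← ih hα, ← ih (opA_mem_schwartzBruhatPunctured hα),
      higherCommutator]
    rfl

/-- The kernel `|1 - u|⁻¹ |log |u||^N` of the `N`-th commutator in the multiplicative variable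
`u = y / x`. -/
noncomputable def commutatorKernel (ν : LocalPlace F) (N : ℕ) (u : F) : ℝ :=
  (ν.modulus (1 - u))⁻¹ * |Real.log (ν.modulus u)| ^ N

omit [MeasurableSpace F] [BorelSpace F] [ν.haar.IsAddHaarMeasure] [ProperSpace F] in
theorem commutatorKernel_nonneg (N : ℕ) (u : F) : 0 ≤ ν.commutatorKernel N u :=
  mul_nonneg (inv_nonneg.2 (ν.modulus_nonneg _)) (by positivity)

omit [ν.haar.IsAddHaarMeasure] [ProperSpace F] in
theorem measurable_commutatorKernel (N : ℕ) : Measurable (ν.commutatorKernel N) := by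
  have h := ν.continuous_modulus.measurable
  exact (h.comp (measurable_id.const_sub 1)).inv.mul
    ((continuous_abs.measurable.comp (Real.measurable_log.comp h)).pow_const N)

/-- The function to which B is applied vanishes at y = x, so both regularising terms disappear; y =
xu then separates x from the kernel. -/
theorem exists_enorm_higherCommutator_le (ν : LocalPlace F) [ν.haar.IsAddHaarMeasure] :
    ∃ k : ℂ, ∀ (N : ℕ), ∀ α ∈ ν.schwartzBruhatPunctured, ∀ x, x ≠ 0 →
      ‖ν.higherCommutator (N + 1) α x‖ₑ ≤
        ‖k‖ₑ * ∫⁻ u, ENNReal.ofReal (ν.commutatorKernel (N + 1) u) * ‖α (x * u)‖ₑ ∂ν.haar := by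
  obtain ⟨k, hk⟩ := exists_opB_eq ν
  obtain ⟨ρ, hρ, -, hρ1, -⟩ := ν.exists_bump 0 one_pos
  have hρ0 : ρ 0 = 1 := hρ1 0 (by simp)
  refine ⟨k, fun N α hα x hx => ?_⟩
  have hp := ν.modulus_pos hx
  rw [higherCommutator_eq_opB hα, hk _ (log_pow_mul_mem hα _ (N + 1)).1 _ hρ (by simp [hρ0])]
  simp only [sub_self, Complex.ofReal_zero, ne_eq, Nat.succ_ne_zero, not_false_eq_true, zero_pow,
    zero_mul, add_zero, sub_zero]
  rw [enorm_mul]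
  gcongr
  refine (enorm_integral_le_lintegral_enorm _).trans_eq ?_
  rw [← lintegral_sub_left_eq_self _ x]
  have h1 := ν.lintegral_comp_mul_left ν.haar hx fun y => ‖(ν.modulus (x - y) : ℂ)⁻¹ *
      (((Real.log (ν.modulus x) - Real.log (ν.modulus y) : ℝ) : ℂ) ^ (N + 1) * α y)‖ₑ
  have h2 : ENNReal.ofReal (ν.modulus x) * ENNReal.ofReal (ν.modulus x)⁻¹ = 1 := by
    rw [← ENNReal.ofReal_mul hp.le, mul_inv_cancel₀ hp.ne', ENNReal.ofReal_one]
  simp only [sub_sub_cancel]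
  rw [← one_mul (lintegral _ _), ← h2, mul_assoc, ← h1,
    ← lintegral_const_mul' _ _ ENNReal.ofReal_ne_top]
  refine lintegral_congr_ae ?_
  filter_upwards [ν.ae_ne_zero ν.haar] with u hu
  have hup := ν.modulus_pos hu
  have e1 : x - x * u = x * (1 - u) := by ring
  have e2 : Real.log (ν.modulus x) - Real.log (ν.modulus (x * u)) = -Real.log (ν.modulus u) := by
    rw [modulus_mul, Real.log_mul hp.ne' hup.ne']
    ring
  rw [e1, e2, ← mul_assoc ((ν.modulus (x * (1 - u)) : ℂ)⁻¹), enorm_mul _ (α _), ← mul_assoc]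
  congr 1
  rw [← ofReal_norm, ← ENNReal.ofReal_mul hp.le]
  congr 1
  rw [norm_mul, norm_inv, norm_pow, Complex.norm_real, Complex.norm_real, norm_neg, modulus_mul,
    Real.norm_of_nonneg (mul_nonneg hp.le (ν.modulus_nonneg _)), commutatorKernel, mul_inv,
    Real.norm_eq_abs]
  field_simp

/-! ### Integrability of the kernel -/

omit [MeasurableSpace F] [BorelSpace F] [ν.haar.IsAddHaarMeasure] [ProperSpace F] in
theorem abs_log_modulus_le {u : F} (hu : ‖u - 1‖ ≤ 1 / 2) :
    |Real.log (ν.modulus u)| ≤ ν.degree * 2 * ‖u - 1‖ := by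
  have h1 : |‖u‖ - 1| ≤ ‖u - 1‖ := by simpa using abs_norm_sub_norm_le u 1
  have h2 := abs_le.1 h1
  have h3 : 1 / 2 ≤ ‖u‖ := by linarith
  rw [modulus, Real.log_pow, abs_mul, Nat.abs_cast, mul_assoc]
  gcongr
  rw [abs_le]
  constructor
  · have h4 := Real.one_sub_inv_le_log_of_pos (show 0 < ‖u‖ by linarith)
    have h5 : ‖u‖⁻¹ - 1 ≤ 2 * ‖u - 1‖ := by
      rw [sub_le_iff_le_add, inv_le_iff_one_le_mul₀ (by linarith)]
      nlinarith
    linarith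
  · have h4 := Real.log_le_sub_one_of_pos (show 0 < ‖u‖ by linarith)
    linarith

theorem exists_abs_log_pow_le (N : ℕ) : ∃ C : ℝ, 0 ≤ C ∧ ∀ r : ℝ, 0 < r →
    |Real.log r| ^ N ≤ C * (r ^ (1 / 4 : ℝ) + r ^ (-(1 / 4) : ℝ)) := by
  rcases Nat.eq_zero_or_pos N with rfl | hN
  · refine ⟨1, zero_le_one, fun r hr => ?_⟩
    rw [pow_zero, one_mul]
    rcases le_total 1 r with h | h
    · exact (Real.one_le_rpow h (by norm_num)).trans
        (le_add_of_nonneg_right (Real.rpow_nonneg hr.le _))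
    · exact (Real.one_le_rpow_of_pos_of_le_one_of_nonpos hr h (by norm_num)).trans
        (le_add_of_nonneg_left (Real.rpow_nonneg hr.le _))
  · have hN' : (0 : ℝ) < N := by exact_mod_cast hN
    -- The N-th power then costs the exponent 1/4. Together with the weight -1/2 this leaves -3/4 at
    -- 0 and, after the factor |u|⁻¹ of the kernel, -5/4 at infinity, on the right sides of -1.
    set ε : ℝ := 1 / 4 / N with hε
    have hε0 : 0 < ε := by positivity
    refine ⟨(2 / ε) ^ N, by positivity, fun r hr => ?_⟩
    have h1 := Real.abs_log_le_rpow_add_rpow hr.le hε0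
    have hpow : ∀ t : ℝ, (r ^ t) ^ N = r ^ (t * N) := fun t => by
      rw [Real.rpow_mul hr.le, Real.rpow_natCast]
    have e1 : ε * N = 1 / 4 := by rw [hε]; field_simp
    have ha := Real.rpow_nonneg hr.le ε
    have hb := Real.rpow_nonneg hr.le (-ε)
    calc |Real.log r| ^ N ≤ ((r ^ ε + r ^ (-ε)) / ε) ^ N := by gcongr
      _ ≤ (2 / ε * max (r ^ ε) (r ^ (-ε))) ^ N := by
        gcongr
        rw [div_mul_eq_mul_div]
        gcongr
        linarith [le_max_left (r ^ ε) (r ^ (-ε)), le_max_right (r ^ ε) (r ^ (-ε))]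
      _ = (2 / ε) ^ N * max (r ^ ε) (r ^ (-ε)) ^ N := mul_pow _ _ _
      _ ≤ (2 / ε) ^ N * ((r ^ ε) ^ N + (r ^ (-ε)) ^ N) := by
        gcongr
        rcases max_choice (r ^ ε) (r ^ (-ε)) with h | h <;> rw [h]
        · exact le_add_of_nonneg_right (by positivity)
        · exact le_add_of_nonneg_left (by positivity)
      _ = _ := by rw [hpow, hpow, neg_mul, e1]

/-- Near u = 1 one factor log|u| is O(‖u-1‖) and tames the pole, which is why at least one
commutator is needed. Away from 1 the pole factor is bounded, and O(|u|⁻¹) at infinity. -/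
theorem integrable_commutatorKernel (ν : LocalPlace F) [ν.haar.IsAddHaarMeasure] (N : ℕ) :
    Integrable (fun u => ν.commutatorKernel (N + 1) u * ν.modulus u ^ (-(1 / 2) : ℝ)) ν.haar := by
  have hmeas : Measurable fun u => ν.commutatorKernel (N + 1) u * ν.modulus u ^ (-(1 / 2) : ℝ) :=
    (measurable_commutatorKernel _).mul (ν.continuous_modulus.measurable.pow_const _)
  have hnn : ∀ u, 0 ≤ ν.commutatorKernel (N + 1) u * ν.modulus u ^ (-(1 / 2) : ℝ) := fun u =>
    mul_nonneg (commutatorKernel_nonneg _ _) (Real.rpow_nonneg (ν.modulus_nonneg u) _)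
  set h := fun u => ν.commutatorKernel (N + 1) u * ν.modulus u ^ (-(1 / 2) : ℝ) with hh
  set S : Set F := closedBall 1 (1 / 2)
  have hS : MeasurableSet S := measurableSet_closedBall
  rw [← integrableOn_univ, ← union_compl_self S]
  refine IntegrableOn.union ?_ ?_
  · have hb : Integrable (fun u : F => (closedBall (0 : F) 1).indicator
        (fun z => ‖z‖ * (ν.modulus z)⁻¹) (u - 1)) ν.haar :=
      (integrable_indicator_norm_mul_inv_modulus ν).comp_sub_right 1
    refine Integrable.mono' ((hb.const_mul ((ν.degree : ℝ) ^ N * (ν.degree * 2) *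
      ((1 / 2) ^ ν.degree) ^ (-(1 / 2) : ℝ))).integrableOn) hmeas.aestronglyMeasurable ?_
    filter_upwards [ae_restrict_mem hS] with u hu
    have hu' : ‖u - 1‖ ≤ 1 / 2 := by simpa [S, dist_eq_norm] using hu
    have h1 := abs_log_modulus_le (ν := ν) hu'
    have h2 : |Real.log (ν.modulus u)| ≤ ν.degree :=
      h1.trans (by nlinarith [(Nat.cast_nonneg ν.degree : (0 : ℝ) ≤ ν.degree)])
    have h3 : (1 / 2 : ℝ) ^ ν.degree ≤ ν.modulus u := by
      rw [modulus]
      gcongr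
      have := (abs_le.1 (show |‖u‖ - 1| ≤ ‖u - 1‖ by simpa using abs_norm_sub_norm_le u 1)).1
      linarith
    have h4 : ν.modulus u ^ (-(1 / 2) : ℝ) ≤ ((1 / 2) ^ ν.degree) ^ (-(1 / 2) : ℝ) :=
      Real.rpow_le_rpow_of_nonpos (by positivity) h3 (by norm_num)
    have h5 := ν.modulus_nonneg (u - 1)
    have h6 := Real.rpow_nonneg (ν.modulus_nonneg u) (-(1 / 2))
    rw [Real.norm_of_nonneg (hnn u), indicator_of_mem (by simpa using hu'.trans (by norm_num))]
    simp only [commutatorKernel]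
    rw [← modulus_neg ν (1 - u), neg_sub, pow_succ]
    calc (ν.modulus (u - 1))⁻¹ * (|Real.log (ν.modulus u)| ^ N * |Real.log (ν.modulus u)|) *
          ν.modulus u ^ (-(1 / 2) : ℝ)
        ≤ (ν.modulus (u - 1))⁻¹ * ((ν.degree : ℝ) ^ N * (ν.degree * 2 * ‖u - 1‖)) *
          ((1 / 2) ^ ν.degree) ^ (-(1 / 2) : ℝ) := by gcongr
      _ = _ := by ring
  · rw [← integrable_indicator_iff hS.compl]
    obtain ⟨C, hC0, hC⟩ := exists_abs_log_pow_le (N + 1)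
    have hind : ∀ u, ‖Sᶜ.indicator h u‖ = Sᶜ.indicator h u := fun u =>
      Real.norm_of_nonneg (indicator_nonneg (fun u _ => hnn u) u)
    have hbound : ∀ (u : F) (M : ℝ), 0 ≤ M → u ≠ 0 → (1 / 2 < ‖u - 1‖ → (ν.modulus (1 - u))⁻¹ ≤ M) →
        Sᶜ.indicator h u ≤ M * (C * (ν.modulus u ^ (1 / 4 : ℝ) + ν.modulus u ^ (-(1 / 4) : ℝ))) *
          ν.modulus u ^ (-(1 / 2) : ℝ) := by
      intro u M hM hu hle
      have hp := ν.modulus_pos hu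
      by_cases hu1 : u ∈ Sᶜ
      · have h1 : 1 / 2 < ‖u - 1‖ := by simpa [S, dist_eq_norm] using hu1
        rw [indicator_of_mem hu1]
        simp only [hh, commutatorKernel]
        have := hle h1
        have := hC _ hp
        gcongr
      · rw [indicator_of_notMem hu1]
        positivity
    have hsmall : ∀ u : F, 1 / 2 < ‖u - 1‖ → (ν.modulus (1 - u))⁻¹ ≤ 3 ^ ν.degree := by
      intro u hu
      rw [norm_sub_rev] at hu
      rw [modulus, ← inv_pow]
      gcongr
      rw [inv_le_iff_one_le_mul₀ (by linarith)]
      linarith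
    have hlarge : ∀ u : F, u ≠ 0 → 1 / 2 < ‖u - 1‖ →
        (ν.modulus (1 - u))⁻¹ ≤ 3 ^ ν.degree * (ν.modulus u)⁻¹ := by
      intro u hu0 hu
      have h1 := norm_add_le (u - 1) 1
      rw [sub_add_cancel, norm_one] at h1
      rw [norm_sub_rev] at hu h1
      rw [modulus, modulus, ← inv_pow, ← inv_pow, ← mul_pow]
      have : 0 < ‖u‖ := norm_pos_iff.2 hu0
      gcongr
      rw [inv_le_iff_one_le_mul₀ (by linarith)]
      field_simp
      linarith
    refine ν.integrable_of_norm_le_rpow ν.haar (hmeas.indicator hS.compl).aestronglyMeasurable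
      (a := -(3 / 4)) (b := -(5 / 4)) (C := 3 ^ ν.degree * C * 2) (by norm_num) (by norm_num)
      (fun u hu hu1 => ?_) fun u hu1 => ?_
    · have hp := ν.modulus_pos hu
      rw [hind]
      refine (hbound u (3 ^ ν.degree) (by positivity) hu (hsmall u)).trans ?_
      have h1 : ν.modulus u ^ (1 / 4 : ℝ) ≤ ν.modulus u ^ (-(1 / 4) : ℝ) :=
        Real.rpow_le_rpow_of_exponent_ge hp (ν.modulus_le_one hu1) (by norm_num)
      rw [show (-(3 / 4) : ℝ) = -(1 / 4) + -(1 / 2) by norm_num, Real.rpow_add hp]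
      calc _ ≤ 3 ^ ν.degree * (C * (ν.modulus u ^ (-(1 / 4) : ℝ) + ν.modulus u ^ (-(1 / 4) : ℝ))) *
            ν.modulus u ^ (-(1 / 2) : ℝ) := by gcongr
        _ = _ := by ring
    · have hu : u ≠ 0 := by rintro rfl; norm_num at hu1
      have hp := ν.modulus_pos hu
      rw [hind]
      refine (hbound u (3 ^ ν.degree * (ν.modulus u)⁻¹) (by positivity) hu (hlarge u hu)).trans ?_
      have h1 : ν.modulus u ^ (-(1 / 4) : ℝ) ≤ ν.modulus u ^ (1 / 4 : ℝ) :=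
        Real.rpow_le_rpow_of_exponent_le (ν.one_le_modulus hu1) (by norm_num)
      rw [show (-(5 / 4) : ℝ) = -1 + 1 / 4 + -(1 / 2) by norm_num, Real.rpow_add hp,
        Real.rpow_add hp, Real.rpow_neg_one]
      calc _ ≤ 3 ^ ν.degree * (ν.modulus u)⁻¹ *
              (C * (ν.modulus u ^ (1 / 4 : ℝ) + ν.modulus u ^ (1 / 4 : ℝ))) *
            ν.modulus u ^ (-(1 / 2) : ℝ) := by gcongr
        _ = _ := by ring

/-! ### Boundedness -/

/-- An integral operator whose kernel is homogeneous of degree `-1` is bounded on `L²`. -/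
theorem lintegral_sq_lintegral_mul_le {κ : F → ℝ} (hκ : Measurable κ) (hκ0 : ∀ u, 0 ≤ κ u)
    {a : F → ℝ≥0∞} (ha : Measurable a) :
    ∫⁻ x, (∫⁻ u, ENNReal.ofReal (κ u) * a (x * u) ∂ν.haar) ^ 2 ∂ν.haar ≤
      (∫⁻ u, ENNReal.ofReal (κ u * ν.modulus u ^ (-(1 / 2) : ℝ)) ∂ν.haar) ^ 2 *
        ∫⁻ x, a x ^ 2 ∂ν.haar := by
  set A := ∫⁻ u, ENNReal.ofReal (κ u * ν.modulus u ^ (-(1 / 2) : ℝ)) ∂ν.haar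
  have hm := ν.continuous_modulus.measurable
  have hw : ∀ t : ℝ, Measurable fun u => ENNReal.ofReal (√(κ u) * ν.modulus u ^ t) := fun t =>
    (hκ.sqrt.mul (hm.pow_const t)).ennreal_ofReal
  have hsq : ∀ (t : ℝ) (u : F), ENNReal.ofReal (√(κ u) * ν.modulus u ^ t) ^ 2 =
      ENNReal.ofReal (κ u * ν.modulus u ^ (t * 2)) := fun t u => by
    rw [← ENNReal.ofReal_pow (mul_nonneg (Real.sqrt_nonneg _)
      (Real.rpow_nonneg (ν.modulus_nonneg u) _)), mul_pow, Real.sq_sqrt (hκ0 u),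
      Real.rpow_mul (ν.modulus_nonneg u), Real.rpow_two]
  -- Cauchy–Schwarz for the splitting κ a = (√κ |u|^{-1/4}) (√κ |u|^{1/4} a).
  have h1 : ∀ x, (∫⁻ u, ENNReal.ofReal (κ u) * a (x * u) ∂ν.haar) ^ 2 ≤
      A * ∫⁻ u, ENNReal.ofReal (κ u * ν.modulus u ^ (1 / 2 : ℝ)) * a (x * u) ^ 2 ∂ν.haar := by
    intro x
    have h2 := lintegral_mul_sq_le ν.haar (hw (-(1 / 4))).aemeasurable
      ((hw (1 / 4)).mul (ha.comp (measurable_const_mul x))).aemeasurable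
    simp only [Pi.mul_apply, Function.comp_apply, mul_pow, hsq] at h2
    rw [show (-(1 / 4) * 2 : ℝ) = -(1 / 2) by norm_num,
      show (1 / 4 * 2 : ℝ) = 1 / 2 by norm_num] at h2
    refine le_trans (le_of_eq ?_) h2
    congr 1
    refine lintegral_congr_ae ?_
    filter_upwards [ν.ae_ne_zero ν.haar] with u hu
    have hp := ν.modulus_pos hu
    rw [← mul_assoc, ← ENNReal.ofReal_mul (mul_nonneg (Real.sqrt_nonneg _)
      (Real.rpow_nonneg hp.le _)), mul_mul_mul_comm, Real.mul_self_sqrt (hκ0 u),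
      ← Real.rpow_add hp]
    norm_num
  calc _ ≤ ∫⁻ x, A * ∫⁻ u, ENNReal.ofReal (κ u * ν.modulus u ^ (1 / 2 : ℝ)) * a (x * u) ^ 2
          ∂ν.haar ∂ν.haar := lintegral_mono h1
    _ = A * ∫⁻ x, ∫⁻ u, ENNReal.ofReal (κ u * ν.modulus u ^ (1 / 2 : ℝ)) * a (x * u) ^ 2
          ∂ν.haar ∂ν.haar := by
        refine lintegral_const_mul _ (Measurable.lintegral_prod_right' (f := fun q : F × F =>
          ENNReal.ofReal (κ q.2 * ν.modulus q.2 ^ (1 / 2 : ℝ)) * a (q.1 * q.2) ^ 2) ?_)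
        fun_prop
    _ = A * ∫⁻ u, ∫⁻ x, ENNReal.ofReal (κ u * ν.modulus u ^ (1 / 2 : ℝ)) * a (x * u) ^ 2
          ∂ν.haar ∂ν.haar := by
        rw [lintegral_lintegral_swap]
        refine Measurable.aemeasurable (f := fun q : F × F =>
          ENNReal.ofReal (κ q.2 * ν.modulus q.2 ^ (1 / 2 : ℝ)) * a (q.1 * q.2) ^ 2) ?_
        fun_prop
    -- Dilating x by u costs |u|⁻¹ and turns |u|^{1/2} into |u|^{-1/2}, so the second factor is
    -- again `A`.
    _ = A * ∫⁻ u, ENNReal.ofReal (κ u * ν.modulus u ^ (-(1 / 2) : ℝ)) * ∫⁻ x, a x ^ 2 ∂ν.haar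
          ∂ν.haar := by
        congr 1
        refine lintegral_congr_ae ?_
        filter_upwards [ν.ae_ne_zero ν.haar] with u hu
        have hp := ν.modulus_pos hu
        simp_rw [mul_comm _ u]
        rw [lintegral_const_mul' _ _ ENNReal.ofReal_ne_top,
          ν.lintegral_comp_mul_left ν.haar hu fun x => a x ^ 2, ← mul_assoc,
          ← ENNReal.ofReal_mul (mul_nonneg (hκ0 u) (Real.rpow_nonneg hp.le _)), mul_assoc (κ u),
          ← Real.rpow_neg_one, ← Real.rpow_add hp]
        norm_num
    _ = _ := by
        have h2 : Measurable fun u => ENNReal.ofReal (κ u * ν.modulus u ^ (-(1 / 2) : ℝ)) :=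
          (hκ.mul (hm.pow_const _)).ennreal_ofReal
        rw [lintegral_mul_const _ h2, ← mul_assoc, sq]

theorem memLp_two_schwartzBruhat (hα : α ∈ ν.schwartzBruhat) : MemLp α 2 ν.haar := by
  have hc := schwartzBruhat_continuous hα
  obtain ⟨C, hC0, hC⟩ := schwartzBruhat_bounded hα
  rw [memLp_two_iff_integrable_sq_norm hc.aestronglyMeasurable]
  refine Integrable.mono' ((integrable_schwartzBruhat hα).norm.const_mul C)
    (by fun_prop) (Eventually.of_forall fun x => ?_)
  rw [Real.norm_of_nonneg (by positivity), sq]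
  gcongr
  exact hC x

theorem _root_.MeasureTheory.eLpNorm_two_sq {X E : Type*} [MeasurableSpace X] [NormedAddCommGroup E]
    (f : X → E) (μ : Measure X) : eLpNorm f 2 μ ^ 2 = ∫⁻ x, ‖f x‖ₑ ^ 2 ∂μ := by
  have h := eLpNorm_nnreal_pow_eq_lintegral (f := f) (μ := μ) (p := 2) two_ne_zero
  simpa using h

theorem isBoundedOn_higherCommutator (N : ℕ) :
    ν.IsBoundedOn ν.schwartzBruhatPunctured (ν.higherCommutator (N + 1)) := by
  obtain ⟨k, hk⟩ := exists_enorm_higherCommutator_le ν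
  set A := ∫⁻ u, ENNReal.ofReal (ν.commutatorKernel (N + 1) u * ν.modulus u ^ (-(1 / 2) : ℝ)) ∂ν.haar
    with hA
  have hAtop : A ≠ ∞ := ((hasFiniteIntegral_iff_ofReal (Eventually.of_forall fun u =>
    mul_nonneg (commutatorKernel_nonneg _ _) (Real.rpow_nonneg (ν.modulus_nonneg u) _))).1
    (integrable_commutatorKernel ν N).2).ne
  have hle : ∀ α ∈ ν.schwartzBruhatPunctured, eLpNorm (ν.higherCommutator (N + 1) α) 2 ν.haar ≤
      (‖k‖₊ * A.toNNReal : ℝ≥0) * eLpNorm α 2 ν.haar := by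
    intro α hα
    rw [← ENNReal.pow_le_pow_left_iff two_ne_zero, mul_pow, eLpNorm_two_sq, eLpNorm_two_sq,
      ENNReal.coe_mul, ENNReal.coe_toNNReal hAtop, mul_pow, mul_assoc]
    have hc := (schwartzBruhat_continuous hα.1).measurable
    calc ∫⁻ x, ‖ν.higherCommutator (N + 1) α x‖ₑ ^ 2 ∂ν.haar
        ≤ ∫⁻ x, (‖k‖ₑ * ∫⁻ u, ENNReal.ofReal (ν.commutatorKernel (N + 1) u) * ‖α (x * u)‖ₑ
            ∂ν.haar) ^ 2 ∂ν.haar := by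
          refine lintegral_mono_ae ?_
          filter_upwards [ν.ae_ne_zero ν.haar] with x hx
          exact pow_le_pow_left' (hk N α hα x hx) 2
      _ = ‖k‖ₑ ^ 2 * ∫⁻ x, (∫⁻ u, ENNReal.ofReal (ν.commutatorKernel (N + 1) u) * ‖α (x * u)‖ₑ
            ∂ν.haar) ^ 2 ∂ν.haar := by
          simp_rw [mul_pow]
          exact lintegral_const_mul' _ _ (by simp)
      _ ≤ _ := by
          refine mul_le_mul_right ?_ _
          exact lintegral_sq_lintegral_mul_le (measurable_commutatorKernel _)
            (commutatorKernel_nonneg _) hc.enorm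
  refine ⟨‖k‖₊ * A.toNNReal, fun α hα => ?_⟩
  have hα2 := memLp_two_schwartzBruhat hα.1
  exact ⟨hα2, ⟨(isMellin_higherCommutator _ hα).1.aestronglyMeasurable,
    (hle α hα).trans_lt (ENNReal.mul_lt_top ENNReal.coe_lt_top hα2.2)⟩, hle α hα⟩

end LocalPlace

/-! ### The main theorem -/

theorem mainTheorem5 {F : Type*} [NormedField F] [MeasurableSpace F] [BorelSpace F]
    (ν : LocalPlace F) :
    -- the self-dual Haar measure exists and is unique
    (∃! μ : MeasureTheory.Measure F, ν.IsSelfDualHaar μ) ∧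
    (∀ χ : Fˣ →ₜ* Circle,
      -- the Gamma function is well defined, analytic and without zeros in the critical strip
      (∀ s ∈ criticalStrip, ∃! c : ℂ, ν.IsGammaFactor χ s c) ∧
      AnalyticOnNhd ℂ (ν.gamma χ) criticalStrip ∧
      (∀ s ∈ criticalStrip, ν.gamma χ s ≠ 0) ∧
      (∀ s ∈ criticalStrip,
        -- the spectral identity for `H`, on the whole field
        ν.DistributionEigen ν.schwartzBruhat ν.conductorOp (ν.homogeneous χ⁻¹ (-s))
          (logDeriv (ν.gamma χ) s) ∧
        -- the spectral identity for `K`, on the punctured field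
        ν.DistributionEigen ν.schwartzBruhatPunctured ν.commutatorOp (ν.homogeneous χ⁻¹ (-s))
          (-Complex.I * deriv (logDeriv (ν.gamma χ)) s) ∧
        -- the spectral identities for the higher commutators `K_N`, on the punctured field
        ∀ N : ℕ, 1 ≤ N →
          ν.DistributionEigen ν.schwartzBruhatPunctured (ν.higherCommutator N)
            (ν.homogeneous χ⁻¹ (-s)) (iteratedDeriv N (logDeriv (ν.gamma χ)) s))) ∧
    -- all the higher commutators are bounded
    (∀ N : ℕ, 1 ≤ N → ν.IsBoundedOn ν.schwartzBruhatPunctured (ν.higherCommutator N)) := by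
  have := ν.properSpace
  have := ν.isAddHaarMeasure_haar
  refine ⟨ν.existsUnique_isSelfDualHaar, fun χ => ⟨fun s hs => LocalPlace.existsUnique_isGammaFactor χ hs,
    LocalPlace.analyticOnNhd_gamma χ, fun s hs => LocalPlace.gamma_ne_zero χ hs, fun s hs =>
    ⟨LocalPlace.distributionEigen_conductorOp χ hs, ?_, fun N _ => ?_⟩⟩, fun N hN => ?_⟩
  · have h := LocalPlace.distributionEigen_const_mul_higherCommutator χ 1
      LocalPlace.commutatorOp_apply (ν := ν) hs
    rwa [iteratedDeriv_one] at h
  · have h := LocalPlace.distributionEigen_const_mul_higherCommutator (ν := ν) (c := 1) χ N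
      (fun α x => (one_mul _).symm) hs
    rwa [one_mul] at h
  · obtain ⟨M, rfl⟩ := Nat.exists_eq_add_of_le' hN
    exact LocalPlace.isBoundedOn_higherCommutator M
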